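/- All Turing machines are deterministic multi-tape machines with a two-way read-only input tape, a one-way write-only output tape and finitely many work tapes; the space used is the largest number of cells used on a work tape (input and output tapes do not count). A function $\ell:\mathbb{N}\to\mathbb{R}^{\ge 0}$ is polylogarithmic if $\ell(N)=p(\log_2 N)$ for some polynomial $p$ with nonnegative integer coefficients (with $\log_2 0:=0$). The length of the encoding of an instance $x$ is denoted $|x|$. $\mathrm{2SAT}_3$ is the problem of deciding whether a given nonempty CNF formula, with one or two literals in each clause and with at most three occurrences (negated or not) of each variable, is satisfiable; $m_{vbl}(x)$ is the number of variables that appear in $x$. The *linear space hypothesis* (LSH) for $\mathrm{2SAT}_3$ states that for no $\varepsilon\in(0,1)$ and no polylogarithmic function $\ell$ is there a Turing machine that solves $\mathrm{2SAT}_3$ simultaneously in time polynomial in $|x|$ and in space at most $m_{vbl}(x)^{\varepsilon}\,\ell(|x|)$ on all instances $x$. Let $\Sigma$ be a finite alphabet with at least two symbols. An instance $x$ of the Unique Ordered Concatenation Knapsack Search Problem (Search-UOCK) over $\Sigma$ consists of a string $w\in\Sigma^*$ and a sequence $(w_1,\dots,w_n)$, $n\ge 1$, of strings over $\Sigma$ such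 that for every $i$, if $w_i$ is a substring of $w$, then there is exactly one pair $(u,v)$ with $w=uw_iv$. A solution is a sequence $(i_1,\dots,i_k)$ with $k\ge1$, $1\le i_1<\dots<i_k\le n$ and $w=w_{i_1}w_{i_2}\cdots w_{i_k}$. A machine solves the problem if on each instance it outputs some solution if one exists, and a designated symbol $\bot$ otherwise. The size parameter is $m_{elm}(x)=n$. **Theorem.** If LSH for $\mathrm{2SAT}_3$ holds, then for every finite alphabet $\Sigma$ with at least two symbols, every $\varepsilon>0$ and every polylogarithmic function $\ell$, there are no constant $C$ and no Turing machine that solves Search-UOCK over $\Sigma$ simultaneously in time polynomial in $|x|$ and in space at most $C\,m_{elm}(x)^{1/2-\varepsilon}\,\ell(|x|)$ on all instances $x$. In particular (with $\ell=1$) there is no polynomial-time $O(n^{1/2-\varepsilon})$-space algorithm for Search-UOCK parameterized by the number $n$ of strings. -/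

import Mathlib

namespace SubLin

/-! ## Multi-tape deterministic Turing machines with separate input and output tapes -/

/-- Head moves. -/
inductive Dir where
  | left
  | stay
  | right

/-- The new position of a head on a tape whose cells are numbered `0, 1, 2, …`; a move to the left
from cell `0` leaves the head where it is. -/
def Dir.apply : Dir → ℕ → ℕ
  | .left, i => i - 1
  | .stay, i => i
  | .right, i => i + 1

/-- What the input head can see: one of the two endmarkers, or an input symbol. -/
inductive InCell (A : Type) where
  | leftEnd
  | sym (a : A)
  | rightEnd

/-- The input tape for the input `x`: the left endmarker in cell `0`, the symbols of `x` in the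
cells `1, …, |x|`, the right endmarker after them. -/
def scan {A : Type} (x : List A) : ℕ → InCell A
  | 0 => .leftEnd
  | i + 1 =>
    match x[i]? with
    | some a => .sym a
    | none => .rightEnd

/-- A deterministic Turing machine with a two-way read-only input tape over `A`, a number `k` of
read-write work tapes, and a one-way write-only output tape over `B`. -/
structure Machine (A B : Type) where
  /-- inner states -/
  Q : Type
  finiteQ : Finite Q
  /-- work alphabet -/
  Γ : Type
  finiteΓ : Finite Γ
  /-- number of work tapes -/
  k : ℕ
  blank : Γ
  start : Q
  /-- accepting states (they matter only when the machine halts, and only for decision problems) -/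
  accept : Q → Prop
  /-- The transition function. From the state, the scanned input cell and the scanned work symbols
  it determines the next state, the input head's move, for each work tape the symbol to be written
  and the head's move, and possibly a symbol to be put on the output tape;
  `none` means that the machine halts. -/
  δ : Q → InCell A → (Fin k → Γ) → Option (Q × Dir × (Fin k → Γ × Dir) × Option B)

namespace Machine

variable {A B : Type}

/-- Configurations. -/
structure Config (M : Machine A B) where
  state : M.Q
  inPos : ℕ
  work : Fin M.k → ℕ → M.Γ
  workPos : Fin M.k → ℕ
  /-- the word written so far on the output tape -/
  out : List B

/-- The initial configuration: all work tapes and the output tape are blank. -/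
def init (M : Machine A B) : M.Config where
  state := M.start
  inPos := 0
  work := fun _ _ => M.blank
  workPos := fun _ => 0
  out := []

/-- The value of the transition function in a configuration on input `x`. -/
def next (M : Machine A B) (x : List A) (c : M.Config) :
    Option (M.Q × Dir × (Fin M.k → M.Γ × Dir) × Option B) :=
  M.δ c.state (scan x c.inPos) (fun i => c.work i (c.workPos i))

/-- The machine halts in the configuration `c`. -/
def Halted (M : Machine A B) (x : List A) (c : M.Config) : Prop :=
  M.next x c = none

/-- One step on input `x`; a halted configuration does not change. The input head never leaves the
part of the tape between the endmarkers. -/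
def step (M : Machine A B) (x : List A) (c : M.Config) : M.Config :=
  match M.next x c with
  | none => c
  | some (q, d, w, o) =>
    { state := q
      inPos := min (d.apply c.inPos) (x.length + 1)
      work := fun i => Function.update (c.work i) (c.workPos i) (w i).1
      workPos := fun i => (w i).2.apply (c.workPos i)
      out := c.out ++ o.toList }

/-- The configuration after `t` steps on input `x`. -/
def run (M : Machine A B) (x : List A) (t : ℕ) : M.Config :=
  (M.step x)^[t] M.init

/-- On input `x`, the machine halts after at most `T` steps. -/
def HaltsWithin (M : Machine A B) (x : List A) (T : ℕ) : Prop :=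
  M.Halted x (M.run x T)

/-- On input `x`, the machine uses at most `s` cells of each of its work tapes (the input tape and
the output tape do not count). -/
def SpaceWithin (M : Machine A B) (x : List A) (s : ℝ) : Prop :=
  ∀ (t : ℕ) (i : Fin M.k), (((M.run x t).workPos i + 1 : ℕ) : ℝ) ≤ s

/-- The machine halts on `x` in an accepting state. -/
def Accepts (M : Machine A B) (x : List A) : Prop :=
  ∃ t, M.Halted x (M.run x t) ∧ M.accept (M.run x t).state

/-- The machine halts on `x` with the word `y` on its output tape. -/
def Outputs (M : Machine A B) (x : List A) (y : List B) : Prop :=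
  ∃ t, M.Halted x (M.run x t) ∧ (M.run x t).out = y

end Machine

/-! ## Parameterized problems -/

/-- A decision problem with a size parameter; its instances are written as words over `A`. -/
structure DecisionProblem (A : Type) where
  Inst : Type
  encode : Inst → List A
  yes : Inst → Prop
  size : Inst → ℕ

/-- A search problem with a size parameter; instances are written as words over `A`, solutions as
words over `B`. -/
structure SearchProblem (A B : Type) where
  Inst : Type
  encode : Inst → List A
  /-- the solution space of an instance -/
  sol : Inst → Set (List B)
  size : Inst → ℕ

/-- The machine decides every instance of `P` correctly. -/
def DecisionProblem.SolvedBy {A : Type} (P : DecisionProblem A) (M : Machine A Empty) : Prop :=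
  ∀ x : P.Inst, M.Accepts (P.encode x) ↔ P.yes x

/-- On every instance of `P` the machine outputs a solution if there is one, and otherwise the
designated symbol `⊥` (here `none`). -/
def SearchProblem.SolvedBy {A B : Type} (P : SearchProblem A B) (M : Machine A (Option B)) : Prop :=
  ∀ x : P.Inst,
    ((P.sol x).Nonempty → ∃ y ∈ P.sol x, M.Outputs (P.encode x) (y.map some)) ∧
    (P.sol x = ∅ → M.Outputs (P.encode x) [none])

/-- Polylogarithmic functions: `ℓ(n) = p(log₂ n)` for a polynomial `p` with coefficients in `ℕ`,
where `log₂ 0 = 0`. -/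
def IsPolylog (ℓ : ℕ → ℝ) : Prop :=
  ∃ p : Polynomial ℕ, ∀ n : ℕ, ℓ n = Polynomial.aeval (Real.logb 2 (n : ℝ)) p

/-- `P` is solved by a deterministic Turing machine simultaneously in time polynomial in the input
length and in space `s (m, N)`, for `m` the size parameter and `N` the input length. -/
def DecisionProblem.SolvableInPolyTimeSpace {A : Type} (P : DecisionProblem A)
    (s : ℕ → ℕ → ℝ) : Prop :=
  ∃ (M : Machine A Empty) (p : Polynomial ℕ), P.SolvedBy M ∧
    ∀ x : P.Inst, M.HaltsWithin (P.encode x) (p.eval (P.encode x).length) ∧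
      M.SpaceWithin (P.encode x) (s (P.size x) (P.encode x).length)

/-- The same for search problems. -/
def SearchProblem.SolvableInPolyTimeSpace {A B : Type} (P : SearchProblem A B)
    (s : ℕ → ℕ → ℝ) : Prop :=
  ∃ (M : Machine A (Option B)) (p : Polynomial ℕ), P.SolvedBy M ∧
    ∀ x : P.Inst, M.HaltsWithin (P.encode x) (p.eval (P.encode x).length) ∧
      M.SpaceWithin (P.encode x) (s (P.size x) (P.encode x).length)

/-- The linear space hypothesis for a parameterized decision problem: it is not solvable in
polynomial time using `m^ε ℓ(N)` space, whatever the constant `ε ∈ (0,1)` and the polylogarithmic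
function `ℓ`. -/
def LinearSpaceHypothesis {A : Type} (P : DecisionProblem A) : Prop :=
  ∀ ε : ℝ, 0 < ε → ε < 1 → ∀ ℓ : ℕ → ℝ, IsPolylog ℓ →
    ¬ P.SolvableInPolyTimeSpace (fun m N => (m : ℝ) ^ ε * ℓ N)

/-! ## 2SAT with at most three occurrences of each variable -/

/-- A literal: a variable and its sign (`true` for the variable itself, `false` for its
negation). -/
abbrev Literal := ℕ × Bool

/-- All occurrences of variables in a CNF formula, from left to right. -/
def varOccurrences (φ : List (List Literal)) : List ℕ :=
  φ.flatten.map Prod.fst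

/-- Instances of 2SAT₃: nonempty CNF formulas whose clauses consist of one or two literals, where
every variable has, negated or not, at most three occurrences. -/
structure TwoSat3Inst where
  clauses : List (List Literal)
  clauses_ne : clauses ≠ []
  clause_len : ∀ c ∈ clauses, 1 ≤ c.length ∧ c.length ≤ 2
  occ_le : ∀ v : ℕ, (varOccurrences clauses).count v ≤ 3

/-- Some truth assignment makes a literal of each clause true. -/
def TwoSat3Inst.Satisfiable (φ : TwoSat3Inst) : Prop :=
  ∃ a : ℕ → Bool, ∀ c ∈ φ.clauses, ∃ l ∈ c, a l.1 = l.2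

/-- The number of variables that appear in the formula. -/
def TwoSat3Inst.numVars (φ : TwoSat3Inst) : ℕ :=
  (varOccurrences φ.clauses).toFinset.card

/-- Symbols in which formulas are written. -/
inductive SatSym where
  | bit (b : Bool)
  | sign (b : Bool)
  | endClause

/-- A literal is written as its sign, followed by the index of the variable in binary (least
significant bit first). -/
def encodeLiteral (l : Literal) : List SatSym :=
  .sign l.2 :: l.1.bits.map .bit

/-- A clause is written as its literals, followed by an end mark. -/
def encodeClause (c : List Literal) : List SatSym :=
  c.flatMap encodeLiteral ++ [.endClause]

/-- 2SAT₃, parameterized by the number of variables. -/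
def twoSat3 : DecisionProblem SatSym where
  Inst := TwoSat3Inst
  encode φ := φ.clauses.flatMap encodeClause
  yes := TwoSat3Inst.Satisfiable
  size := TwoSat3Inst.numVars

/-! ## The unique ordered concatenation knapsack search problem -/

/-- `z` occurs in `w` in exactly one place. -/
def IsUniqueSubstring {S : Type} (z w : List S) : Prop :=
  ∃! uv : List S × List S, w = uv.1 ++ z ++ uv.2

/-- Instances: a string `w` and a sequence `(w₁, …, wₙ)` of strings, `n ≥ 1`, such that each `wᵢ`
that is a substring of `w` is a unique substring. -/
structure UOCKInst (S : Type) where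
  w : List S
  ws : List (List S)
  ws_ne : ws ≠ []
  unique : ∀ z ∈ ws, z <:+: w → IsUniqueSubstring z w

/-- A solution: a nonempty, strictly increasing sequence of indices such that the concatenation of
the corresponding strings is `w`. Indices are counted from `0` here. -/
def UOCKInst.IsSolution {S : Type} (x : UOCKInst S) (is : List (Fin x.ws.length)) : Prop :=
  is ≠ [] ∧ is.Pairwise (· < ·) ∧ x.w = (is.map x.ws.get).flatten

/-- Symbols in which index sequences are written: bits, and an end mark. -/
inductive IdxSym where
  | bit (b : Bool)
  | endIndex

/-- Each index is written in binary (least significant bit first), counted from `1`, and is followed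
by an end mark. -/
def encodeIndices {n : ℕ} (is : List (Fin n)) : List IdxSym :=
  is.flatMap (fun i => (i.val + 1).bits.map .bit ++ [.endIndex])

/-- The unique ordered concatenation knapsack search problem over the alphabet `S`, parameterized by
the number `n` of strings. The instance is written as `w#w₁#w₂#⋯#wₙ`, with `none` as the
separator `#`. -/
def searchUOCK (S : Type) : SearchProblem (Option S) IdxSym where
  Inst := UOCKInst S
  encode x := x.w.map some ++ x.ws.flatMap (fun z => none :: z.map some)
  sol x := { y | ∃ is, x.IsSolution is ∧ y = encodeIndices is }
  size x := x.ws.length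

end SubLin

namespace SubLin

/-! A machine that solves Search-UOCK in too little space would decide 2SAT₃ in too little space. A
2CNF formula is unsatisfiable exactly if some literal and its complement reach each other in the
implication graph (`satisfiable_iff_reach`). So it is enough to decide reachability between
occurrences of literals: the vertices are the input cells that hold the sign of a literal, and the
edges are given by `Step`.

Let K = |x| + 1 and let T be the number of occurrences of literals. In a layered graph, cell p in
layer t (0 ≤ t ≤ T) has the number tK + p, and edges lead from a layer to the next one: those of
`Step`, and the edges from p to p, which pad short paths. The number j is written as the block 0 1^j
0, an edge (u, v) becomes the string of the blocks u, …, v - 1, and w consists of the blocks a, …,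
TK + b - 1. A concatenation of edge strings that equals w is a path from a in layer 0 to b in layer
T. The edges are listed layer by layer, so the required order of the indices is no restriction. A
block with j ≥ 1 occurs in w only at its own place, so the strings are unique substrings
(`isUniqueSubstring_blocks`). All this is collected in `sol_knapsack_nonempty_iff`.

Since every variable occurs at most three times, T ≤ 3m, and at most seven edges leave a vertex of a
layer. Hence n ≤ 63 m² (`length_edges_encode_le`), and n^(1/2-ε) is O(m^(2e)) for some e < 1/2,
which contradicts the hypothesis.

The instance is too long to be stored. Before every simulated step the scanned symbol is computed
anew from the formula, with counters of logarithmic length (`sym_fetch`); of the output only the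
information whether its first symbol is ⊥ is kept. The rest is programming: register programs with
bounded loops are compiled to stack programs and these to Turing machines (`Prog.exists_machine`).
The mark `hw` measures the stacks that hold the simulated tapes; all other stacks hold numbers of
polynomial size. `exists_machine_twoSat3` combines the two halves. -/

/-! ## Stack programs and their implementation by Turing machines -/

/-- Programs over a finite store `σ`, a two-way input head and stacks over `G` indexed by `ι`.
Tests and updates see the store, the scanned input cell and the tops of all stacks. -/
inductive Cmd (A σ G ι : Type) where
  | set (f : σ → InCell A → (ι → Option G) → σ)
  | move (d : Dir)
  | push (i : ι) (g : σ → (ι → Option G) → G)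
  -- There is no rule for this command in `Run`: it arises only as the second machine step of a
  -- push, when the head is already on the new cell.
  | write (i : ι) (g : G)
  | pop (i : ι)
  | seq (p q : Cmd A σ G ι)
  | ite (b : σ → InCell A → (ι → Option G) → Bool) (p q : Cmd A σ G ι)
  | loop (b : σ → InCell A → (ι → Option G) → Bool) (p : Cmd A σ G ι)

/-- The memory a stack program works on. -/
structure Mem (σ G ι : Type) where
  st : σ
  pos : ℕ
  stk : ι → List G

/-- The tops of the stacks. -/
def Mem.tops {σ G ι : Type} (m : Mem σ G ι) : ι → Option G := fun i => (m.stk i).head?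

section StackPrograms

variable {A σ G ι : Type} [DecidableEq ι]

/-- `Run x H c m t m'`: on input `x`, the program `c` leads from `m` to `m'` in `t` machine steps,
and every stack `i` keeps its height at most `H i` when something is pushed. -/
inductive Run (x : List A) (H : ι → ℕ) : Cmd A σ G ι → Mem σ G ι → ℕ → Mem σ G ι → Prop
  | set (f m) : Run x H (.set f) m 1 { m with st := f m.st (scan x m.pos) m.tops }
  | move (d m) : Run x H (.move d) m 1 { m with pos := min (d.apply m.pos) (x.length + 1) }
  | push (i g) (m : Mem σ G ι) (h : (m.stk i).length + 1 ≤ H i) :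
      Run x H (.push i g) m 2
        { m with stk := Function.update m.stk i (g m.st m.tops :: m.stk i) }
  | pop (i) (m : Mem σ G ι) :
      Run x H (.pop i) m 1 { m with stk := Function.update m.stk i (m.stk i).tail }
  | seq {p q m m' m'' t t'} (hp : Run x H p m t m') (hq : Run x H q m' t' m'') :
      Run x H (.seq p q) m (1 + t + t') m''
  | ite_true {b p q m m' t} (hb : b m.st (scan x m.pos) m.tops = true) (hp : Run x H p m t m') :
      Run x H (.ite b p q) m (1 + t) m'
  | ite_false {b p q m m' t} (hb : b m.st (scan x m.pos) m.tops = false) (hq : Run x H q m t m') :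
      Run x H (.ite b p q) m (1 + t) m'
  | loop_true {b p m m' m'' t t'} (hb : b m.st (scan x m.pos) m.tops = true)
      (hp : Run x H p m t m') (hl : Run x H (.loop b p) m' t' m'') :
      Run x H (.loop b p) m (1 + t + t') m''
  | loop_false {b p m} (hb : b m.st (scan x m.pos) m.tops = false) :
      Run x H (.loop b p) m 1 m

/-- Leave all work tapes as they are. -/
def stays (v : ι → Option G) : ι → Option G × Dir := fun i => (v i, .stay)

/-- One step of a list of programs that are to be executed one after the other. -/
def stepCont : List (Cmd A σ G ι) → σ → InCell A → (ι → Option G) →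
    Option (List (Cmd A σ G ι) × σ × Dir × (ι → Option G × Dir))
  | [], _, _, _ => none
  | .set f :: k, s, a, v => some (k, f s a v, .stay, stays v)
  | .move d :: k, s, _, v => some (k, s, d, stays v)
  | .push i g :: k, s, _, v =>
      some (.write i (g s v) :: k, s, .stay, Function.update (stays v) i (v i, .right))
  | .write i g :: k, s, _, v => some (k, s, .stay, Function.update (stays v) i (some g, .stay))
  | .pop i :: k, s, _, v => some (k, s, .stay, Function.update (stays v) i (v i, .left))
  | .seq p q :: k, s, _, v => some (p :: q :: k, s, .stay, stays v)
  | .ite b p q :: k, s, a, v => some ((if b s a v then p else q) :: k, s, .stay, stays v)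
  | .loop b p :: k, s, a, v =>
      some (if b s a v then p :: .loop b p :: k else k, s, .stay, stays v)

/-- The lists of programs that occur while `c` is executed before `k`. -/
def conts : Cmd A σ G ι → List (Cmd A σ G ι) → Set (List (Cmd A σ G ι))
  | .set f, k => {.set f :: k}
  | .move d, k => {.move d :: k}
  | .push i g, k => {.push i g :: k} ∪ Set.range (fun g' => .write i g' :: k)
  | .write i g, k => {.write i g :: k}
  | .pop i, k => {.pop i :: k}
  | .seq p q, k => {.seq p q :: k} ∪ conts p (q :: k) ∪ conts q k
  | .ite b p q, k => {.ite b p q :: k} ∪ conts p k ∪ conts q k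
  | .loop b p, k => {.loop b p :: k} ∪ conts p (.loop b p :: k)

omit [DecidableEq ι] in
theorem mem_conts (c : Cmd A σ G ι) (k) : c :: k ∈ conts c k := by
  cases c <;> simp [conts]

-- This makes lists of programs usable as states of a machine. Only a push contributes more than one
-- list of its own, one for each symbol of the finite alphabet `G`.
omit [DecidableEq ι] in
theorem finite_conts [Finite G] (c : Cmd A σ G ι) (k) : (conts c k).Finite := by
  induction c generalizing k with
  | seq p q hp hq => exact ((Set.finite_singleton _).union (hp _)).union (hq _)
  | ite b p q hp hq => exact ((Set.finite_singleton _).union (hp _)).union (hq _)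
  | loop b p hp => exact (Set.finite_singleton _).union (hp _)
  | push i g => exact (Set.finite_singleton _).union (Set.finite_range _)
  | _ => exact Set.finite_singleton _

/-- While `c` is executed before `k`, the control stays in the finite set `conts c k` until exactly
`k` is left. A loop fits in because its body runs in front of the loop itself. -/
theorem stepCont_mem (c : Cmd A σ G ι) (k l) (hl : l ∈ conts c k) {s a v r}
    (hr : stepCont l s a v = some r) : r.1 = k ∨ r.1 ∈ conts c k := by
  induction c generalizing k with
  | seq p q hp hq =>
    rcases hl with (rfl | hl) | hl
    · simp only [stepCont, Option.some.injEq] at hr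
      subst hr
      exact .inr (.inl (.inr (mem_conts p _)))
    · rcases hp _ hl with h | h
      · exact .inr (.inr (h ▸ mem_conts q _))
      · exact .inr (.inl (.inr h))
    · rcases hq _ hl with h | h
      · exact .inl h
      · exact .inr (.inr h)
  | ite b p q hp hq =>
    rcases hl with (rfl | hl) | hl
    · simp only [stepCont, Option.some.injEq] at hr
      subst hr
      by_cases hb : b s a v
      · simp only [hb, if_true]
        exact .inr (.inl (.inr (mem_conts p _)))
      · simp only [hb]
        exact .inr (.inr (mem_conts q _))
    · rcases hp _ hl with h | h
      · exact .inl h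
      · exact .inr (.inl (.inr h))
    · rcases hq _ hl with h | h
      · exact .inl h
      · exact .inr (.inr h)
  | loop b p hp =>
    rcases hl with rfl | hl
    · simp only [stepCont, Option.some.injEq] at hr
      subst hr
      by_cases hb : b s a v
      · simp only [hb, if_true]
        exact .inr (.inr (mem_conts p _))
      · simp [hb]
    · rcases hp _ hl with h | h
      · exact .inr (.inl h)
      · exact .inr (.inr h)
  | push i g =>
    rcases hl with rfl | ⟨g', rfl⟩
    · simp only [stepCont, Option.some.injEq] at hr
      subst hr
      exact .inr (.inr ⟨_, rfl⟩)
    · simp only [stepCont, Option.some.injEq] at hr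
      subst hr
      exact .inl rfl
  | _ =>
    obtain rfl := hl
    simp only [stepCont, Option.some.injEq] at hr
    subst hr
    exact .inl rfl

/-- The states of the control of the machine for `c`. -/
def control (c : Cmd A σ G ι) : Set (List (Cmd A σ G ι)) := insert [] (conts c [])

theorem stepCont_mem_control (c : Cmd A σ G ι) {l} (hl : l ∈ control c) {s a v r}
    (hr : stepCont l s a v = some r) : r.1 ∈ control c := by
  rcases hl with rfl | hl
  · simp [stepCont] at hr
  · rcases stepCont_mem c [] l hl hr with h | h
    · exact .inl h
    · exact .inr h

open Classical in
/-- The Turing machine that executes the program `c`. -/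
noncomputable def Cmd.machine [Finite ι] [Finite σ] [Finite G] (c : Cmd A σ G ι) (s₀ : σ)
    (acc : σ → Prop) : Machine A Empty where
  Q := control c × σ
  finiteQ := by
    have : Finite (control c) := ((finite_conts c []).insert []).to_subtype
    infer_instance
  Γ := Option G
  finiteΓ := inferInstance
  k := Nat.card ι
  blank := none
  start := (⟨[c], .inr (mem_conts c [])⟩, s₀)
  accept q := acc q.2
  δ q a w := (stepCont q.1.1 q.2 a (fun i => w (Finite.equivFin ι i))).bind fun r =>
    -- The test never fails, by `stepCont_mem_control`; it only supplies the membership proof that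
    -- is part of the new state.
    if h : r.1 ∈ control c then
      some ((⟨r.1, h⟩, r.2.1), r.2.2.1, fun j => r.2.2.2 ((Finite.equivFin ι).symm j), none)
    else none

/-- A tape that holds a stack: cell `0` is blank, and the stack starts in cell `1`. -/
def Holds (f : ℕ → Option G) : List G → Prop
  | [] => f 0 = none
  | g :: l => f (l.length + 1) = some g ∧ Holds f l

theorem Holds.top {f : ℕ → Option G} : ∀ {l : List G}, Holds f l → f l.length = l.head?
  | [], h => h
  | _ :: _, h => h.1

theorem Holds.tail {f : ℕ → Option G} : ∀ {l : List G}, Holds f l → Holds f l.tail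
  | [], h => h
  | _ :: _, h => h.2

/-- `Holds` says nothing about the cells above the top. So the symbols that pops leave behind do no
harm, and a cell above the top may be overwritten. -/
theorem Holds.update {f : ℕ → Option G} (n : ℕ) (g : Option G) :
    ∀ {l : List G}, Holds f l → l.length < n → Holds (Function.update f n g) l
  | [], h, hn => by
    simp only [Holds, List.length_nil] at *
    rw [Function.update_of_ne (by omega)]
    exact h
  | _ :: l, h, hn => by
    simp only [Holds, List.length_cons] at *
    exact ⟨by rw [Function.update_of_ne (by omega)]; exact h.1, h.2.update n g (by omega)⟩

variable [Finite ι] [Finite σ] [Finite G] {c : Cmd A σ G ι} {s₀ : σ} {acc : σ → Prop}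

/-- The contents of the work tape that holds the stack `i`. -/
noncomputable def tape (C : (c.machine s₀ acc).Config) (i : ι) : ℕ → Option G := C.work (Finite.equivFin ι i)

/-- The position of the head on the work tape that holds the stack `i`. -/
noncomputable def head (C : (c.machine s₀ acc).Config) (i : ι) : ℕ := C.workPos (Finite.equivFin ι i)

/-- The programs that are still to be executed. -/
def todo (C : (c.machine s₀ acc).Config) : List (Cmd A σ G ι) := C.state.1.1

/-- The store of a configuration. -/
def store (C : (c.machine s₀ acc).Config) : σ := C.state.2

/-- Describes a step with tapes indexed by `ι`; the numbering `Finite.equivFin` used in the machine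
does not appear any more in what follows. -/
theorem step_spec {C : (c.machine s₀ acc).Config} (x : List A) {k s d w}
    (hs : stepCont (todo C) (store C) (scan x C.inPos) (fun i => tape C i (head C i)) =
      some (k, s, d, w)) :
    todo ((c.machine s₀ acc).step x C) = k ∧ store ((c.machine s₀ acc).step x C) = s ∧
      ((c.machine s₀ acc).step x C).inPos = min (d.apply C.inPos) (x.length + 1) ∧
      ∀ i, tape ((c.machine s₀ acc).step x C) i =
          Function.update (tape C i) (head C i) (w i).1 ∧
        head ((c.machine s₀ acc).step x C) i = (w i).2.apply (head C i) := by
  have hk : k ∈ control c := stepCont_mem_control c C.state.1.2 hs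
  have hn : (c.machine s₀ acc).next x C =
      some ((⟨k, hk⟩, s), d, fun j => w ((Finite.equivFin ι).symm j), none) := by
    simp only [Machine.next, Cmd.machine]
    change (stepCont (todo C) (store C) (scan x C.inPos)
      (fun i => tape C i (head C i))).bind _ = _
    rw [hs]
    simp [hk]
  have : (c.machine s₀ acc).step x C =
      { state := (⟨k, hk⟩, s)
        inPos := min (d.apply C.inPos) (x.length + 1)
        work := fun j => Function.update (C.work j) (C.workPos j)
          (w ((Finite.equivFin ι).symm j)).1
        workPos := fun j => (w ((Finite.equivFin ι).symm j)).2.apply (C.workPos j)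
        out := C.out } := by
    simp only [Machine.step, hn]
    simp
  rw [this]
  refine ⟨rfl, rfl, rfl, fun i => ⟨?_, ?_⟩⟩
  · change Function.update (tape C i) (head C i) (w ((Finite.equivFin ι).symm _)).1 = _
    rw [Equiv.symm_apply_apply]
  · change (w ((Finite.equivFin ι).symm _)).2.apply (head C i) = _
    rw [Equiv.symm_apply_apply]

/-- The machine for `c` is in a configuration with memory `m` that is going to execute `l`. -/
structure Represents (l : List (Cmd A σ G ι)) (m : Mem σ G ι)
    (C : (c.machine s₀ acc).Config) : Prop where
  todo_eq : todo C = l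
  store_eq : store C = m.st
  pos_eq : C.inPos = m.pos
  head_eq : ∀ i, head C i = (m.stk i).length
  holds : ∀ i, Holds (tape C i) (m.stk i)

theorem Represents.tops {l : List (Cmd A σ G ι)} {m : Mem σ G ι}
    {C : (c.machine s₀ acc).Config} (h : Represents l m C) :
    (fun i => tape C i (head C i)) = m.tops := by
  funext i
  rw [h.head_eq i]
  exact (h.holds i).top

/-- `t` steps of the machine, during which the height of no stack exceeds its bound. -/
def Leads (x : List A) (H : ι → ℕ) (C : (c.machine s₀ acc).Config) (t : ℕ)
    (C' : (c.machine s₀ acc).Config) : Prop :=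
  ((c.machine s₀ acc).step x)^[t] C = C' ∧
    ∀ u ≤ t, ∀ i, head (((c.machine s₀ acc).step x)^[u] C) i ≤ H i

theorem Leads.trans {x : List A} {H : ι → ℕ} {C C' C'' : (c.machine s₀ acc).Config} {t t' : ℕ}
    (h : Leads x H C t C') (h' : Leads x H C' t' C'') : Leads x H C (t + t') C'' := by
  refine ⟨by rw [add_comm, Function.iterate_add_apply, h.1, h'.1], fun u hu i => ?_⟩
  by_cases hut : u ≤ t
  · exact h.2 u hut i
  · have := h'.2 (u - t) (by omega) i
    rwa [← h.1, ← Function.iterate_add_apply, Nat.sub_add_cancel (by omega)] at this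

theorem Leads.single {x : List A} {H : ι → ℕ} {C : (c.machine s₀ acc).Config}
    (h1 : ∀ i, head C i ≤ H i) (h2 : ∀ i, head ((c.machine s₀ acc).step x C) i ≤ H i) :
    Leads x H C 1 ((c.machine s₀ acc).step x C) := by
  refine ⟨rfl, fun u hu i => ?_⟩
  interval_cases u
  · exact h1 i
  · exact h2 i

/-- Covers all commands that leave the stacks alone: every head writes the symbol that it has just
read. -/
theorem Represents.still {l : List (Cmd A σ G ι)} {m : Mem σ G ι}
    {C : (c.machine s₀ acc).Config} (h : Represents l m C) (x : List A) {H : ι → ℕ} {k s d}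
    (hs : stepCont l m.st (scan x m.pos) m.tops = some (k, s, d, stays m.tops))
    (hH : ∀ i, (m.stk i).length ≤ H i) :
    ∃ C', Leads x H C 1 C' ∧
      Represents k ⟨s, min (d.apply m.pos) (x.length + 1), m.stk⟩ C' := by
  obtain ⟨e1, e2, e3, e4⟩ := step_spec x
    (by rw [h.todo_eq, h.store_eq, h.pos_eq, h.tops]; exact hs)
  have e5 : ∀ i, head ((c.machine s₀ acc).step x C) i = (m.stk i).length := fun i => by
    rw [(e4 i).2, h.head_eq]; rfl
  refine ⟨_, Leads.single ?_ ?_, ⟨e1, e2, by rw [e3, h.pos_eq], e5, ?_⟩⟩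
  · intro i; rw [h.head_eq]; exact hH i
  · intro i; rw [e5]; exact hH i
  · intro i
    have : Function.update (tape C i) (head C i) (stays m.tops i).1 = tape C i := by
      rw [Function.update_eq_self_iff, h.head_eq]
      exact (h.holds i).top.symm
    rw [(e4 i).1, this]
    exact h.holds i

theorem Represents.of_stay {l : List (Cmd A σ G ι)} {m : Mem σ G ι}
    {C : (c.machine s₀ acc).Config} {x : List A} {s : σ}
    (hp : m.pos ≤ x.length + 1)
    (h : Represents l ⟨s, min (Dir.stay.apply m.pos) (x.length + 1), m.stk⟩ C) :
    Represents l ⟨s, m.pos, m.stk⟩ C := by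
  simpa [Dir.apply, hp] using h

/-- A pop is a mere move to the left. On an empty stack the head is in cell 0 and remains there, in
agreement with `[].tail = []`. -/
theorem Represents.pop {k : List (Cmd A σ G ι)} {m : Mem σ G ι} {i : ι}
    {C : (c.machine s₀ acc).Config} (h : Represents (.pop i :: k) m C) (x : List A) {H : ι → ℕ}
    (hp : m.pos ≤ x.length + 1) (hH : ∀ i, (m.stk i).length ≤ H i) :
    ∃ C', Leads x H C 1 C' ∧
      Represents k ⟨m.st, m.pos, Function.update m.stk i (m.stk i).tail⟩ C' := by
  obtain ⟨e1, e2, e3, e4⟩ := step_spec x (C := C)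
    (by rw [h.todo_eq, h.store_eq, h.pos_eq, h.tops]; rfl)
  have e5 : ∀ j, tape ((c.machine s₀ acc).step x C) j = tape C j := fun j => by
    rw [(e4 j).1, Function.update_eq_self_iff, h.head_eq, (h.holds j).top]
    by_cases hj : j = i
    · subst hj; simp [Mem.tops]
    · simp [hj, stays, Mem.tops]
  have e6 : ∀ j, head ((c.machine s₀ acc).step x C) j =
      (Function.update m.stk i (m.stk i).tail j).length := fun j => by
    rw [(e4 j).2, h.head_eq]
    by_cases hj : j = i
    · subst hj; simp [Dir.apply]
    · simp [hj, stays, Dir.apply]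
  refine ⟨_, Leads.single ?_ ?_, ⟨e1, e2, ?_, e6, ?_⟩⟩
  · intro j; rw [h.head_eq]; exact hH j
  · intro j
    rw [e6]
    by_cases hj : j = i
    · subst hj; simpa using (Nat.sub_le _ _).trans (hH j)
    · simpa [hj] using hH j
  · rw [e3, h.pos_eq]; simp [Dir.apply, hp]
  · intro j
    rw [e5]
    by_cases hj : j = i
    · subst hj; simpa using (h.holds j).tail
    · simpa [hj] using h.holds j

/-- A machine writes before it moves. So the head goes to the cell above the top in one step, and
the new symbol is written in the next one. -/
theorem Represents.push {k : List (Cmd A σ G ι)} {m : Mem σ G ι} {i : ι} {g}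
    {C : (c.machine s₀ acc).Config} (h : Represents (.push i g :: k) m C) (x : List A) {H : ι → ℕ}
    (hp : m.pos ≤ x.length + 1) (hH : ∀ i, (m.stk i).length ≤ H i)
    (hi : (m.stk i).length + 1 ≤ H i) :
    ∃ C', Leads x H C 2 C' ∧ Represents k
      ⟨m.st, m.pos, Function.update m.stk i (g m.st m.tops :: m.stk i)⟩ C' := by
  obtain ⟨e1, e2, e3, e4⟩ := step_spec x (C := C)
    (by rw [h.todo_eq, h.store_eq, h.pos_eq, h.tops]; rfl)
  have e5 : ∀ j, tape ((c.machine s₀ acc).step x C) j = tape C j := fun j => by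
    rw [(e4 j).1, Function.update_eq_self_iff, h.head_eq, (h.holds j).top]
    by_cases hj : j = i
    · subst hj; simp [Mem.tops]
    · simp [hj, stays, Mem.tops]
  have e6 : ∀ j, head ((c.machine s₀ acc).step x C) j =
      (m.stk j).length + (if j = i then 1 else 0) := fun j => by
    rw [(e4 j).2, h.head_eq]
    by_cases hj : j = i
    · subst hj; simp [Dir.apply]
    · simp [hj, stays, Dir.apply]
  have e3' : ((c.machine s₀ acc).step x C).inPos = m.pos := by
    rw [e3, h.pos_eq]; simp [Dir.apply, hp]
  obtain ⟨f1, f2, f3, f4⟩ := step_spec x (C := (c.machine s₀ acc).step x C)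
    (by rw [e1]; rfl)
  have f6 : ∀ j, head ((c.machine s₀ acc).step x ((c.machine s₀ acc).step x C)) j =
      (m.stk j).length + (if j = i then 1 else 0) := fun j => by
    rw [(f4 j).2, e6]
    by_cases hj : j = i
    · subst hj; simp [Dir.apply]
    · simp [hj, stays, Dir.apply]
  have hle : ∀ j, (m.stk j).length + (if j = i then 1 else 0) ≤ H j := by
    intro j
    split_ifs with hj
    · subst hj; exact hi
    · exact hH j
  refine ⟨_, (Leads.single ?_ ?_).trans (Leads.single ?_ ?_),
    ⟨f1, f2.trans e2, ?_, ?_, ?_⟩⟩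
  · intro j; rw [h.head_eq]; exact hH j
  · intro j; rw [e6]; exact hle j
  · intro j; rw [e6]; exact hle j
  · intro j; rw [f6]; exact hle j
  · rw [f3, e3']; simp [Dir.apply, hp]
  · intro j
    rw [f6]
    by_cases hj : j = i
    · subst hj; simp
    · simp [hj]
  · intro j
    rw [(f4 j).1, e6, e5]
    by_cases hj : j = i
    · subst hj
      simp only [Function.update_self, if_true]
      exact ⟨by simp, (h.holds j).update _ _ (by simp)⟩
    · simp only [hj, ne_eq, not_false_eq_true, Function.update_of_ne, stays, if_false, e5, e6,
        add_zero, Function.update_eq_self]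
      exact h.holds j

/-- Induction on the execution. The list `k` of what remains to be done has to be arbitrary, since
parts of a program run in front of its other parts. -/
theorem Run.leads {x : List A} {H : ι → ℕ} {p : Cmd A σ G ι} {m m' : Mem σ G ι} {t : ℕ}
    (hr : Run x H p m t m') (hp : m.pos ≤ x.length + 1)
    (hH : ∀ i, (m.stk i).length ≤ H i) {k : List (Cmd A σ G ι)}
    {C : (c.machine s₀ acc).Config} (h : Represents (p :: k) m C) :
    (m'.pos ≤ x.length + 1 ∧ ∀ i, (m'.stk i).length ≤ H i) ∧
      ∃ C', Leads x H C t C' ∧ Represents k m' C' := by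
  induction hr generalizing k C with
  | set f m =>
    obtain ⟨C', h1, h2⟩ := h.still x rfl hH
    exact ⟨⟨hp, hH⟩, C', h1, h2.of_stay hp⟩
  | move d m =>
    obtain ⟨C', h1, h2⟩ := h.still x rfl hH
    exact ⟨⟨min_le_right _ _, hH⟩, C', h1, h2⟩
  | push i g m hi =>
    refine ⟨⟨hp, fun j => ?_⟩, h.push x hp hH hi⟩
    by_cases hj : j = i
    · subst hj; simpa using hi
    · simpa [hj] using hH j
  | pop i m =>
    refine ⟨⟨hp, fun j => ?_⟩, h.pop x hp hH⟩
    by_cases hj : j = i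
    · subst hj; simpa using (Nat.sub_le _ _).trans (hH j)
    · simpa [hj] using hH j
  | seq hp' hq ih1 ih2 =>
    obtain ⟨C1, h1, h2⟩ := h.still x rfl hH
    obtain ⟨⟨g1, g2⟩, C2, h3, h4⟩ := ih1 hp hH (h2.of_stay hp)
    obtain ⟨g, C3, h5, h6⟩ := ih2 g1 g2 h4
    exact ⟨g, C3, (h1.trans h3).trans h5, h6⟩
  | @ite_true b p q m m' t hb hp' ih =>
    obtain ⟨C1, h1, h2⟩ := h.still x (k := p :: k) (by simp only [stepCont, hb, if_true]; rfl) hH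
    obtain ⟨g, C2, h3, h4⟩ := ih hp hH (h2.of_stay hp)
    exact ⟨g, C2, h1.trans h3, h4⟩
  | @ite_false b p q m m' t hb hp' ih =>
    obtain ⟨C1, h1, h2⟩ := h.still x (k := q :: k) (by simp only [stepCont, hb]; rfl) hH
    obtain ⟨g, C2, h3, h4⟩ := ih hp hH (h2.of_stay hp)
    exact ⟨g, C2, h1.trans h3, h4⟩
  | @loop_true b p m m' m'' t t' hb hp' hl ih1 ih2 =>
    obtain ⟨C1, h1, h2⟩ := h.still x (k := p :: .loop b p :: k)
      (by simp only [stepCont, hb, if_true]; rfl) hH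
    obtain ⟨⟨g1, g2⟩, C2, h3, h4⟩ := ih1 hp hH (h2.of_stay hp)
    obtain ⟨g, C3, h5, h6⟩ := ih2 g1 g2 h4
    exact ⟨g, C3, (h1.trans h3).trans h5, h6⟩
  | loop_false hb =>
    obtain ⟨C1, h1, h2⟩ := h.still x (k := k) (by simp only [stepCont, hb]; rfl) hH
    exact ⟨⟨hp, hH⟩, C1, h1, h2.of_stay hp⟩

theorem Machine.run_eq_of_halted {B : Type} {M : Machine A B} {x : List A} {t u : ℕ}
    (h : M.Halted x (M.run x t)) (hu : t ≤ u) : M.run x u = M.run x t := by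
  have hfix : M.step x (M.run x t) = M.run x t := by
    simp only [Machine.Halted] at h
    simp only [Machine.step, h]
  obtain ⟨d, rfl⟩ := Nat.exists_eq_add_of_le hu
  induction d with
  | zero => rfl
  | succ d ih =>
    rw [← add_assoc, Machine.run, Function.iterate_succ_apply']
    change M.step x (M.run x (t + d)) = _
    rw [ih (by omega), hfix]

theorem Machine.run_eq_run_of_halted {B : Type} {M : Machine A B} {x : List A} {t u : ℕ}
    (h : M.Halted x (M.run x t)) (h' : M.Halted x (M.run x u)) : M.run x t = M.run x u := by
  rcases le_total t u with htu | htu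
  · exact (Machine.run_eq_of_halted h htu).symm
  · exact Machine.run_eq_of_halted h' htu

/-- A terminating execution of a stack program bounds the resources of its Turing machine and
determines whether it accepts. -/
theorem Run.machine {x : List A} {H : ι → ℕ} {m' : Mem σ G ι} {t : ℕ}
    (hr : Run x H c ⟨s₀, 0, fun _ => []⟩ t m') :
    (c.machine s₀ acc).HaltsWithin x t ∧
      (∀ u j, ∃ i, ((c.machine s₀ acc).run x u).workPos j ≤ H i) ∧
      ((c.machine s₀ acc).Accepts x ↔ acc m'.st) := by
  have h0 : Represents (c := c) (s₀ := s₀) (acc := acc) [c] ⟨s₀, 0, fun _ => []⟩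
      (c.machine s₀ acc).init :=
    ⟨rfl, rfl, rfl, fun i => rfl, fun i => rfl⟩
  obtain ⟨-, C', h1, h2⟩ := hr.leads (Nat.zero_le _) (fun i => Nat.zero_le _) h0
  have hrun : (c.machine s₀ acc).run x t = C' := h1.1
  have hh : (c.machine s₀ acc).HaltsWithin x t := by
    rw [Machine.HaltsWithin, hrun, Machine.Halted, Machine.next]
    simp only [Cmd.machine]
    change (stepCont (todo C') _ _ _).bind _ = none
    rw [h2.todo_eq]
    rfl
  refine ⟨hh, fun u j => ?_, ⟨fun ⟨u, hu, ha⟩ => ?_, fun ha => ⟨t, hh, ?_⟩⟩⟩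
  · obtain ⟨i, rfl⟩ := (Finite.equivFin ι).surjective j
    refine ⟨i, ?_⟩
    -- After `t` steps the configuration is constant, so the bound up to time `t` is a bound for all
    -- times.
    rcases le_total u t with hut | hut
    · exact h1.2 u hut i
    · rw [Machine.run_eq_of_halted hh hut]
      exact h1.2 t le_rfl i
  · rw [← Machine.run_eq_run_of_halted hh hu, hrun] at ha
    have : acc (store C') := ha
    rwa [h2.store_eq] at this
  · change acc (store _)
    rw [hrun, h2.store_eq]
    exact ha

end StackPrograms


/-! ## Execution of stack programs within given time -/

section Exec

variable {A σ G ι : Type} [DecidableEq ι] {x : List A} {H : ι → ℕ}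

/-- Started in `m`, the program `c` takes at most `T` steps and ends in a memory with property
`P`. -/
def Exec (x : List A) (H : ι → ℕ) (c : Cmd A σ G ι) (m : Mem σ G ι) (T : ℕ)
    (P : Mem σ G ι → Prop) : Prop :=
  ∃ t m', Run x H c m t m' ∧ t ≤ T ∧ P m'

theorem Exec.mono {c : Cmd A σ G ι} {m : Mem σ G ι} {T T' : ℕ} {P P' : Mem σ G ι → Prop}
    (h : Exec x H c m T P) (hT : T ≤ T') (hP : ∀ m', P m' → P' m') : Exec x H c m T' P' :=
  let ⟨t, m', h1, h2, h3⟩ := h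
  ⟨t, m', h1, h2.trans hT, hP _ h3⟩

theorem Exec.set {f} {m : Mem σ G ι} {P : Mem σ G ι → Prop}
    (h : P { m with st := f m.st (scan x m.pos) m.tops }) : Exec x H (.set f) m 1 P :=
  ⟨_, _, .set f m, le_rfl, h⟩

theorem Exec.move {d} {m : Mem σ G ι} {P : Mem σ G ι → Prop}
    (h : P { m with pos := min (d.apply m.pos) (x.length + 1) }) : Exec x H (.move d) m 1 P :=
  ⟨_, _, .move d m, le_rfl, h⟩

theorem Exec.push {i g} {m : Mem σ G ι} {P : Mem σ G ι → Prop}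
    (hi : (m.stk i).length + 1 ≤ H i)
    (h : P { m with stk := Function.update m.stk i (g m.st m.tops :: m.stk i) }) :
    Exec x H (.push i g) m 2 P :=
  ⟨_, _, .push i g m hi, le_rfl, h⟩

theorem Exec.pop {i} {m : Mem σ G ι} {P : Mem σ G ι → Prop}
    (h : P { m with stk := Function.update m.stk i (m.stk i).tail }) : Exec x H (.pop i) m 1 P :=
  ⟨_, _, .pop i m, le_rfl, h⟩

theorem Exec.seq {p q : Cmd A σ G ι} {m : Mem σ G ι} {T T' : ℕ} {P Q : Mem σ G ι → Prop}
    (hp : Exec x H p m T P) (hq : ∀ m', P m' → Exec x H q m' T' Q) :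
    Exec x H (.seq p q) m (1 + T + T') Q := by
  obtain ⟨t, m', h1, h2, h3⟩ := hp
  obtain ⟨t', m'', h4, h5, h6⟩ := hq m' h3
  exact ⟨_, m'', h1.seq h4, by omega, h6⟩

theorem Exec.pop_seq {i} {q : Cmd A σ G ι} {m : Mem σ G ι} {T : ℕ} {P : Mem σ G ι → Prop}
    (h : Exec x H q { m with stk := Function.update m.stk i (m.stk i).tail } T P) :
    Exec x H (.seq (.pop i) q) m (T + 2) P :=
  (Exec.seq (Exec.pop (P := fun m' => m' = _) rfl) (fun _ h' => h' ▸ h)).mono (by omega)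
    fun _ h => h

theorem Exec.push_seq {i g} {q : Cmd A σ G ι} {m : Mem σ G ι} {T : ℕ} {P : Mem σ G ι → Prop}
    (hi : (m.stk i).length + 1 ≤ H i)
    (h : Exec x H q
      { m with stk := Function.update m.stk i (g m.st m.tops :: m.stk i) } T P) :
    Exec x H (.seq (.push i g) q) m (T + 3) P :=
  (Exec.seq (Exec.push (P := fun m' => m' = _) hi rfl) (fun _ h' => h' ▸ h)).mono (by omega)
    fun _ h => h

theorem Exec.ite {b} {p q : Cmd A σ G ι} {m : Mem σ G ι} {T : ℕ} {P : Mem σ G ι → Prop}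
    (hp : b m.st (scan x m.pos) m.tops = true → Exec x H p m T P)
    (hq : b m.st (scan x m.pos) m.tops = false → Exec x H q m T P) :
    Exec x H (.ite b p q) m (1 + T) P := by
  cases hb : b m.st (scan x m.pos) m.tops
  · obtain ⟨t, m', h1, h2, h3⟩ := hq hb
    exact ⟨_, m', .ite_false hb h1, by omega, h3⟩
  · obtain ⟨t, m', h1, h2, h3⟩ := hp hb
    exact ⟨_, m', .ite_true hb h1, by omega, h3⟩

/-- The index of the invariant bounds the number of rounds that remain: a round lowers it, and the
test cannot succeed at 0. Each round costs the test and the body, and one failing test ends the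
loop. -/
theorem Exec.loop {b} {p : Cmd A σ G ι} {T : ℕ} (Inv : ℕ → Mem σ G ι → Prop)
    (hstep : ∀ n m, Inv n m → b m.st (scan x m.pos) m.tops = true →
      0 < n ∧ Exec x H p m T (Inv (n - 1))) (n : ℕ) (m : Mem σ G ι) (hm : Inv n m) :
    Exec x H (.loop b p) m (n * (T + 1) + 1)
      (fun m' => b m'.st (scan x m'.pos) m'.tops = false ∧ ∃ n', Inv n' m') := by
  induction n generalizing m with
  | zero =>
    cases hb : b m.st (scan x m.pos) m.tops
    · exact ⟨1, m, .loop_false hb, by omega, hb, _, hm⟩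
    · exact absurd (hstep 0 m hm hb).1 (lt_irrefl 0)
  | succ n ih =>
    cases hb : b m.st (scan x m.pos) m.tops
    · exact ⟨1, m, .loop_false hb, by omega, hb, _, hm⟩
    · obtain ⟨t, m', h1, h2, h3⟩ := (hstep _ m hm hb).2
      obtain ⟨t', m'', h4, h5, h6⟩ := ih m' h3
      refine ⟨_, m'', .loop_true hb h1 h4, ?_, h6⟩
      rw [Nat.succ_mul]
      omega

end Exec

/-! ## Numbers on stacks, in bijective base two -/

/-- Successor on digit lists, where `false` is the digit one, `true` is the digit two and `k` twos
have been passed already. -/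
def incAux : ℕ → List Bool → List Bool
  | k, [] => List.replicate k false ++ [false]
  | k, false :: l => List.replicate k false ++ true :: l
  | k, true :: l => incAux (k + 1) l

/-- Predecessor on digit lists, where `k` ones have been passed already. -/
def decAux : ℕ → List Bool → List Bool
  | k, [] => List.replicate (k - 1) true
  | k, true :: l => List.replicate k true ++ false :: l
  | k, false :: l => decAux (k + 1) l

/-- The digits of a number, least significant first. -/
def enc : ℕ → List Bool
  | 0 => []
  | n + 1 => incAux 0 (enc n)

/-- The number with given digits. -/
def val : List Bool → ℕ
  | [] => 0
  | b :: l => 2 * val l + (if b then 2 else 1)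

theorem incAux_succ (k : ℕ) (l : List Bool) : incAux (k + 1) l = false :: incAux k l := by
  induction l generalizing k with
  | nil => simp [incAux, List.replicate_succ]
  | cons b l ih =>
    cases b
    · simp [incAux, List.replicate_succ]
    · simp only [incAux, ih]

/-- The leading twos that the increment turns into ones are the leading ones that the decrement
turns back into twos. -/
theorem decAux_incAux (k : ℕ) (l : List Bool) :
    decAux k (incAux 0 l) = List.replicate k true ++ l := by
  induction l generalizing k with
  | nil => simp [incAux, decAux]
  | cons b l ih =>
    cases b
    · simp [incAux, decAux]
    · simp [incAux, incAux_succ, decAux, ih, List.replicate_succ']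

theorem decAux_enc (n : ℕ) : decAux 0 (enc n) = enc (n - 1) := by
  cases n with
  | zero => rfl
  | succ n => simpa [enc] using decAux_incAux 0 (enc n)

theorem val_enc (n : ℕ) : val (enc n) = n := by
  have h : ∀ l, val (incAux 0 l) = val l + 1 := by
    intro l
    induction l with
    | nil => rfl
    | cons b l ih =>
      cases b
      · simp [incAux, val]
      · simp [incAux, incAux_succ, val, ih]; omega
  induction n with
  | zero => rfl
  | succ n ih => rw [enc, h, ih]

/-- All digits are at least one, so a list of k digits has value at least 2^k - 1. -/
theorem length_enc (n : ℕ) : (enc n).length ≤ Nat.log 2 (n + 1) := by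
  have h : ∀ l, 2 ^ l.length ≤ val l + 1 := by
    intro l
    induction l with
    | nil => simp [val]
    | cons b l ih =>
      simp only [List.length_cons, pow_succ, val]
      split_ifs <;> omega
  exact (Nat.le_log_iff_pow_le (by norm_num) (by omega)).2 (by simpa [val_enc] using h (enc n))

/-- There is no digit zero in bijective base two, so 0 is the empty list. Testing a register for
zero therefore means looking at the top of its stack. -/
theorem enc_eq_nil {n : ℕ} : enc n = [] ↔ n = 0 := by
  refine ⟨fun h => ?_, fun h => h ▸ rfl⟩
  rw [← val_enc n, h]; rfl

/-! ### Counting, erasing and copying on stacks. -/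

section Subroutines

variable {A σ G ι : Type} [DecidableEq ι] {x : List A} {H : ι → ℕ}

/-- The digits of a number as stack symbols. -/
def dig (G : Type) (n : ℕ) : List (Bool ⊕ G) := (enc n).map .inl

theorem dig_eq_nil {n : ℕ} : dig G n = [] ↔ n = 0 := by simp [dig, enc_eq_nil]

/-- Is the top of a stack the digit `b`? -/
def isDigit (b : Bool) : Option (Bool ⊕ G) → Bool
  | some (.inl c) => c == b
  | _ => false

/-- Increment the number on stack `i`, using stack `u`. -/
def incCmd (u i : ι) : Cmd A σ (Bool ⊕ G) ι :=
  .seq (.loop (fun _ _ v => isDigit true (v i)) (.seq (.pop i) (.push u fun _ _ => .inl false)))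
    (.seq (.ite (fun _ _ v => (v i).isSome) (.seq (.pop i) (.push i fun _ _ => .inl true))
        (.push i fun _ _ => .inl false))
      (.loop (fun _ _ v => (v u).isSome) (.seq (.pop u) (.push i fun _ _ => .inl false))))

/-- Decrement the number on stack `i`, using stack `u`. -/
def decCmd (u i : ι) : Cmd A σ (Bool ⊕ G) ι :=
  .seq (.loop (fun _ _ v => isDigit false (v i)) (.seq (.pop i) (.push u fun _ _ => .inl true)))
    (.seq (.ite (fun _ _ v => (v i).isSome) (.seq (.pop i) (.push i fun _ _ => .inl false))
        (.pop u))
      (.loop (fun _ _ v => (v u).isSome) (.seq (.pop u) (.push i fun _ _ => .inl true))))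

/-- Empty the stack `i`. -/
def wipeCmd (i : ι) : Cmd A σ G ι := .loop (fun _ _ v => (v i).isSome) (.pop i)

/-- Copy stack `j` to stack `i`, using stack `u`. -/
def copyCmd (u : ι) (d : G) (i j : ι) : Cmd A σ G ι :=
  .seq (wipeCmd i)
    (.seq (.loop (fun _ _ v => (v j).isSome)
        (.seq (.push u fun _ v => (v j).getD d) (.pop j)))
      (.loop (fun _ _ v => (v u).isSome)
        (.seq (.push i fun _ v => (v u).getD d)
          (.seq (.push j fun _ v => (v u).getD d) (.pop u)))))

/-- `m'` is `m`, except that stack `i` holds `l`. -/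
structure Puts (m : Mem σ G ι) (i : ι) (l : List G) (m' : Mem σ G ι) : Prop where
  st : m'.st = m.st
  pos : m'.pos = m.pos
  stk : m'.stk i = l
  other : ∀ j ≠ i, m'.stk j = m.stk j

/-- Move the stack `u`, which consists of `|u|` copies of `g`, back to stack `i`. -/
theorem exec_unload {u i : ι} (hui : u ≠ i) (g : G) (m : Mem σ G ι)
    (h : (m.stk u).length + (m.stk i).length ≤ H i) :
    Exec x H (.loop (fun _ _ v => (v u).isSome) (.seq (.pop u) (.push i fun _ _ => g))) m
      ((m.stk u).length * 5 + 1)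
      (fun m' => m'.st = m.st ∧ m'.pos = m.pos ∧
        m'.stk i = List.replicate (m.stk u).length g ++ m.stk i ∧ m'.stk u = [] ∧
        ∀ j, j ≠ i → j ≠ u → m'.stk j = m.stk j) := by
  refine (Exec.loop (T := 4) (fun n m' => m'.st = m.st ∧ m'.pos = m.pos ∧
    (m'.stk u).length = n ∧ n ≤ (m.stk u).length ∧
    m'.stk i = List.replicate ((m.stk u).length - n) g ++ m.stk i ∧
    ∀ j, j ≠ i → j ≠ u → m'.stk j = m.stk j) ?_ (m.stk u).length m
    ⟨rfl, rfl, rfl, le_rfl, by simp, fun _ _ _ => rfl⟩).mono le_rfl ?_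
  · rintro n m1 ⟨h1, h2, h3, h4, h5, h6⟩ hb
    have hn : 0 < n := by
      rw [← h3, List.length_pos_iff]
      rintro h0
      simp [Mem.tops, h0] at hb
    refine ⟨hn, Exec.pop_seq ?_⟩
    refine Exec.push ?_ ⟨h1, h2, ?_, by omega, ?_, ?_⟩
    · simp only [ne_eq, hui.symm, not_false_eq_true, Function.update_of_ne, h5,
        List.length_append, List.length_replicate]
      omega
    · simp [hui, h3]
    · simp only [ne_eq, hui.symm, not_false_eq_true, Function.update_of_ne, Function.update_self,
        h5]
      rw [show (m.stk u).length - (n - 1) = (m.stk u).length - n + 1 by omega,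
        List.replicate_succ]
      rfl
    · intro j hj1 hj2
      simp [hj1, hj2, h6]
  · rintro m1 ⟨hb, n, h1, h2, h3, h4, h5, h6⟩
    have h0 : m1.stk u = [] := by simpa [Mem.tops] using hb
    simp only [h0, List.length_nil] at h3
    subst h3
    exact ⟨h1, h2, by simpa using h5, h0, h6⟩

/-- The leading twos move to `u` as ones, then the first one becomes a two or a new digit one is
added, and finally the ones return from `u`. During the first loop, `incAux` applied to the height
of `u` and the remaining digits has the constant value `enc (n + 1)`. -/
theorem exec_inc {u i : ι} (hui : u ≠ i) (m : Mem σ (Bool ⊕ G) ι) (n h : ℕ)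
    (hi : m.stk i = dig G n) (hu : m.stk u = []) (hh : Nat.log 2 (n + 2) ≤ h)
    (hHu : h ≤ H u) (hHi : h ≤ H i) :
    Exec x H (incCmd u i) m (10 * h + 10) (Puts m i (dig G (n + 1))) := by
  have hlen : (enc n).length ≤ h :=
    (length_enc n).trans ((Nat.log_mono_right (by omega)).trans hh)
  have hlen' : (enc (n + 1)).length ≤ h := (length_enc (n + 1)).trans hh
  refine (Exec.seq (P := fun m' => m'.st = m.st ∧ m'.pos = m.pos ∧
    (∃ l : List Bool, m'.stk i = (l.map Sum.inl : List (Bool ⊕ G)) ∧ incAux (m'.stk u).length l = enc (n + 1) ∧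
      l.head? ≠ some true ∧ (m'.stk u).length ≤ h) ∧
    ∀ j, j ≠ i → j ≠ u → m'.stk j = m.stk j) (T := h * 5 + 1) (T' := 5 + (h * 5 + 1) + 1)
    ?_ ?_).mono (by omega) (fun _ h => h)
  · refine (Exec.loop (T := 4) (fun k m' => m'.st = m.st ∧ m'.pos = m.pos ∧
      (∃ l : List Bool, m'.stk i = (l.map Sum.inl : List (Bool ⊕ G)) ∧ incAux (m'.stk u).length l = enc (n + 1) ∧
        l.length = k ∧ (m'.stk u).length + k = (enc n).length) ∧
      ∀ j, j ≠ i → j ≠ u → m'.stk j = m.stk j) ?_ (enc n).length m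
      ⟨rfl, rfl, ⟨enc n, hi, by simp [hu, enc], rfl, by simp [hu]⟩, fun _ _ _ => rfl⟩).mono
      (by omega) ?_
    · rintro k m1 ⟨h1, h2, ⟨l, h3, h4, h5, h6⟩, h7⟩ hb
      cases l with
      | nil => simp [Mem.tops, h3, isDigit] at hb
      | cons b l =>
        cases b
        · simp [Mem.tops, h3, isDigit] at hb
        simp only [List.length_cons] at h5
        refine ⟨by omega, Exec.pop_seq ?_⟩
        refine Exec.push ?_ ⟨h1, h2, ⟨l, ?_, ?_, ?_, ?_⟩, ?_⟩
        · simp only [ne_eq, hui, not_false_eq_true, Function.update_of_ne]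
          omega
        · simp [hui.symm, h3]
        · simpa [hui, incAux] using h4
        · omega
        · simp [hui]
          omega
        · intro j hj1 hj2
          simp [hj1, hj2, h7]
    · rintro m1 ⟨hb, k, h1, h2, ⟨l, h3, h4, h5, h6⟩, h7⟩
      refine ⟨h1, h2, ⟨l, h3, h4, ?_, by omega⟩, h7⟩
      intro hl
      cases l with
      | nil => simp at hl
      | cons b l => 
        simp only [List.head?_cons, Option.some.injEq] at hl
        simp [Mem.tops, h3, isDigit, hl] at hb
  · rintro m1 ⟨h1, h2, ⟨l, h3, h4, h5, h6⟩, h7⟩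
    refine (Exec.seq (P := fun m' => m'.st = m.st ∧ m'.pos = m.pos ∧ m'.stk u = m1.stk u ∧
      List.replicate (m'.stk u).length (.inl false) ++ m'.stk i = dig G (n + 1) ∧
      ∀ j, j ≠ i → j ≠ u → m'.stk j = m.stk j) (T := 5) (T' := h * 5 + 1)
      ?_ ?_).mono (by omega) (fun _ h => h)
    · refine (Exec.ite (T := 4) ?_ ?_).mono (by omega) (fun _ h => h)
      · intro hb
        cases l with
        | nil => simp [Mem.tops, h3] at hb
        | cons b l =>
          cases b
          · have hl : (m1.stk u).length + (l.length + 1) ≤ h := by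
              rw [← h4] at hlen'
              simpa [incAux] using hlen'
            refine Exec.pop_seq ?_
            refine Exec.push ?_ ⟨h1, h2, ?_, ?_, ?_⟩
            · simp [h3]; omega
            · simp [hui]
            · simp [hui, h3, dig, ← h4, incAux]
            · intro j hj1 hj2
              simp [hj1, hj2, h7]
          · simp at h5
      · intro hb
        cases l with
        | cons b l => simp [Mem.tops, h3] at hb
        | nil =>
          have hl : (m1.stk u).length + 1 ≤ h := by
            rw [← h4] at hlen'
            simpa [incAux] using hlen'
          refine (Exec.push ?_ ⟨h1, h2, ?_, ?_, ?_⟩).mono (by omega) (fun _ h => h)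
          · simp [h3]; omega
          · simp [hui]
          · simp [hui, h3, dig, ← h4, incAux]
          · intro j hj1 hj2
            simp [hj1, hj2, h7]
    · rintro m2 ⟨g1, g2, g3, g4, g5⟩
      refine (exec_unload hui (.inl false) m2 ?_).mono
        (show (m2.stk u).length * 5 + 1 ≤ h * 5 + 1 by rw [g3]; omega) ?_
      · have := congrArg List.length g4
        simp only [List.length_append, List.length_replicate, dig, List.length_map] at this
        omega
      · rintro m3 ⟨f1, f2, f3, f4, f5⟩
        refine ⟨f1.trans g1, f2.trans g2, f3.trans g4, fun j hj => ?_⟩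
        by_cases hju : j = u
        · subst hju; rw [f4, hu]
        · rw [f5 j hj hju, g5 j hj hju]

theorem length_decAux (k : ℕ) (l : List Bool) : (decAux k l).length ≤ k + l.length := by
  induction l generalizing k with
  | nil => simp [decAux]
  | cons b l ih =>
    cases b
    · have := ih (k + 1)
      simp only [decAux, List.length_cons]; omega
    · simp [decAux]

/-- The mirror image of `exec_inc`. If all digits are ones, the number gets shorter by a digit, and
this digit is popped from `u`. For `n = 0` this pop has no effect, as it should be with truncated
subtraction. -/
theorem exec_dec {u i : ι} (hui : u ≠ i) (m : Mem σ (Bool ⊕ G) ι) (n h : ℕ)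
    (hi : m.stk i = dig G n) (hu : m.stk u = []) (hh : Nat.log 2 (n + 1) ≤ h)
    (hHu : h ≤ H u) (hHi : h ≤ H i) :
    Exec x H (decCmd u i) m (10 * h + 10) (Puts m i (dig G (n - 1))) := by
  have hlen : (enc n).length ≤ h := (length_enc n).trans hh
  refine (Exec.seq (P := fun m' => m'.st = m.st ∧ m'.pos = m.pos ∧
    (∃ l : List Bool, m'.stk i = (l.map Sum.inl : List (Bool ⊕ G)) ∧ decAux (m'.stk u).length l = enc (n - 1) ∧
      l.head? ≠ some false ∧ (m'.stk u).length + l.length ≤ h) ∧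
    ∀ j, j ≠ i → j ≠ u → m'.stk j = m.stk j) (T := h * 5 + 1) (T' := 5 + (h * 5 + 1) + 1)
    ?_ ?_).mono (by omega) (fun _ h => h)
  · refine (Exec.loop (T := 4) (fun k m' => m'.st = m.st ∧ m'.pos = m.pos ∧
      (∃ l : List Bool, m'.stk i = (l.map Sum.inl : List (Bool ⊕ G)) ∧ decAux (m'.stk u).length l = enc (n - 1) ∧
        l.length = k ∧ (m'.stk u).length + k = (enc n).length) ∧
      ∀ j, j ≠ i → j ≠ u → m'.stk j = m.stk j) ?_ (enc n).length m
      ⟨rfl, rfl, ⟨enc n, hi, by simp [hu, decAux_enc], rfl, by simp [hu]⟩, fun _ _ _ => rfl⟩).mono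
      (by omega) ?_
    · rintro k m1 ⟨h1, h2, ⟨l, h3, h4, h5, h6⟩, h7⟩ hb
      cases l with
      | nil => simp [Mem.tops, h3, isDigit] at hb
      | cons b l =>
        cases b
        swap
        · simp [Mem.tops, h3, isDigit] at hb
        simp only [List.length_cons] at h5
        refine ⟨by omega, Exec.pop_seq ?_⟩
        refine Exec.push ?_ ⟨h1, h2, ⟨l, ?_, ?_, ?_, ?_⟩, ?_⟩
        · simp only [ne_eq, hui, not_false_eq_true, Function.update_of_ne]
          omega
        · simp [hui.symm, h3]
        · simpa [hui, decAux] using h4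
        · omega
        · simp [hui]
          omega
        · intro j hj1 hj2
          simp [hj1, hj2, h7]
    · rintro m1 ⟨hb, k, h1, h2, ⟨l, h3, h4, h5, h6⟩, h7⟩
      refine ⟨h1, h2, ⟨l, h3, h4, ?_, by omega⟩, h7⟩
      intro hl
      cases l with
      | nil => simp at hl
      | cons b l => 
        simp only [List.head?_cons, Option.some.injEq] at hl
        simp [Mem.tops, h3, isDigit, hl] at hb
  · rintro m1 ⟨h1, h2, ⟨l, h3, h4, h5, h6⟩, h7⟩
    refine (Exec.seq (P := fun m' => m'.st = m.st ∧ m'.pos = m.pos ∧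
      (m'.stk u).length ≤ h ∧
      List.replicate (m'.stk u).length (.inl true) ++ m'.stk i = dig G (n - 1) ∧
      ∀ j, j ≠ i → j ≠ u → m'.stk j = m.stk j) (T := 5) (T' := h * 5 + 1)
      ?_ ?_).mono (by omega) (fun _ h => h)
    · refine (Exec.ite (T := 4) ?_ ?_).mono (by omega) (fun _ h => h)
      · intro hb
        cases l with
        | nil => simp [Mem.tops, h3] at hb
        | cons b l =>
          cases b
          · simp at h5
          · simp only [List.length_cons] at h6
            refine Exec.pop_seq ?_
            refine Exec.push ?_ ⟨h1, h2, ?_, ?_, ?_⟩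
            · simp [h3]; omega
            · simp [hui]; omega
            · simp [hui, h3, dig, ← h4, decAux]
            · intro j hj1 hj2
              simp [hj1, hj2, h7]
      · intro hb
        cases l with
        | cons b l => simp [Mem.tops, h3] at hb
        | nil =>
          refine (Exec.pop ⟨h1, h2, ?_, ?_, ?_⟩).mono (by omega) (fun _ h => h)
          · simp at h6 ⊢; omega
          · simp [hui.symm, h3, dig, ← h4, decAux]
          · intro j hj1 hj2
            simp [hj2, h7, hj1]
    · rintro m2 ⟨g1, g2, g3, g4, g5⟩
      refine (exec_unload hui (.inl true) m2 ?_).mono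
        (show (m2.stk u).length * 5 + 1 ≤ h * 5 + 1 by omega) ?_
      · have := congrArg List.length g4
        have h8 := length_decAux 0 (enc n)
        rw [decAux_enc] at h8
        simp only [List.length_append, List.length_replicate, dig, List.length_map] at this
        omega
      · rintro m3 ⟨f1, f2, f3, f4, f5⟩
        refine ⟨f1.trans g1, f2.trans g2, f3.trans g4, fun j hj => ?_⟩
        by_cases hju : j = u
        · subst hju; rw [f4, hu]
        · rw [f5 j hj hju, g5 j hj hju]

theorem exec_wipe {i : ι} (m : Mem σ G ι) (h : ℕ) (hi : (m.stk i).length ≤ h) :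
    Exec x H (wipeCmd i) m (2 * h + 1) (Puts m i []) := by
  refine (Exec.loop (T := 1) (fun k m' => m'.st = m.st ∧ m'.pos = m.pos ∧
      (m'.stk i).length = k ∧ ∀ j, j ≠ i → m'.stk j = m.stk j) ?_ (m.stk i).length m
      ⟨rfl, rfl, rfl, fun _ _ => rfl⟩).mono (by omega) ?_
  · rintro n m1 ⟨h1, h2, h3, h4⟩ hb
    have hn : 0 < n := by
      rw [← h3, List.length_pos_iff]
      rintro h0
      simp [Mem.tops, h0] at hb
    refine ⟨hn, Exec.pop ⟨h1, h2, by simp [h3], fun j hj => by simp [hj, h4]⟩⟩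
  · rintro m1 ⟨hb, n, h1, h2, h3, h4⟩
    exact ⟨h1, h2, by simpa [Mem.tops] using hb, h4⟩

/-- The contents of `j` are reversed onto `u`; the way back reverses them again and pushes every
symbol to both `i` and `j`. -/
theorem exec_copy {u i j : ι} (hui : u ≠ i) (huj : u ≠ j) (hij : i ≠ j) (d : G)
    (m : Mem σ G ι) (h : ℕ) (hu : m.stk u = []) (hi : (m.stk i).length ≤ h)
    (hj : (m.stk j).length ≤ h)
    (hHu : h ≤ H u) (hHi : h ≤ H i) (hHj : h ≤ H j) :
    Exec x H (copyCmd u d i j) m (20 * h + 10) (Puts m i (m.stk j)) := by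
  refine (Exec.seq (exec_wipe m h hi) (T' := 13 * h + 7) ?_).mono (by omega) (fun _ h => h)
  rintro m1 ⟨h1, h2, h3, h4⟩
  refine (Exec.seq (T := h * 5 + 1) (T' := h * 8 + 1) (P := fun m' => m'.st = m.st ∧
    m'.pos = m.pos ∧ m'.stk i = [] ∧
    m'.stk j = [] ∧ m'.stk u = (m.stk j).reverse ∧
    ∀ k, k ≠ i → k ≠ j → k ≠ u → m'.stk k = m.stk k) ?_ ?_).mono (by omega) (fun _ h => h)
  · refine (Exec.loop (T := 4) (fun k m' => m'.st = m.st ∧ m'.pos = m.pos ∧ m'.stk i = [] ∧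
      (m'.stk u).reverse ++ m'.stk j = m.stk j ∧ (m'.stk j).length = k ∧
      ∀ k, k ≠ i → k ≠ j → k ≠ u → m'.stk k = m.stk k) ?_ (m.stk j).length m1
      ⟨h1, h2, h3, by simp [h4 u hui, h4 j hij.symm, hu], by rw [h4 j hij.symm],
        fun k hk _ _ => h4 k hk⟩).mono (by omega) ?_
    · rintro n m2 ⟨g1, g2, g3, g4, g5, g6⟩ hb
      cases hl : m2.stk j with
      | nil => simp [Mem.tops, hl] at hb
      | cons a l =>
        have e := congrArg List.length g4
        simp only [hl, List.length_append, List.length_reverse, List.length_cons] at e g5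
        refine ⟨by omega, Exec.push_seq ?_ ?_⟩
        · omega
        refine Exec.pop ⟨g1, g2, ?_, ?_, ?_, ?_⟩
        · simp [hij, hui.symm, g3]
        · simp only [huj.symm, huj, ne_eq, not_false_eq_true, Function.update_of_ne,
            Function.update_self, hl, Mem.tops, List.head?_cons, Option.getD_some,
            List.reverse_cons, List.tail_cons, List.append_assoc, List.singleton_append]
          rw [← hl, g4]
        · simp [huj.symm, hl]; omega
        · intro k k1 k2 k3
          simp [k1, k2, k3, g6]
    · rintro m2 ⟨hb, n, g1, g2, g3, g4, g5, g6⟩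
      have h0 : m2.stk j = [] := by simpa [Mem.tops] using hb
      refine ⟨g1, g2, g3, h0, ?_, g6⟩
      rw [← g4, h0]; simp
  · rintro m2 ⟨g1, g2, g3, g4, g5, g6⟩
    refine (Exec.loop (T := 7) (fun k m' => m'.st = m.st ∧ m'.pos = m.pos ∧
      m'.stk i = m'.stk j ∧
      (m'.stk u).reverse ++ m'.stk j = m.stk j ∧ (m'.stk u).length = k ∧
      ∀ k, k ≠ i → k ≠ j → k ≠ u → m'.stk k = m.stk k) ?_ (m.stk j).length m2
      ⟨g1, g2, g3.trans g4.symm, by simp [g5, g4], by simp [g5], g6⟩).mono (by omega) ?_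
    · rintro n m3 ⟨f1, f2, f3, f4, f5, f6⟩ hb
      cases hl : m3.stk u with
      | nil => simp [Mem.tops, hl] at hb
      | cons a l =>
        have e := congrArg List.length f4
        simp only [hl, List.length_append, List.length_reverse, List.length_cons] at e f5
        refine ⟨by omega, Exec.push_seq ?_ ?_⟩
        · rw [f3]; omega
        refine Exec.push_seq ?_ ?_
        · simp [hij.symm]; omega
        refine Exec.pop ⟨f1, f2, ?_, ?_, ?_, ?_⟩
        · simp [hij, hui.symm, huj.symm, hui, huj, hl, f3, hij.symm, Mem.tops]
        · simp only [huj.symm, huj, hui, hij.symm, ne_eq, not_false_eq_true,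
            Function.update_of_ne,
            Function.update_self, hl, Mem.tops, List.head?_cons, Option.getD_some,
            List.tail_cons]
          rw [← f4, hl]; simp
        · simp [huj, hui, hl]; omega
        · intro k k1 k2 k3
          simp [k1, k2, k3, f6]
    · rintro m3 ⟨hb, n, f1, f2, f3, f4, f5, f6⟩
      have h0 : m3.stk u = [] := by simpa [Mem.tops] using hb
      have hj' : m3.stk j = m.stk j := by rw [← f4, h0]; simp
      refine ⟨f1, f2, f3.trans hj', fun k hk => ?_⟩
      by_cases k1 : k = j
      · rw [k1, hj']
      · by_cases k2 : k = u
        · rw [k2, h0, hu]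
        · exact f6 k hk k1 k2

end Subroutines


/-! ## Register programs with bounded loops -/

/-- The state of a register program: a finite store, registers that hold numbers, stacks, and the
largest height that a stack has reached by a push so far. -/
structure State (σ R J G : Type) where
  st : σ
  reg : R → ℕ
  stk : J → List G
  hw : ℕ

/-- Register programs. `read r f` reads the input cell whose number is in register `r`; `rep p`
repeats `p` a number of times that is fixed by the input. -/
inductive Prog (A σ R J G : Type) where
  | set (f : σ → (R → Bool) → (J → Option G) → σ)
  | inc (r : R)
  | dec (r : R)
  | clear (r : R)
  | copy (r r' : R)
  | read (r : R) (f : σ → InCell A → σ)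
  | push (j : J) (g : σ → (J → Option G) → G)
  | pop (j : J)
  | wipe (j : J)
  | seq (p q : Prog A σ R J G)
  | ite (b : σ → (R → Bool) → (J → Option G) → Bool) (p q : Prog A σ R J G)
  | rep (p : Prog A σ R J G)

/-- The stacks by which registers, stacks and auxiliary quantities are implemented. -/
inductive Slot (R J : Type) (D : ℕ) where
  | reg (r : R)
  | stk (j : J)
  | bnd
  | tmp
  | ptr
  | ctr (n : Fin (D + 1))
  deriving DecidableEq

instance {R J : Type} {D : ℕ} [Finite R] [Finite J] : Finite (Slot R J D) := by
  refine Finite.of_injective (β := R ⊕ J ⊕ Fin 3 ⊕ Fin (D + 1)) (fun s => match s with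
    | .reg r => .inl r
    | .stk j => .inr (.inl j)
    | .bnd => .inr (.inr (.inl 0))
    | .tmp => .inr (.inr (.inl 1))
    | .ptr => .inr (.inr (.inl 2))
    | .ctr n => .inr (.inr (.inr n))) ?_
  intro a b h
  cases a <;> cases b <;> simp_all

section RegisterPrograms

variable {A σ R J G : Type}

/-- Which registers are zero. -/
def State.zeros (s : State σ R J G) : R → Bool := fun r => decide (s.reg r = 0)

/-- The tops of the stacks. -/
def State.tops (s : State σ R J G) : J → Option G := fun j => (s.stk j).head?

/-- The nesting depth of loops. -/
def Prog.height : Prog A σ R J G → ℕ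
  | .seq p q => max p.height q.height
  | .ite _ p q => max p.height q.height
  | .rep p => p.height + 1
  | _ => 0

/-- A bound for the number of instructions executed. -/
def Prog.count (K : ℕ) : Prog A σ R J G → ℕ
  | .seq p q => p.count K + q.count K
  | .ite _ p q => p.count K + q.count K
  | .rep p => K * p.count K
  | _ => 1

/-- A bound for the running time, if an instruction takes time `c`. -/
def Prog.cost (c K : ℕ) : Prog A σ R J G → ℕ
  | .seq p q => 1 + p.cost c K + q.cost c K
  | .ite _ p q => 1 + p.cost c K + q.cost c K
  | .rep p => c + 2 + K * (c + p.cost c K + 2)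
  | _ => c

variable [DecidableEq R] [DecidableEq J]

/-- The effect of a program on input `x`, where loops are executed `K` times. -/
def Prog.eval (x : List A) (K : ℕ) : Prog A σ R J G → State σ R J G → State σ R J G
  | .set f, s => { s with st := f s.st s.zeros s.tops }
  | .inc r, s => { s with reg := Function.update s.reg r (s.reg r + 1) }
  | .dec r, s => { s with reg := Function.update s.reg r (s.reg r - 1) }
  | .clear r, s => { s with reg := Function.update s.reg r 0 }
  | .copy r r', s => { s with reg := Function.update s.reg r (s.reg r') }
  | .read r f, s => { s with st := f s.st (scan x (s.reg r)) }
  | .push j g, s =>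
      { s with
        stk := Function.update s.stk j (g s.st s.tops :: s.stk j)
        hw := max s.hw ((s.stk j).length + 1) }
  | .pop j, s => { s with stk := Function.update s.stk j (s.stk j).tail }
  | .wipe j, s => { s with stk := Function.update s.stk j [] }
  | .seq p q, s => q.eval x K (p.eval x K s)
  | .ite b p q, s => if b s.st s.zeros s.tops then p.eval x K s else q.eval x K s
  | .rep p, s => (p.eval x K)^[K] s

/-- The mark never decreases. Hence a bound for its final value holds for every push on the way. -/
theorem Prog.hw_le_eval (x : List A) (K : ℕ) (p : Prog A σ R J G) (s : State σ R J G) :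
    s.hw ≤ (p.eval x K s).hw := by
  induction p generalizing s with
  | seq p q hp hq => exact (hp s).trans (hq _)
  | ite b p q hp hq =>
    simp only [Prog.eval]
    split_ifs
    · exact hp s
    · exact hq s
  | rep p hp =>
    simp only [Prog.eval]
    generalize K = n at *
    have : ∀ k, s.hw ≤ ((p.eval x n)^[k] s).hw := by
      intro k
      induction k with
      | zero => exact le_rfl
      | succ k ih =>
        rw [Function.iterate_succ_apply']
        exact ih.trans (hp _)
    exact this n
  | push j g => exact le_max_left _ _
  | _ => exact le_rfl

theorem Prog.hw_le_iterate (x : List A) (K : ℕ) (p : Prog A σ R J G) (s : State σ R J G) {m n : ℕ}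
    (h : m ≤ n) : ((p.eval x K)^[m] s).hw ≤ ((p.eval x K)^[n] s).hw := by
  obtain ⟨d, rfl⟩ := Nat.exists_eq_add_of_le' h
  rw [Function.iterate_add_apply]
  generalize (p.eval x K)^[m] s = s'
  induction d with
  | zero => exact le_rfl
  | succ k ih =>
    rw [Function.iterate_succ_apply']
    exact (ih (by omega)).trans (Prog.hw_le_eval x K p _)

/-- Registers and stack heights are at most `Z`. -/
def State.Bdd (Z : ℕ) (s : State σ R J G) : Prop :=
  (∀ r, s.reg r ≤ Z) ∧ ∀ j, (s.stk j).length ≤ Z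

omit [DecidableEq R] [DecidableEq J] in
theorem State.Bdd.mono {Z Z' : ℕ} {s : State σ R J G} (h : s.Bdd Z) (hZ : Z ≤ Z') : s.Bdd Z' :=
  ⟨fun r => (h.1 r).trans hZ, fun j => (h.2 j).trans hZ⟩

omit [DecidableEq J] in
theorem State.Bdd.update_reg {Z : ℕ} {s : State σ R J G} (h : s.Bdd Z) {r : R} {n : ℕ}
    (hn : n ≤ Z) : State.Bdd Z { s with reg := Function.update s.reg r n } := by
  refine ⟨fun r' => ?_, h.2⟩
  by_cases hr : r' = r
  · subst hr; simpa using hn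
  · simpa [hr] using h.1 r'

omit [DecidableEq R] in
theorem State.Bdd.update_stk {Z : ℕ} {s : State σ R J G} (h : s.Bdd Z) {j : J} {l : List G}
    (hl : l.length ≤ Z) (n : ℕ) :
    State.Bdd Z { s with stk := Function.update s.stk j l, hw := n } := by
  refine ⟨h.1, fun j' => ?_⟩
  by_cases hj : j' = j
  · subst hj; simpa using hl
  · simpa [hj] using h.2 j'

/-- A single instruction raises the maximum of all registers and stack heights by at most one. -/
theorem Prog.eval_bdd (x : List A) (K : ℕ) (p : Prog A σ R J G) {Z : ℕ} {s : State σ R J G}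
    (h : s.Bdd Z) : (p.eval x K s).Bdd (Z + p.count K) := by
  induction p generalizing s Z with
  | seq p q hp hq =>
    have := hq (hp h)
    rwa [add_assoc] at this
  | ite b p q hp hq =>
    simp only [Prog.eval, Prog.count]
    split_ifs
    · exact (hp h).mono (by omega)
    · exact (hq h).mono (by omega)
  | rep p hp =>
    have : ∀ k, ((p.eval x K)^[k] s).Bdd (Z + k * p.count K) := by
      intro k
      induction k with
      | zero => simpa using h
      | succ k ih =>
        rw [Function.iterate_succ_apply']
        exact (hp ih).mono (by rw [Nat.succ_mul]; omega)
    exact this K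
  | inc r => exact (h.mono (Nat.le_succ Z)).update_reg (Nat.succ_le_succ (h.1 r))
  | dec r => exact (h.mono (Nat.le_succ Z)).update_reg ((Nat.sub_le _ _).trans
      ((h.1 r).trans (Nat.le_succ Z)))
  | clear r => exact (h.mono (Nat.le_succ Z)).update_reg (Nat.zero_le _)
  | copy r r' => exact (h.mono (Nat.le_succ Z)).update_reg ((h.1 r').trans (Nat.le_succ Z))
  | push j g =>
    exact (h.mono (Nat.le_succ Z)).update_stk (j := j) (l := g s.st s.tops :: s.stk j)
      (Nat.succ_le_succ (h.2 j)) _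
  | pop j =>
    exact (h.mono (Nat.le_succ Z)).update_stk (j := j) (l := (s.stk j).tail)
      (by simpa using (h.2 j).trans (Nat.le_succ Z |>.trans (Nat.le_succ _))) _
  | wipe j =>
    exact (h.mono (Nat.le_succ Z)).update_stk (j := j) (l := []) (Nat.zero_le _) _
  | set f => exact h.mono (Nat.le_succ Z)
  | read r f => exact h.mono (Nat.le_succ Z)

/-! ### Implementation by stack programs -/

/-- Does the input head scan the left endmarker? -/
def InCell.isLeftEnd : InCell A → Bool
  | .leftEnd => true
  | _ => false

/-- The zero tests of registers, from the tops of the stacks that implement them. -/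
def slotZeros {D : ℕ} (v : Slot R J D → Option (Bool ⊕ G)) : R → Bool :=
  fun r => (v (.reg r)).isNone

/-- The tops of the stacks of a register program, from those of the stacks that implement them. -/
def slotTops {D : ℕ} (v : Slot R J D → Option (Bool ⊕ G)) : J → Option G :=
  fun j => (v (.stk j)).bind Sum.getRight?

/-- The stack program for a register program. -/
def Prog.compile (D : ℕ) : Prog A σ R J G → Cmd A σ (Bool ⊕ G) (Slot R J D)
  | .set f => .set fun s _ v => f s (slotZeros v) (slotTops v)
  | .inc r => incCmd .tmp (.reg r)
  | .dec r => decCmd .tmp (.reg r)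
  | .clear r => wipeCmd (.reg r)
  | .copy r r' =>
      -- `copyCmd` empties its target before it reads the source, so a copy of a register to itself
      -- must be treated separately.
      if r = r' then .set fun s _ _ => s else copyCmd .tmp (.inl false) (.reg r) (.reg r')
  | .read r f =>
      .seq (copyCmd .tmp (.inl false) .ptr (.reg r))
        (.seq (.loop (fun _ a _ => !a.isLeftEnd) (.move .left))
          (.seq (.loop (fun _ _ v => (v .ptr).isSome) (.seq (decCmd .tmp .ptr) (.move .right)))
            (.set fun s a _ => f s a)))
  | .push j g => .push (.stk j) fun s v => .inr (g s (slotTops v))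
  | .pop j => .pop (.stk j)
  | .wipe j => wipeCmd (.stk j)
  | .seq p q => .seq (p.compile D) (q.compile D)
  | .ite b p q => .ite (fun s _ v => b s (slotZeros v) (slotTops v)) (p.compile D) (q.compile D)
  | .rep p =>
      -- The counter is chosen by the nesting depth of the body, so a loop and the loops inside it
      -- use different counters. For depths up to `D` the conversion to `Fin (D + 1)` changes
      -- nothing.
      .seq (copyCmd .tmp (.inl false) (.ctr (Fin.ofNat (D + 1) p.height)) .bnd)
        (.loop (fun _ _ v => (v (.ctr (Fin.ofNat (D + 1) p.height))).isSome)
          (.seq (decCmd .tmp (.ctr (Fin.ofNat (D + 1) p.height))) (p.compile D)))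

/-- The memory `m` implements the state `s`; the loop counters below `d` are zero. -/
structure Models {D : ℕ} (x : List A) (K d : ℕ) (s : State σ R J G)
    (m : Mem σ (Bool ⊕ G) (Slot R J D)) : Prop where
  st : m.st = s.st
  pos : m.pos ≤ x.length + 1
  reg : ∀ r, m.stk (.reg r) = dig G (s.reg r)
  stk : ∀ j, m.stk (.stk j) = (s.stk j).map .inr
  bnd : m.stk .bnd = dig G K
  tmp : m.stk .tmp = []
  ptr : m.stk .ptr = []
  ctr : ∀ n : Fin (D + 1), n.val < d → m.stk (.ctr n) = []

/-- The bounds for the heights of stacks: `h` for those that hold numbers, `H` for the others. -/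
def heights {D : ℕ} (h H : ℕ) : Slot R J D → ℕ
  | .stk _ => H
  | _ => h

omit [DecidableEq R] [DecidableEq J] in
theorem Models.zeros {D : ℕ} {x : List A} {K d : ℕ} {s : State σ R J G}
    {m : Mem σ (Bool ⊕ G) (Slot R J D)} (h : Models x K d s m) :
    slotZeros m.tops = s.zeros := by
  funext r
  simp only [slotZeros, Mem.tops, State.zeros, h.reg]
  by_cases hr : s.reg r = 0
  · simp [hr, dig_eq_nil.2]
  · have : dig G (s.reg r) ≠ [] := fun h0 => hr (dig_eq_nil.1 h0)
    simp [this, hr]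

omit [DecidableEq R] [DecidableEq J] in
theorem Models.tops {D : ℕ} {x : List A} {K d : ℕ} {s : State σ R J G}
    {m : Mem σ (Bool ⊕ G) (Slot R J D)} (h : Models x K d s m) :
    slotTops m.tops = s.tops := by
  funext j
  simp only [slotTops, Mem.tops, State.tops, h.stk]
  cases s.stk j <;> simp

omit [DecidableEq J] in
theorem Models.puts_reg {D : ℕ} {x : List A} {K d : ℕ} {s : State σ R J G}
    {m m' : Mem σ (Bool ⊕ G) (Slot R J D)} (h : Models x K d s m) {r : R} {n : ℕ}
    (hp : Puts m (.reg r) (dig G n) m') :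
    Models x K d { s with reg := Function.update s.reg r n } m' ∧
      ∀ n : Fin (D + 1), d ≤ n.val → m'.stk (.ctr n) = m.stk (.ctr n) := by
  refine ⟨⟨hp.st.trans h.st, hp.pos ▸ h.pos, fun r' => ?_, fun j => ?_, ?_, ?_, ?_, ?_⟩, ?_⟩
  · by_cases hr : r' = r
    · subst hr; simp [hp.stk]
    · rw [hp.other _ (by simpa using hr), h.reg]
      simp [hr]
  · rw [hp.other _ (by simp), h.stk]
  · rw [hp.other _ (by simp), h.bnd]
  · rw [hp.other _ (by simp), h.tmp]
  · rw [hp.other _ (by simp), h.ptr]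
  · intro n hn
    rw [hp.other _ (by simp), h.ctr n hn]
  · intro n _
    rw [hp.other _ (by simp)]

omit [DecidableEq R] in
theorem Models.puts_stk {D : ℕ} {x : List A} {K d : ℕ} {s : State σ R J G}
    {m m' : Mem σ (Bool ⊕ G) (Slot R J D)} (h : Models x K d s m) {j : J} {l : List G} (w : ℕ)
    (hp : Puts m (.stk j) (l.map .inr) m') :
    Models x K d { s with stk := Function.update s.stk j l, hw := w } m' ∧
      ∀ n : Fin (D + 1), d ≤ n.val → m'.stk (.ctr n) = m.stk (.ctr n) := by
  refine ⟨⟨hp.st.trans h.st, hp.pos ▸ h.pos, fun r => ?_, fun j' => ?_, ?_, ?_, ?_, ?_⟩, ?_⟩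
  · rw [hp.other _ (by simp), h.reg]
  · by_cases hr : j' = j
    · subst hr; simp [hp.stk]
    · rw [hp.other _ (by simpa using hr), h.stk]
      simp [hr]
  · rw [hp.other _ (by simp), h.bnd]
  · rw [hp.other _ (by simp), h.tmp]
  · rw [hp.other _ (by simp), h.ptr]
  · intro n hn
    rw [hp.other _ (by simp), h.ctr n hn]
  · intro n _
    rw [hp.other _ (by simp)]

/-- The input head stops at the right endmarker, while a register may exceed the input length. Both
read the right endmarker. -/
theorem scan_min (x : List A) (n : ℕ) : scan x (min n (x.length + 1)) = scan x n := by
  rcases le_total n (x.length + 1) with h | h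
  · rw [min_eq_left h]
  · rw [min_eq_right h]
    obtain ⟨k, rfl⟩ := Nat.exists_eq_add_of_le' h
    rw [show k + (x.length + 1) = (k + x.length) + 1 by omega]
    simp [scan]

theorem length_dig_le {n W : ℕ} (h : n ≤ W) : (dig G n).length ≤ Nat.log 2 (W + 2) := by
  simpa [dig] using (length_enc n).trans (Nat.log_mono_right (by omega))

theorem exec_rewind {D : ℕ} {x : List A} {H : Slot R J D → ℕ} (m : Mem σ (Bool ⊕ G) (Slot R J D))
    (hp : m.pos ≤ x.length + 1) :
    Exec x H (.loop (fun _ a _ => !a.isLeftEnd) (.move .left)) m ((x.length + 1) * 2 + 1)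
      (fun m' => m'.st = m.st ∧ m'.pos = 0 ∧ m'.stk = m.stk) := by
  refine (Exec.loop (T := 1) (fun k m' => m'.st = m.st ∧ m'.pos = k ∧ k ≤ x.length + 1 ∧
    m'.stk = m.stk) ?_ m.pos m ⟨rfl, rfl, hp, rfl⟩).mono (by omega) ?_
  · rintro n m1 ⟨h1, h2, h3, h4⟩ hb
    have hn : 0 < n := by
      rw [← h2, Nat.pos_iff_ne_zero]
      intro h0
      rw [h0] at hb
      simp [scan, InCell.isLeftEnd] at hb
    refine ⟨hn, Exec.move ⟨h1, ?_, by omega, h4⟩⟩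
    simp only [Dir.apply, h2]
    omega
  · rintro m1 ⟨hb, n, h1, h2, h3, h4⟩
    refine ⟨h1, ?_, h4⟩
    by_contra h0
    obtain ⟨k, hk⟩ := Nat.exists_eq_succ_of_ne_zero h0
    rw [hk] at hb
    simp only [scan] at hb
    split at hb <;> simp [InCell.isLeftEnd] at hb

theorem exec_advance {D : ℕ} {x : List A} {h H : ℕ} (m : Mem σ (Bool ⊕ G) (Slot R J D)) (n W : ℕ)
    (hW : n ≤ W) (hh : h = Nat.log 2 (W + 2)) (hp : m.pos = 0) (hm : m.stk .ptr = dig G n)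
    (ht : m.stk .tmp = []) :
    Exec x (heights h H)
      (.loop (fun _ _ v => (v .ptr).isSome) (.seq (decCmd .tmp .ptr) (.move .right))) m
      (W * (10 * h + 13) + 1)
      (fun m' => m'.st = m.st ∧ m'.pos = min n (x.length + 1) ∧ m'.stk .ptr = [] ∧
        ∀ j ≠ .ptr, m'.stk j = m.stk j) := by
  refine (Exec.loop (T := 10 * h + 12) (fun k m' => m'.st = m.st ∧
    m'.pos = min (n - k) (x.length + 1) ∧ m'.stk .ptr = dig G k ∧ k ≤ n ∧
    ∀ j ≠ .ptr, m'.stk j = m.stk j) ?_ n m ⟨rfl, by simp [hp], hm, le_rfl, fun _ _ => rfl⟩).mono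
    (Nat.succ_le_succ (Nat.mul_le_mul_right (10 * h + 13) hW)) ?_
  · rintro k m1 ⟨h1, h2, h3, h4, h5⟩ hb
    have hk : 0 < k := by
      rw [Nat.pos_iff_ne_zero]
      rintro rfl
      simp [Mem.tops, h3, dig_eq_nil.2] at hb
    refine ⟨hk, (Exec.seq (exec_dec (by simp) m1 k h h3 (by rw [h5 _ (by simp), ht])
      (by rw [hh]; exact Nat.log_mono_right (by omega)) le_rfl le_rfl) ?_ (T' := 1)).mono
      (by omega) (fun _ h => h)⟩
    rintro m2 ⟨g1, g2, g3, g4⟩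
    refine Exec.move ⟨g1.trans h1, ?_, g3, by omega, fun j hj => (g4 j hj).trans (h5 j hj)⟩
    simp only [Dir.apply, g2, h2]
    omega
  · rintro m1 ⟨hb, k, h1, h2, h3, h4, h5⟩
    have h0 : m1.stk .ptr = [] := by simpa [Mem.tops] using hb
    have hk : k = 0 := by rw [← dig_eq_nil (G := G), ← h3, h0]
    subst hk
    exact ⟨h1, h2, h0, h5⟩

/-- The number 100(W + 2)² is a generous bound for the time of any single instruction. The third
inequality is for `read`, where the pointer is decremented once for each move of the head. -/
theorem cost_bounds {W h N : ℕ} (hh : h = Nat.log 2 (W + 2)) (hN : N ≤ W) :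
    20 * h + 10 ≤ 100 * (W + 2) ^ 2 ∧ 2 * W + 10 ≤ 100 * (W + 2) ^ 2 ∧
      1 + (20 * h + 10) + (1 + (N * 2 + 1) + (1 + (W * (10 * h + 13) + 1) + 1)) ≤
        100 * (W + 2) ^ 2 := by
  have h1 : h ≤ W + 2 := hh ▸ (Nat.log_lt_self 2 (by omega)).le
  have h2 : W * (10 * h + 13) ≤ (W + 2) * (10 * (W + 2) + 13) :=
    Nat.mul_le_mul (by omega) (by omega)
  have h3 : 2 * (W + 2) ≤ (W + 2) ^ 2 := by rw [pow_two]; exact Nat.mul_le_mul_right _ (by omega)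
  have h4 : (W + 2) * (10 * (W + 2) + 13) = 10 * (W + 2) ^ 2 + 13 * (W + 2) := by ring
  omega

/-- All registers and heights stay below `W` because they grow by at most `p.count K`. So stacks
with numbers need at most `h` cells, and the other stacks are controlled by `hw`. The body of a loop
finds the counters below its own depth at zero and leaves them so, which allows it to be repeated.
-/
theorem exec_compile (D : ℕ) (x : List A) {K W h H : ℕ} (hKW : K ≤ W) (hx : x.length + 1 ≤ W)
    (hh : h = Nat.log 2 (W + 2)) (p : Prog A σ R J G) {d Z : ℕ} {s : State σ R J G}
    {m : Mem σ (Bool ⊕ G) (Slot R J D)} (hm : Models x K d s m) (hd : p.height ≤ d)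
    (hD : p.height ≤ D + 1) (hZ : s.Bdd Z) (hW : Z + p.count K ≤ W)
    (hH : (p.eval x K s).hw ≤ H) :
    Exec x (heights h H) (p.compile D) m (p.cost (100 * (W + 2) ^ 2) K)
      (fun m' => Models x K d (p.eval x K s) m' ∧
        ∀ n : Fin (D + 1), d ≤ n.val → m'.stk (.ctr n) = m.stk (.ctr n)) := by
  obtain ⟨c1, c2, c3⟩ := cost_bounds hh hx
  induction p generalizing d Z s m with
  | set f =>
    refine (Exec.set ⟨⟨?_, hm.pos, hm.reg, hm.stk, hm.bnd, hm.tmp, hm.ptr, hm.ctr⟩,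
      fun _ _ => rfl⟩).mono (by simp only [Prog.cost]; omega) (fun _ h => h)
    simp [hm.zeros, hm.tops, hm.st, Prog.eval]
  | inc r =>
    have h1 := hZ.1 r
    simp only [Prog.count] at hW
    exact (exec_inc (by simp) m (s.reg r) h (hm.reg r) hm.tmp
      (by rw [hh]; exact Nat.log_mono_right (by omega)) le_rfl le_rfl).mono
      (by simp only [Prog.cost]; omega) (fun _ h => hm.puts_reg h)
  | dec r =>
    have h1 := hZ.1 r
    simp only [Prog.count] at hW
    exact (exec_dec (by simp) m (s.reg r) h (hm.reg r) hm.tmp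
      (by rw [hh]; exact Nat.log_mono_right (by omega)) le_rfl le_rfl).mono
      (by simp only [Prog.cost]; omega) (fun _ h => hm.puts_reg h)
  | clear r =>
    have h1 := hZ.1 r
    simp only [Prog.count] at hW
    exact (exec_wipe m h (by rw [hm.reg, hh]; exact length_dig_le (by omega))).mono
      (by simp only [Prog.cost]; omega) (fun _ h => hm.puts_reg (n := 0) h)
  | copy r r' =>
    have h1 := hZ.1 r
    have h2 := hZ.1 r'
    simp only [Prog.count] at hW
    by_cases hr : r = r'
    · subst hr
      simp only [Prog.compile, if_true]
      refine (Exec.set ⟨⟨hm.st, hm.pos, ?_, hm.stk, hm.bnd, hm.tmp, hm.ptr, hm.ctr⟩,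
        fun _ _ => rfl⟩).mono (by simp only [Prog.cost]; omega) (fun _ h => h)
      simpa [Prog.eval] using hm.reg
    · simp only [Prog.compile, hr, if_false]
      exact (exec_copy (by simp) (by simp) (by simpa using hr) _ m h hm.tmp
        (by rw [hm.reg, hh]; exact length_dig_le (by omega))
        (by rw [hm.reg, hh]; exact length_dig_le (by omega)) le_rfl le_rfl le_rfl).mono
        (by simp only [Prog.cost]; omega) (fun _ h => hm.puts_reg (hm.reg r' ▸ h))
  | read r f =>
    have h1 := hZ.1 r
    simp only [Prog.count] at hW
    refine (Exec.seq (exec_copy (H := heights h H) (u := .tmp) (i := .ptr) (j := .reg r) (by simp) (by simp) (by simp)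
        _ m h hm.tmp (by simp [hm.ptr])
        (by rw [hm.reg, hh]; exact length_dig_le (by omega)) le_rfl le_rfl le_rfl)
      (T' := 1 + ((x.length + 1) * 2 + 1) + (1 + (W * (10 * h + 13) + 1) + 1)) ?_).mono ?_
      (fun _ h => h)
    swap
    · simp only [Prog.cost]; omega
    intro m1 g
    refine Exec.seq (exec_rewind m1 (by rw [g.pos]; exact hm.pos)) ?_
    rintro m2 ⟨f1, f2, f3⟩
    refine Exec.seq (exec_advance m2 (s.reg r) W (by omega) hh f2
      (by rw [f3, g.stk, hm.reg]) (by rw [f3, g.other _ (by simp), hm.tmp])) ?_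
    rintro m3 ⟨k1, k2, k3, k4⟩
    have hst : m3.st = s.st := by rw [k1, f1, g.st, hm.st]
    have hstk : ∀ j ≠ .ptr, m3.stk j = m.stk j := fun j hj => by
      rw [k4 j hj, f3, g.other j hj]
    refine Exec.set ⟨⟨?_, ?_, fun r' => ?_, fun j => ?_, ?_, ?_, k3, fun n hn => ?_⟩,
      fun n hn => ?_⟩
    · simp [hst, k2, scan_min, Prog.eval]
    · simp [k2]
    · exact (hstk _ (by simp)).trans (hm.reg r')
    · exact (hstk _ (by simp)).trans (hm.stk j)
    · exact (hstk _ (by simp)).trans hm.bnd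
    · exact (hstk _ (by simp)).trans hm.tmp
    · exact (hstk _ (by simp)).trans (hm.ctr n hn)
    · exact hstk _ (by simp)
  | push j g =>
    have h1 := (le_max_right _ _).trans hH
    refine (Exec.push ?_ ?_).mono (by simp only [Prog.cost]; omega) (fun _ h => h)
    swap
    · refine hm.puts_stk (l := g s.st s.tops :: s.stk j) _ ⟨rfl, rfl, ?_, ?_⟩
      · simp [hm.st, hm.tops, hm.stk]
      · intro j' hj'
        simp [hj']
    · simpa [hm.stk, heights] using h1
  | pop j =>
    refine (Exec.pop ?_).mono (by simp only [Prog.cost]; omega) (fun _ h => h)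
    refine hm.puts_stk (l := (s.stk j).tail) _ ⟨rfl, rfl, ?_, ?_⟩
    · simp [hm.stk]
    · intro j' hj'
      simp [hj']
  | wipe j =>
    have h1 := hZ.2 j
    exact (exec_wipe m W (by simp only [hm.stk, List.length_map]; omega)).mono
      (by simp only [Prog.cost]; omega) (fun _ h => hm.puts_stk (l := []) _ h)
  | seq p q hp hq =>
    simp only [Prog.height, Prog.count, Prog.eval] at hd hD hW hH
    refine Exec.seq (hp hm (by omega) (by omega) hZ (by omega)
      ((Prog.hw_le_eval x K q _).trans hH)) ?_
    rintro m1 ⟨h1, h2⟩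
    refine (hq h1 (by omega) (by omega) (p.eval_bdd x K hZ) (by omega) hH).mono le_rfl ?_
    rintro m2 ⟨h3, h4⟩
    exact ⟨h3, fun n hn => (h4 n hn).trans (h2 n hn)⟩
  | ite b p q hp hq =>
    simp only [Prog.height, Prog.count, Prog.eval] at hd hD hW hH
    have hb : b m.st (slotZeros m.tops) (slotTops m.tops) = b s.st s.zeros s.tops := by
      rw [hm.st, hm.zeros, hm.tops]
    simp only [Prog.eval]
    rw [← hb] at hH ⊢
    refine (Exec.ite (T := p.cost (100 * (W + 2) ^ 2) K + q.cost (100 * (W + 2) ^ 2) K)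
      (fun hc => ?_) (fun hc => ?_)).mono (by simp only [Prog.cost]; omega) (fun _ h => h)
    · rw [if_pos hc] at hH ⊢
      exact (hp hm (by omega) (by omega) hZ (by omega) hH).mono (by omega) (fun _ h => h)
    · rw [hc] at hH ⊢
      exact (hq hm (by omega) (by omega) hZ (by omega) hH).mono (by omega) (fun _ h => h)
  | rep p hp =>
    simp only [Prog.height, Prog.count, Prog.eval] at hd hD hW hH
    set c : Fin (D + 1) := Fin.ofNat (D + 1) p.height with hc
    have hcv : c.val = p.height := by
      simp only [hc, Fin.ofNat]
      exact Nat.mod_eq_of_lt (by omega)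
    simp only [Prog.eval, Prog.cost]
    refine (Exec.seq (exec_copy (H := heights h H) (u := .tmp) (i := .ctr c) (j := .bnd) (by simp) (by simp) (by simp)
        _ m h hm.tmp (by simp [hm.ctr c (by omega)])
        (by rw [hm.bnd, hh]; exact length_dig_le hKW) le_rfl le_rfl le_rfl)
      (T' := K * (100 * (W + 2) ^ 2 + p.cost (100 * (W + 2) ^ 2) K + 2) + 1) ?_).mono
      (by omega) (fun _ h => h)
    intro m1 g
    -- When the counter `c` shows `k`, the body has been executed `K - k` times; the other counters
    -- from the depth of the body upwards are untouched.
    refine (Exec.loop (T := 100 * (W + 2) ^ 2 + p.cost (100 * (W + 2) ^ 2) K + 1)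
      (fun k m' => k ≤ K ∧ Models x K p.height ((p.eval x K)^[K - k] s) m' ∧
        m'.stk (.ctr c) = dig G k ∧
        ∀ n : Fin (D + 1), n ≠ c → p.height ≤ n.val → m'.stk (.ctr n) = m.stk (.ctr n))
      ?_ K m1 ?_).mono le_rfl ?_
    · rintro k m2 ⟨f1, f2, f3, f4⟩ hb
      have hk : 0 < k := by
        rw [Nat.pos_iff_ne_zero]
        rintro rfl
        change (m2.tops (.ctr c)).isSome = true at hb
        simp [Mem.tops, f3, dig_eq_nil.2] at hb
      have hbdd : ∀ i, ((p.eval x K)^[i] s).Bdd (Z + i * p.count K) := by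
        intro i
        induction i with
        | zero => simpa using hZ
        | succ i ih =>
          rw [Function.iterate_succ_apply']
          exact (p.eval_bdd x K ih).mono (by rw [Nat.succ_mul]; omega)
      have hmul : (K - k + 1) * p.count K ≤ K * p.count K := Nat.mul_le_mul_right _ (by omega)
      rw [Nat.succ_mul] at hmul
      refine ⟨hk, (Exec.seq (exec_dec (by simp) m2 k h f3 f2.tmp
        (by rw [hh]; exact Nat.log_mono_right (by omega)) le_rfl le_rfl)
        (T' := p.cost (100 * (W + 2) ^ 2) K) ?_).mono (by omega) (fun _ h => h)⟩
      intro m3 k1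
      have hm3 : Models x K p.height ((p.eval x K)^[K - k] s) m3 := by
        refine ⟨k1.st.trans f2.st, k1.pos ▸ f2.pos, fun r => ?_, fun j => ?_, ?_, ?_, ?_,
          fun n hn => ?_⟩
        · rw [k1.other _ (by simp), f2.reg]
        · rw [k1.other _ (by simp), f2.stk]
        · rw [k1.other _ (by simp), f2.bnd]
        · rw [k1.other _ (by simp), f2.tmp]
        · rw [k1.other _ (by simp), f2.ptr]
        · rw [k1.other _ (by simp only [ne_eq, Slot.ctr.injEq]; rintro rfl; omega), f2.ctr n hn]
      have e1 : (p.eval x K)^[K - (k - 1)] s = p.eval x K ((p.eval x K)^[K - k] s) := by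
        rw [show K - (k - 1) = K - k + 1 by omega, Function.iterate_succ_apply']
      refine (hp hm3 le_rfl (by omega) (hbdd _) (by omega) ?_).mono le_rfl ?_
      · rw [← e1]
        exact (p.hw_le_iterate x K s (by omega)).trans hH
      · rintro m4 ⟨k2, k3⟩
        refine ⟨by omega, by rw [e1]; exact k2, ?_, fun n hn hn' => ?_⟩
        · rw [k3 c (by omega), k1.stk]
        · rw [k3 n hn', k1.other _ (by simpa using hn), f4 n hn hn']
    · refine ⟨le_rfl, ⟨g.st.trans (by simpa using hm.st), g.pos ▸ hm.pos, fun r => ?_, fun j => ?_,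
        ?_, ?_, ?_, fun n hn => ?_⟩, by rw [g.stk, hm.bnd], fun n hn _ => ?_⟩
      · rw [g.other _ (by simp), hm.reg]; simp
      · rw [g.other _ (by simp), hm.stk]; simp
      · rw [g.other _ (by simp), hm.bnd]
      · rw [g.other _ (by simp), hm.tmp]
      · rw [g.other _ (by simp), hm.ptr]
      · rw [g.other _ (by simp only [ne_eq, Slot.ctr.injEq]; rintro rfl; omega),
          hm.ctr n (by omega)]
      · rw [g.other _ (by simpa using hn)]
    · rintro m2 ⟨hb, k, f1, f2, f3, f4⟩
      change (m2.tops (.ctr c)).isSome = false at hb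
      have h0 : m2.stk (.ctr c) = [] := by simpa [Mem.tops] using hb
      have hk : k = 0 := by rw [← dig_eq_nil (G := G), ← f3, h0]
      subst hk
      refine ⟨⟨f2.st, f2.pos, f2.reg, f2.stk, f2.bnd, f2.tmp, f2.ptr, fun n hn => ?_⟩,
        fun n hn => f4 n (by rintro rfl; omega) (by omega)⟩
      by_cases hn1 : n = c
      · rw [hn1, h0]
      · by_cases hn2 : n.val < p.height
        · exact f2.ctr n hn2
        · rw [f4 n hn1 (by omega), hm.ctr n hn]

end RegisterPrograms


/-! ## Resources of register programs -/

/-- Functions that are bounded by a polynomial. -/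
def PolyBdd (f : ℕ → ℕ) : Prop := ∃ P : Polynomial ℕ, ∀ n, f n ≤ P.eval n

theorem PolyBdd.const (c : ℕ) : PolyBdd fun _ => c := ⟨.C c, by simp⟩

theorem PolyBdd.id : PolyBdd fun n => n := ⟨.X, by simp⟩

theorem PolyBdd.add {f g : ℕ → ℕ} (hf : PolyBdd f) (hg : PolyBdd g) : PolyBdd fun n => f n + g n :=
  let ⟨P, hP⟩ := hf
  let ⟨Q, hQ⟩ := hg
  ⟨P + Q, fun n => by simpa using Nat.add_le_add (hP n) (hQ n)⟩

theorem PolyBdd.mul {f g : ℕ → ℕ} (hf : PolyBdd f) (hg : PolyBdd g) : PolyBdd fun n => f n * g n :=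
  let ⟨P, hP⟩ := hf
  let ⟨Q, hQ⟩ := hg
  ⟨P * Q, fun n => by simpa using Nat.mul_le_mul (hP n) (hQ n)⟩

section Resources

variable {A σ R J G : Type}

theorem Prog.polyBdd_count (p : Prog A σ R J G) : PolyBdd fun N => p.count (N + 1) := by
  induction p with
  | seq p q hp hq => exact hp.add hq
  | ite b p q hp hq => exact hp.add hq
  | rep p hp => exact (PolyBdd.id.add (.const 1)).mul hp
  | _ => exact .const 1

theorem Prog.polyBdd_cost (p : Prog A σ R J G) {c : ℕ → ℕ} (hc : PolyBdd c) :
    PolyBdd fun N => p.cost (c N) (N + 1) := by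
  induction p with
  | seq p q hp hq => exact ((PolyBdd.const 1).add hp).add hq
  | ite b p q hp hq => exact ((PolyBdd.const 1).add hp).add hq
  | rep p hp =>
    exact (hc.add (.const 2)).add ((PolyBdd.id.add (.const 1)).mul ((hc.add hp).add (.const 2)))
  | _ => exact hc

/-- Does the input head scan the right endmarker? -/
def InCell.isRightEnd : InCell A → Bool
  | .rightEnd => true
  | _ => false

theorem isRightEnd_scan (x : List A) (n : ℕ) :
    (scan x n).isRightEnd = decide (x.length < n) := by
  cases n with
  | zero => simp [scan, InCell.isRightEnd]
  | succ n =>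
    by_cases h : n < x.length
    · simp [scan, h, InCell.isRightEnd]
    · have h' : x.length ≤ n := by omega
      simp [scan, h', InCell.isRightEnd]

variable [DecidableEq R] [DecidableEq J]

/-- Before the compiled program starts, the head walks to the right endmarker and counts. The result
|x| + 1 is the number of rounds of all bounded loops. -/
theorem exec_measure {D : ℕ} (x : List A) {h H : ℕ} (hh : Nat.log 2 (x.length + 2) ≤ h) (s₀ : σ) :
    Exec x (heights h H) (.loop (fun _ a _ => !a.isRightEnd) (.seq (incCmd .tmp .bnd) (.move .right)))
      (⟨s₀, 0, fun _ => []⟩ : Mem σ (Bool ⊕ G) (Slot R J D))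
      ((x.length + 1) * (10 * h + 13) + 1)
      (fun m => m.st = s₀ ∧ m.pos = x.length + 1 ∧ m.stk .bnd = dig G (x.length + 1) ∧
        ∀ j ≠ .bnd, m.stk j = []) := by
  refine (Exec.loop (T := 10 * h + 12) (fun k m => m.st = s₀ ∧ m.pos + k = x.length + 1 ∧
    m.stk .bnd = dig G m.pos ∧ ∀ j ≠ .bnd, m.stk j = []) ?_ (x.length + 1) _
    ⟨rfl, by simp, rfl, fun _ _ => rfl⟩).mono le_rfl ?_
  · rintro k m ⟨h1, h2, h3, h4⟩ hb
    simp only [isRightEnd_scan, Bool.not_eq_true', decide_eq_false_iff_not, not_lt] at hb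
    refine ⟨by omega, (Exec.seq (exec_inc (by simp) m m.pos h h3 (h4 _ (by simp))
      ((Nat.log_mono_right (by omega)).trans hh) le_rfl le_rfl) ?_ (T' := 1)).mono (by omega)
      (fun _ h => h)⟩
    rintro m2 ⟨g1, g2, g3, g4⟩
    refine Exec.move ⟨g1.trans h1, ?_, ?_, fun j hj => (g4 j hj).trans (h4 j hj)⟩
    · simp only [Dir.apply, g2]; omega
    · simp only [Dir.apply, g2, g3]
      congr 1; omega
  · rintro m ⟨hb, k, h1, h2, h3, h4⟩
    simp only [isRightEnd_scan, Bool.not_eq_false', decide_eq_true_eq] at hb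
    have : m.pos = x.length + 1 := by omega
    exact ⟨h1, this, this ▸ h3, h4⟩

/-- The state in which register programs are started. -/
def State.initial (R J G : Type) (s₀ : σ) : State σ R J G := ⟨s₀, fun _ => 0, fun _ => [], 0⟩

theorem Machine.HaltsWithin.mono {B : Type} {M : Machine A B} {x : List A} {t u : ℕ}
    (h : M.HaltsWithin x t) (hu : t ≤ u) : M.HaltsWithin x u := by
  rw [Machine.HaltsWithin, Machine.run_eq_of_halted h hu]
  exact h

/-- A register program is executed by a Turing machine in polynomial time and in space that is the
maximum of a logarithm and of the heights of the stacks. -/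
theorem Prog.exists_machine [Finite σ] [Finite R] [Finite J] [Finite G] (p : Prog A σ R J G)
    (s₀ : σ) (acc : σ → Prop) :
    ∃ (M : Machine A Empty) (P Q : Polynomial ℕ), ∀ x : List A,
      M.HaltsWithin x (P.eval x.length) ∧
      (∀ u j, (M.run x u).workPos j ≤ max (Nat.log 2 (Q.eval x.length))
        (p.eval x (x.length + 1) (.initial R J G s₀)).hw) ∧
      (M.Accepts x ↔ acc (p.eval x (x.length + 1) (.initial R J G s₀)).st) := by
  obtain ⟨Q, hQ⟩ := p.polyBdd_count
  -- This is `W + 2` for `W = Q(N) + N + 1`, which is at least the number of instructions, and at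
  -- least the number N + 1 of rounds of a loop.
  set Q' : Polynomial ℕ := Q + .X + .C 3 with hQ'
  have e : ∀ n, Q'.eval n = Q.eval n + n + 1 + 2 := fun n => by simp [hQ']
  have hc : PolyBdd fun N => 100 * (Q'.eval N) ^ 2 := ⟨.C 100 * Q' ^ 2, fun n => by simp⟩
  obtain ⟨P, hP⟩ := p.polyBdd_cost hc
  set c : Cmd A σ (Bool ⊕ G) (Slot R J p.height) :=
    .seq (.loop (fun _ a _ => !a.isRightEnd) (.seq (incCmd .tmp .bnd) (.move .right)))
      (p.compile p.height) with hcdef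
  refine ⟨c.machine s₀ acc, 1 + ((.X + 1) * (10 * Q' + 13) + 1) + P, Q', fun x => ?_⟩
  set N := x.length with hN
  set W := Q.eval N + N + 1 with hW
  set h := Nat.log 2 (W + 2) with hh
  set H := (p.eval x (N + 1) (.initial R J G s₀)).hw with hH
  have hE : Exec x (heights h H) c ⟨s₀, 0, fun _ => []⟩
      (1 + ((N + 1) * (10 * h + 13) + 1) + p.cost (100 * (W + 2) ^ 2) (N + 1))
      (fun m => m.st = (p.eval x (N + 1) (.initial R J G s₀)).st) := by
    refine Exec.seq (exec_measure x (Nat.log_mono_right (by omega)) s₀) ?_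
    rintro m ⟨h1, h2, h3, h4⟩
    refine (exec_compile p.height x (W := W) (H := H) (Z := 0) (K := N + 1)
      (s := .initial R J G s₀) (d := p.height)
      (by omega) (by omega) hh p ?_ le_rfl (by omega) ⟨fun _ => le_rfl, fun _ => le_rfl⟩
      (by have : p.count (N + 1) ≤ Q.eval N := hQ N; omega) le_rfl).mono le_rfl (fun m' hm' => hm'.1.st)
    exact ⟨h1, h2.le, fun r => h4 _ (by simp), fun j => h4 _ (by simp), h3, h4 _ (by simp),
      h4 _ (by simp), fun n _ => h4 _ (by simp)⟩
  obtain ⟨t, m', r1, r2, r3⟩ := hE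
  obtain ⟨k1, k2, k3⟩ := r1.machine (acc := acc)
  refine ⟨k1.mono (r2.trans ?_), fun u j => ?_, ?_⟩
  · have e1 : h ≤ W + 2 := (Nat.log_lt_self 2 (by omega)).le
    have e2 : (N + 1) * (10 * h + 13) ≤ (N + 1) * (10 * (W + 2) + 13) :=
      Nat.mul_le_mul_left _ (by omega)
    have e3 : p.cost (100 * (Q'.eval N) ^ 2) (N + 1) ≤ P.eval N := hP N
    have e4 : Q'.eval N = W + 2 := e N
    rw [e4] at e3
    simp only [Polynomial.eval_add, Polynomial.eval_mul, Polynomial.eval_one, Polynomial.eval_X,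
      Polynomial.eval_ofNat, e4]
    omega
  · obtain ⟨i, hi⟩ := k2 u j
    refine hi.trans ?_
    rw [e N]
    cases i with
    | stk j => exact le_max_right _ _
    | _ => exact le_max_left _ _
  · rw [k3, r3]

end Resources


/-! ## Tools for register programs -/

section Frames

variable {A σ R J G : Type} [DecidableEq R]

/-- The program does not write to register `r`. -/
def Prog.keepsReg (r : R) : Prog A σ R J G → Bool
  | .inc r' => r' ≠ r
  | .dec r' => r' ≠ r
  | .clear r' => r' ≠ r
  | .copy r' _ => r' ≠ r
  | .seq p q => p.keepsReg r && q.keepsReg r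
  | .ite _ p q => p.keepsReg r && q.keepsReg r
  | .rep p => p.keepsReg r
  | _ => true

/-- The program does not change the stacks. -/
def Prog.keepsStk : Prog A σ R J G → Bool
  | .push _ _ => false
  | .pop _ => false
  | .wipe _ => false
  | .seq p q => p.keepsStk && q.keepsStk
  | .ite _ p q => p.keepsStk && q.keepsStk
  | .rep p => p.keepsStk
  | _ => true

omit [DecidableEq R] in
/-- The program does not change the part `π` of the store. -/
def Prog.KeepsSt {α : Type} (π : σ → α) : Prog A σ R J G → Prop
  | .set f => ∀ s z v, π (f s z v) = π s
  | .read _ f => ∀ s a, π (f s a) = π s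
  | .seq p q => p.KeepsSt π ∧ q.KeepsSt π
  | .ite _ p q => p.KeepsSt π ∧ q.KeepsSt π
  | .rep p => p.KeepsSt π
  | _ => True

variable [DecidableEq J] (x : List A) (K : ℕ)

/-- The condition is Boolean, so for most concrete programs it is checked by `rfl`. -/
theorem Prog.eval_reg (p : Prog A σ R J G) {r : R} (h : p.keepsReg r = true) (s : State σ R J G) :
    (p.eval x K s).reg r = s.reg r := by
  induction p generalizing s with
  | seq p q hp hq =>
    simp only [Prog.keepsReg, Bool.and_eq_true] at h
    rw [Prog.eval, hq h.2, hp h.1]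
  | ite b p q hp hq =>
    simp only [Prog.keepsReg, Bool.and_eq_true] at h
    simp only [Prog.eval]
    split_ifs
    · exact hp h.1 s
    · exact hq h.2 s
  | rep p hp =>
    have : ∀ k, ((p.eval x K)^[k] s).reg r = s.reg r := by
      intro k
      induction k with
      | zero => rfl
      | succ k ih => rw [Function.iterate_succ_apply', hp h, ih]
    exact this K
  | inc r' => simp_all [Prog.keepsReg, Prog.eval, Function.update_of_ne, Ne.symm]
  | dec r' => simp_all [Prog.keepsReg, Prog.eval, Function.update_of_ne, Ne.symm]
  | clear r' => simp_all [Prog.keepsReg, Prog.eval, Function.update_of_ne, Ne.symm]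
  | copy r' r'' => simp_all [Prog.keepsReg, Prog.eval, Function.update_of_ne, Ne.symm]
  | _ => rfl

theorem Prog.eval_stk (p : Prog A σ R J G) (h : p.keepsStk = true) (s : State σ R J G) :
    (p.eval x K s).stk = s.stk ∧ (p.eval x K s).hw = s.hw := by
  induction p generalizing s with
  | seq p q hp hq =>
    simp only [Prog.keepsStk, Bool.and_eq_true] at h
    rw [Prog.eval, (hq h.2 _).1, (hq h.2 _).2]
    exact hp h.1 s
  | ite b p q hp hq =>
    simp only [Prog.keepsStk, Bool.and_eq_true] at h
    simp only [Prog.eval]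
    split_ifs
    · exact hp h.1 s
    · exact hq h.2 s
  | rep p hp =>
    have : ∀ k, ((p.eval x K)^[k] s).stk = s.stk ∧ ((p.eval x K)^[k] s).hw = s.hw := by
      intro k
      induction k with
      | zero => exact ⟨rfl, rfl⟩
      | succ k ih => rw [Function.iterate_succ_apply', (hp h _).1, (hp h _).2]; exact ih
    exact this K
  | push => simp [Prog.keepsStk] at h
  | pop => simp [Prog.keepsStk] at h
  | wipe => simp [Prog.keepsStk] at h
  | _ => exact ⟨rfl, rfl⟩

theorem Prog.eval_st (p : Prog A σ R J G) {α : Type} {π : σ → α} (h : p.KeepsSt π)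
    (s : State σ R J G) : π (p.eval x K s).st = π s.st := by
  induction p generalizing s with
  | seq p q hp hq => rw [Prog.eval, hq h.2, hp h.1]
  | ite b p q hp hq =>
    simp only [Prog.eval]
    split_ifs
    · exact hp h.1 s
    · exact hq h.2 s
  | rep p hp =>
    have : ∀ k, π ((p.eval x K)^[k] s).st = π s.st := by
      intro k
      induction k with
      | zero => rfl
      | succ k ih => rw [Function.iterate_succ_apply', hp h, ih]
    exact this K
  | set f => exact h _ _ _
  | read r f => exact h _ _
  | _ => rfl

section Eval

variable {x K} {s : State σ R J G}

theorem Prog.eval_seq {p q : Prog A σ R J G} :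
    (Prog.seq p q).eval x K s = q.eval x K (p.eval x K s) := rfl

theorem Prog.eval_ite {b} {p q : Prog A σ R J G} : (Prog.ite b p q).eval x K s =
    if b s.st s.zeros s.tops then p.eval x K s else q.eval x K s := rfl

theorem Prog.eval_rep {p : Prog A σ R J G} : (Prog.rep p).eval x K s = (p.eval x K)^[K] s := rfl

theorem Prog.eval_copy {r r' : R} : (Prog.copy r r' : Prog A σ R J G).eval x K s =
    { s with reg := Function.update s.reg r (s.reg r') } := rfl

theorem Prog.eval_clear {r : R} : (Prog.clear r : Prog A σ R J G).eval x K s =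
    { s with reg := Function.update s.reg r 0 } := rfl

theorem Prog.eval_set {f} : (Prog.set f : Prog A σ R J G).eval x K s =
    { s with st := f s.st s.zeros s.tops } := rfl

theorem Prog.eval_read {r : R} {f} : (Prog.read r f : Prog A σ R J G).eval x K s =
    { s with st := f s.st (scan x (s.reg r)) } := rfl

end Eval

/-- Do nothing. -/
def Prog.skip : Prog A σ R J G := .set fun s _ _ => s

/-- Execute `body` for `r = 1, 2, …`. -/
def Prog.each (r : R) (body : Prog A σ R J G) : Prog A σ R J G :=
  .seq (.clear r) (.rep (.seq (.inc r) body))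

/-- Repeat a program very often. -/
def Prog.repPow : ℕ → Prog A σ R J G → Prog A σ R J G
  | 0, p => p
  | d + 1, p => .rep (p.repPow d)

theorem Prog.eval_repPow (p : Prog A σ R J G) (d : ℕ) (s : State σ R J G) :
    (p.repPow d).eval x K s = (p.eval x K)^[K ^ d] s := by
  induction d generalizing s with
  | zero => rfl
  | succ d ih =>
    have : (p.repPow d).eval x K = (p.eval x K)^[K ^ d] := funext ih
    rw [Prog.repPow, Prog.eval, this, ← Function.iterate_mul, pow_succ]

/-- The loop rule. -/
theorem iterate_induction {α : Type} {f : α → α} (Inv : ℕ → α → Prop) {s : α} (n : ℕ)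
    (h0 : Inv 0 s) (hstep : ∀ i s, i < n → Inv i s → Inv (i + 1) (f s)) : Inv n (f^[n] s) := by
  have : ∀ i ≤ n, Inv i (f^[i] s) := by
    intro i
    induction i with
    | zero => exact fun _ => h0
    | succ i ih =>
      intro hi
      rw [Function.iterate_succ_apply']
      exact hstep i _ hi (ih (by omega))
  exact this n le_rfl

/-- The invariant must not depend on `r`, which changes before each execution of the body. In round
`i` the body sees `r = i + 1`, because the symbols of the input start in cell 1. -/
theorem Prog.each_induction (r : R) (body : Prog A σ R J G) (Inv : ℕ → State σ R J G → Prop)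
    (hr : body.keepsReg r = true) {s : State σ R J G}
    (hinv : ∀ i s n, Inv i s → Inv i { s with reg := Function.update s.reg r n })
    (h0 : Inv 0 s)
    (hstep : ∀ i s, i < K → s.reg r = i + 1 → Inv i s → Inv (i + 1) (body.eval x K s)) :
    Inv K ((Prog.each r body).eval x K s) := by
  refine (iterate_induction (f := (Prog.seq (.inc r) body).eval x K)
    (fun i s => s.reg r = i ∧ Inv i s) (s := { s with reg := Function.update s.reg r 0 }) K
    ⟨by simp, hinv _ _ _ h0⟩ ?_).2
  rintro i s1 hi ⟨h1, h2⟩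
  simp only [Prog.eval]
  exact ⟨by rw [Prog.eval_reg x K body hr]; simp [h1],
    hstep i _ hi (by simp [h1]) (hinv _ _ _ h2)⟩

end Frames


/-! ## The knapsack instance computed from a formula -/

/-- The block that stands for the number `j`. -/
def blk (j : ℕ) : List Bool := false :: (List.replicate j true ++ [false])

/-- The blocks of the numbers `u, …, v - 1`. -/
def blocks (u v : ℕ) : List Bool := (List.range' u (v - u)).flatMap blk

section Word

variable (x : List SatSym) (K : ℕ)

/-- Does a cell hold the sign of a literal? -/
def InCell.isSign : InCell SatSym → Bool
  | .sym (.sign _) => true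
  | _ => false

/-- Does a cell hold the end mark of a clause? -/
def InCell.isEnd : InCell SatSym → Bool
  | .sym .endClause => true
  | _ => false

/-- The bit that a cell holds. -/
def InCell.bit? : InCell SatSym → Option Bool
  | .sym (.bit b) => some b
  | _ => none

/-- Comparison of the signs of two literals, where `some false` means that these literals are not
complementary. -/
def startNeg : InCell SatSym → InCell SatSym → Option Bool
  | .sym (.sign b), .sym (.sign c) => if b = c then some false else none
  | _, _ => some false

/-- Comparison of two symbols of the names of variables. -/
def cmpCell (c d : InCell SatSym) : Option Bool :=
  match c.bit?, d.bit? with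
  | some b, some b' => if b = b' then none else some false
  | none, none => some true
  | _, _ => some false

/-- The result of the comparison of the literals in the cells `p` and `q` after `k` symbols of the
names of their variables. -/
def scanNeg (p q : ℕ) : ℕ → Option Bool
  | 0 => startNeg (scan x p) (scan x q)
  | k + 1 =>
    match scanNeg p q k with
    | some v => some v
    | none => cmpCell (scan x (p + (k + 1))) (scan x (q + (k + 1)))

/-- The cells `p` and `q` hold complementary literals. -/
def negAt (p q : ℕ) : Bool := scanNeg x p q K = some true

/-- Whether the current clause has a literal already, and the cells of its first and of its last
literal, after `n` cells. -/
def pairState : ℕ → Bool × ℕ × ℕ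
  | 0 => (false, 0, 0)
  | n + 1 =>
    if (scan x (n + 1)).isSign then
      if (pairState n).1 then (true, (pairState n).2.1, n + 1) else (true, n + 1, n + 1)
    else if (scan x (n + 1)).isEnd then (false, (pairState n).2)
    else pairState n

/-- The clauses that end in the first `n` cells, as pairs of cells of literals. -/
def pairsTo : ℕ → List (ℕ × ℕ)
  | 0 => []
  | n + 1 => pairsTo n ++ if (scan x (n + 1)).isEnd then [(pairState x n).2] else []

/-- The number of literals in the first `n` cells. -/
def signsTo : ℕ → ℕ
  | 0 => 0
  | n + 1 => signsTo n + if (scan x (n + 1)).isSign then 1 else 0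

/-- The edges that clause `(f, g)` provides for the literal in cell `p`. -/
def clauseEdges (base p : ℕ) (c : ℕ × ℕ) : List (ℕ × ℕ) :=
  -- For a clause of one literal the two cells coincide and its edge is listed twice, which does no
  -- harm.
  (if negAt x K p c.1 then [(base + p, base + K + c.2)] else []) ++
    if negAt x K p c.2 then [(base + p, base + K + c.1)] else []

/-- The edges from the literal in cell `p` to the next layer. -/
def edgesFrom (base p : ℕ) : List (ℕ × ℕ) :=
  -- This edge stays in the same cell and allows a path to be shorter than the number of layers.
  (base + p, base + K + p) :: (pairsTo x K).flatMap (clauseEdges x K base p)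

/-- The edges between two layers. -/
def layer (base : ℕ) : List (ℕ × ℕ) :=
  (List.range K).flatMap fun i =>
    if (scan x (i + 1)).isSign then edgesFrom x K base (i + 1) else []

/-- All edges; there is a layer for each literal of the formula. -/
def edges : List (ℕ × ℕ) :=
  (List.range K).flatMap fun i =>
    if (scan x (i + 1)).isSign then layer x K (signsTo x i * K) else []

/-- The string for an edge, with the separator in front. -/
def edgeWord (e : ℕ × ℕ) : List (Option Bool) := none :: (blocks e.1 e.2).map some

/-- The knapsack instance that asks for a path from the literal in cell `a` to the literal in
cell `b`. -/
def instWord (a b : ℕ) : List (Option Bool) :=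
  (blocks a (signsTo x K * K + b)).map some ++ (edges x K).flatMap edgeWord

end Word

theorem blocks_of_le {u v : ℕ} (h : v ≤ u) : blocks u v = [] := by
  simp [blocks, Nat.sub_eq_zero_of_le h]

theorem blocks_succ {u v : ℕ} (h : u ≤ v) : blocks u (v + 1) = blocks u v ++ blk v := by
  rw [blocks, blocks, Nat.succ_sub h, List.range'_concat]
  simp [Nat.add_sub_cancel' h]

/-! ## The program that computes it -/

/-- Registers of the reduction. -/
inductive Reg where
  | a | b | ip | c | base | r | p | cl | f | g | u | v | lo | hi | cur | cnt | pp | qq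
  deriving DecidableEq

instance : Finite Reg :=
  Set.finite_univ_iff.1 ((Set.toFinite {.a, .b, .ip, .c, .base, .r, .p, .cl, .f, .g, .u, .v, .lo,
    .hi, .cur, .cnt, .pp, .qq}).subset fun r _ => by cases r <;> simp)

/-- The store of the reduction, which simulates the machine `M`. -/
structure Store (S : Type) (M : Machine (Option S) (Option IdxSym)) where
  /-- the state of `M` -/
  q : M.Q
  /-- the symbol in the scanned cell of the input of `M` -/
  sym : InCell (Option S)
  /-- that symbol has been found -/
  found : Bool
  /-- the first symbol that `M` has written belongs to a solution -/
  first : Option Bool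
  /-- the next action of `M` -/
  act : Option (M.Q × Dir × (Fin M.k → M.Γ × Dir) × Option (Option IdxSym))
  cx : InCell SatSym
  cy : InCell SatSym
  neg : Option Bool
  /-- the current clause has a literal already -/
  hasLit : Bool
  res : Bool
  bad : Bool

section Program

variable {S : Type} {M : Machine (Option S) (Option IdxSym)}

/-- Programs of the reduction. -/
abbrev RProg (S : Type) (M : Machine (Option S) (Option IdxSym)) : Type :=
  Prog SatSym (Store S M) Reg (Fin M.k × Bool) M.Γ

/-- Put a symbol of the input of `M` out: it is the one that is looked for if the counter is
zero. -/
def emit (e : InCell (Option S)) : RProg S M :=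
  .ite (fun s _ _ => s.found) .skip
    (.ite (fun _ z _ => z .c) (.set fun s _ _ => { s with sym := e, found := true }) (.dec .c))

/-- Add register `t` to register `d`. -/
def addTo (d t : Reg) : RProg S M :=
  .seq (.copy .cnt t) (.rep (.ite (fun _ z _ => z .cnt) .skip (.seq (.inc d) (.dec .cnt))))

/-- Put out block number `cur`. -/
def emitBlk (sy : Bool → S) : RProg S M :=
  .seq (emit (.sym (some (sy false))))
    (.seq (.copy .cnt .cur)
      -- The numbers of blocks are at most K² + K, hence at most K³ if K ≥ 2. So three nested loops
      -- are long enough.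
      (.seq (.repPow 3 (.ite (fun _ z _ => z .cnt) .skip
          (.seq (emit (.sym (some (sy true)))) (.dec .cnt))))
        (emit (.sym (some (sy false))))))

/-- Put out the blocks from `u` to `v`. -/
def emitBlocks (sy : Bool → S) : RProg S M :=
  .seq (.copy .lo .u) (.seq (.copy .hi .v) (.seq (.clear .cur)
    -- `lo` and `hi` count down from `u` and `v` while `cur` counts up, so `lo` is zero if `u ≤
    -- cur`, and `hi` is nonzero if `cur < v`.
    (.repPow 3 (.seq (.ite (fun _ z _ => !z .hi && z .lo) (emitBlk sy) .skip)
      (.seq (.dec .lo) (.seq (.dec .hi) (.inc .cur)))))))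

/-- Are the literals in the cells `p` and `q` complementary? -/
def compare (p q : Reg) : RProg S M :=
  .seq (.copy .pp p) (.seq (.copy .qq q)
    (.seq (.read .pp fun s c => { s with cx := c }) (.seq (.read .qq fun s c => { s with cy := c })
      (.seq (.set fun s _ _ => { s with neg := startNeg s.cx s.cy })
        (.rep (.seq (.inc .pp) (.seq (.inc .qq)
          (.seq (.read .pp fun s c => { s with cx := c })
            (.seq (.read .qq fun s c => { s with cy := c })
              -- The first verdict is final, as in `scanNeg`.
              (.set fun s _ _ => { s with neg := s.neg.or (cmpCell s.cx s.cy) }))))))))))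

/-- Put out the string of the edge from `p` to `t`. -/
def emitEdge (sy : Bool → S) (t : Reg) : RProg S M :=
  .seq (.copy .u .base) (.seq (addTo .u .p) (.seq (.copy .v .base) (.seq (.rep (.inc .v))
    (.seq (addTo .v t) (.seq (emit (.sym none)) (emitBlocks sy))))))

/-- Put out the edge from `p` to `t'` if the literals in `p` and `t` are complementary. -/
def emitIf (sy : Bool → S) (t t' : Reg) : RProg S M :=
  .seq (compare .p t) (.ite (fun s _ _ => s.neg == some true) (emitEdge sy t') .skip)

/-- Put out all edges from `p` to the next layer that come from clauses. -/
def emitClauses (sy : Bool → S) : RProg S M :=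
  .seq (.set fun s _ _ => { s with hasLit := false }) (.seq (.clear .f) (.seq (.clear .g)
    (.each .cl (.seq (.read .cl fun s c => { s with cx := c })
      (.ite (fun s _ _ => s.cx.isSign)
        (.seq (.ite (fun s _ _ => s.hasLit) .skip (.copy .f .cl))
          (.seq (.copy .g .cl) (.set fun s _ _ => { s with hasLit := true })))
        (.ite (fun s _ _ => s.cx.isEnd)
          (.seq (emitIf sy .f .g) (.seq (emitIf sy .g .f)
            (.set fun s _ _ => { s with hasLit := false })))
          .skip))))))

/-- Execute `body` for all cells `r` that hold the sign of a literal. -/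
def eachSign (r : Reg) (body : RProg S M) : RProg S M :=
  .each r (.seq (.read r fun s c => { s with cx := c })
    (.ite (fun s _ _ => s.cx.isSign) body .skip))

/-- Put out the edges between two layers. -/
def emitLayer (sy : Bool → S) : RProg S M :=
  eachSign .p (.seq (emitEdge sy .p) (emitClauses sy))

/-- Put out the instance for `a` and `b`. -/
def emitInst (sy : Bool → S) (a b : Reg) : RProg S M :=
  -- The first pass over the literals only computes the offset TK of the last layer, which is needed
  -- for the end of the target word.
  .seq (.clear .base) (.seq (eachSign .r (.rep (.inc .base)))
    (.seq (.copy .u a) (.seq (.copy .v .base) (.seq (addTo .v b) (.seq (emitBlocks sy)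
      (.seq (.clear .base) (eachSign .r (.seq (emitLayer sy) (.rep (.inc .base))))))))))

/-- Find the symbol that `M` scans on its input. -/
def fetch (sy : Bool → S) (a b : Reg) : RProg S M :=
  -- This default survives if the word ends before the counter has run down, that is, if the head of
  -- `M` is beyond the last symbol.
  .seq (.set fun s _ _ => { s with sym := .rightEnd, found := false })
    (.seq (.copy .c .ip) (.seq (emit .leftEnd) (emitInst sy a b)))

end Program

/-! ### Correctness -/

section Correctness

variable {S : Type} {M : Machine (Option S) (Option IdxSym)} (x : List SatSym) (K : ℕ)

/-- States of the reduction. -/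
abbrev RState (S : Type) (M : Machine (Option S) (Option IdxSym)) : Type :=
  State (Store S M) Reg (Fin M.k × Bool) M.Γ

/-- The effect of putting out a symbol on the counter, the symbol found and the flag. -/
def emitStep (t : ℕ × InCell (Option S) × Bool) (e : InCell (Option S)) :
    ℕ × InCell (Option S) × Bool :=
  if t.2.2 then t else if t.1 = 0 then (0, e, true) else (t.1 - 1, t.2)

/-- The effect of putting out a word. -/
def emits (sy : Bool → S) (l : List (Option Bool)) (t : ℕ × InCell (Option S) × Bool) :
    ℕ × InCell (Option S) × Bool :=
  (l.map fun o => InCell.sym (o.map sy)).foldl emitStep t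

theorem emits_append (sy : Bool → S) (l l' : List (Option Bool)) (t) :
    emits sy (l ++ l') t = emits sy l' (emits sy l t) := by
  simp [emits]

/-- The part of the state that putting out symbols acts on. -/
def em (s : RState S M) : ℕ × InCell (Option S) × Bool := (s.reg .c, s.st.sym, s.st.found)

theorem em_eval {p : RProg S M} (h : p.keepsReg .c = true)
    (h' : p.KeepsSt fun s => (s.sym, s.found)) (s : RState S M) : em (p.eval x K s) = em s := by
  have h1 := p.eval_st x K h' s
  simp only [Prod.mk.injEq] at h1
  simp only [em, Prog.eval_reg x K p h, h1]

theorem em_emit (e : InCell (Option S)) (s : RState S M) :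
    em ((emit e).eval x K s) = emitStep (em s) e := by
  simp only [emit, Prog.eval, em, emitStep, State.zeros, Prog.skip]
  by_cases h1 : s.st.found
  · simp [h1]
  · by_cases h2 : s.reg .c = 0 <;> simp [h1, h2]

theorem em_emit_some (sy : Bool → S) (o : Bool) (s : RState S M) :
    em ((emit (.sym (some (sy o)))).eval x K s) = emits sy [some o] (em s) :=
  em_emit x K _ s

/-- A bounded loop has `K` rounds, which limits the summand. -/
theorem reg_addTo {d t : Reg} (hd : d ≠ .cnt) (s : RState S M)
    (h : s.reg t ≤ K) : ((addTo d t).eval x K s).reg d = s.reg d + s.reg t := by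
  rw [addTo, Prog.eval_seq, Prog.eval_rep, Prog.eval_copy]
  have := iterate_induction (f := Prog.eval x K (.ite (fun _ z _ => z .cnt) .skip
      (.seq (.inc d) (.dec .cnt)) : RProg S M))
    (fun i s' => s'.reg d = s.reg d + min i (s.reg t) ∧ s'.reg .cnt = s.reg t - i)
    (s := { s with reg := Function.update s.reg .cnt (s.reg t) }) K (by simp [hd]) ?_
  · rw [this.1, min_eq_right h]
  · rintro i s' hi ⟨h1, h2⟩
    by_cases h3 : s.reg t - i = 0
    · simp only [Prog.eval, State.zeros, h2, h3, Prog.skip, decide_true, if_true]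
      exact ⟨by rw [h1]; omega, by omega⟩
    · simp only [Prog.eval, State.zeros, h2, h3, decide_false]
      simp [hd, hd.symm, h1, h2]
      omega

theorem reg_addK (d : Reg) (s : RState S M) :
    ((Prog.rep (.inc d)).eval x K s).reg d = s.reg d + K := by
  refine iterate_induction (fun i (s' : RState S M) => s'.reg d = s.reg d + i) K rfl ?_
  intro i s' _ h
  simp [Prog.eval, h]; omega

theorem em_emitBlk (sy : Bool → S) (s : RState S M) (h : s.reg .cur ≤ K ^ 3) :
    em ((emitBlk sy).eval x K s) = emits sy ((blk (s.reg .cur)).map some) (em s) := by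
  rw [emitBlk, Prog.eval_seq, Prog.eval_seq, Prog.eval_seq, Prog.eval_repPow, Prog.eval_copy]
  set s1 := (emit (.sym (some (sy false)))).eval x K s with hs1
  have e1 : em s1 = emits sy [some false] (em s) := em_emit_some x K sy _ s
  have e2 : s1.reg .cur = s.reg .cur := Prog.eval_reg x K _ rfl s
  have := iterate_induction (f := Prog.eval x K (.ite (fun _ z _ => z .cnt) .skip
      (.seq (emit (.sym (some (sy true)))) (.dec .cnt)) : RProg S M))
    (fun i s' => em s' = emits sy (List.replicate (min i (s.reg .cur)) (some true)) (em s1) ∧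
      s'.reg .cnt = s.reg .cur - i)
    (s := { s1 with reg := Function.update s1.reg .cnt (s1.reg .cur) }) (K ^ 3)
    (by simp [e2, em, emits]) ?_
  · rw [em_emit_some, this.1, min_eq_right h, e1, ← emits_append, ← emits_append]
    simp [blk]
  · rintro i s' hi ⟨h1, h2⟩
    by_cases h3 : s.reg .cur - i = 0
    · simp only [Prog.eval, State.zeros, h2, h3, Prog.skip, decide_true, if_true]
      refine ⟨?_, by omega⟩
      change em s' = _
      rw [h1, show min (i + 1) (s.reg .cur) = min i (s.reg .cur) by omega]
    · simp only [Prog.eval, State.zeros, h2, h3, decide_false]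
      refine ⟨?_, ?_⟩
      · change em ((emit (.sym (some (sy true)))).eval x K s') = _
        rw [em_emit_some, h1, ← emits_append, show min (i + 1) (s.reg .cur) =
          min i (s.reg .cur) + 1 by omega, List.replicate_succ']
      · have : ((emit (.sym (some (sy true)))).eval x K s').reg .cnt = s'.reg .cnt :=
          Prog.eval_reg x K _ rfl s'
        simp only [Bool.false_eq_true, if_false, Function.update_self, this, h2]
        omega

theorem em_emitBlocks (sy : Bool → S) (s : RState S M) (h : s.reg .v ≤ K ^ 3) :
    em ((emitBlocks sy).eval x K s) = emits sy ((blocks (s.reg .u) (s.reg .v)).map some) (em s) := by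
  rw [emitBlocks, Prog.eval_seq, Prog.eval_seq, Prog.eval_seq, Prog.eval_repPow, Prog.eval_copy,
    Prog.eval_copy, Prog.eval_clear]
  refine (iterate_induction (f := Prog.eval x K
    (.seq (.ite (fun _ z _ => !z .hi && z .lo) (emitBlk sy) .skip)
      (.seq (.dec .lo) (.seq (.dec .hi) (.inc .cur))) : RProg S M))
    (fun i s' => em s' = emits sy ((blocks (s.reg .u) (min i (s.reg .v))).map some) (em s) ∧
      s'.reg .lo = s.reg .u - i ∧ s'.reg .hi = s.reg .v - i ∧ s'.reg .cur = i) (K ^ 3) ?_ ?_).1.trans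
    (by rw [min_eq_right h])
  · simp [em, emits, blocks_of_le]
  · rintro i s' hi ⟨h1, h2, h3, h4⟩
    set p : RProg S M := .ite (fun _ z _ => !z .hi && z .lo) (emitBlk sy) .skip with hp
    have k1 : (p.eval x K s').reg .lo = s'.reg .lo := Prog.eval_reg x K _ rfl s'
    have k2 : (p.eval x K s').reg .hi = s'.reg .hi := Prog.eval_reg x K _ rfl s'
    have k3 : (p.eval x K s').reg .cur = s'.reg .cur := Prog.eval_reg x K _ rfl s'
    refine ⟨?_, ?_, ?_, ?_⟩
    · change em (p.eval x K s') = _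
      simp only [hp, Prog.eval, State.zeros, h2, h3]
      by_cases h5 : s.reg .u ≤ i
      · by_cases h6 : s.reg .v ≤ i
        · simp only [Nat.sub_eq_zero_of_le h6, decide_true, Bool.not_true, Bool.false_and,
            Prog.skip]
          change em s' = _
          rw [h1, min_eq_right h6, min_eq_right (h6.trans (Nat.le_succ i))]
        · have h7 : s.reg .v - i ≠ 0 := by omega
          simp only [Nat.sub_eq_zero_of_le h5, h7, decide_true, decide_false, Bool.not_false,
            Bool.true_and, if_true]
          rw [em_emitBlk x K sy s' (by omega), h1, ← emits_append, h4, min_eq_left (by omega),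
            min_eq_left (by omega), blocks_succ h5, List.map_append]
      · have h7 : s.reg .u - i ≠ 0 := by omega
        simp only [h7, decide_false, Bool.and_false, Prog.skip]
        change em s' = _
        rw [h1, blocks_of_le (by omega), blocks_of_le (by omega)]
    · simp [Prog.eval, k1, h2]; omega
    · simp [Prog.eval, k2, h3]; omega
    · simp [Prog.eval, k3, h4]

/-- `q` must differ from `.pp`, which is overwritten before `q` is read. -/
theorem neg_compare {p q : Reg} (hq : q ≠ .pp) (s : RState S M) :
    ((compare p q).eval x K s).st.neg = scanNeg x (s.reg p) (s.reg q) K := by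
  simp only [compare, Prog.eval_seq, Prog.eval_rep, Prog.eval_copy, Prog.eval_set, Prog.eval_read]
  refine (iterate_induction (fun i (s' : RState S M) => s'.st.neg = scanNeg x (s.reg p) (s.reg q) i ∧
    s'.reg .pp = s.reg p + i ∧ s'.reg .qq = s.reg q + i) K ?_ ?_).1
  · simp [scanNeg, hq]
  · rintro i s' _ ⟨h1, h2, h3⟩
    refine ⟨?_, ?_, ?_⟩
    · simp only [Prog.eval, h1, h2, h3, scanNeg, Function.update_self, ne_eq, reduceCtorEq,
        not_false_eq_true, Function.update_of_ne, add_assoc]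
      cases scanNeg x (s.reg p) (s.reg q) i <;> rfl
    · simp [Prog.eval, h2]; omega
    · simp [Prog.eval, h3]; omega

theorem reg_copy_addTo {d t : Reg} (hd : d ≠ .cnt) (hdt : t ≠ d) (s : RState S M)
    (h : s.reg t ≤ K) :
    ((Prog.seq (.copy d .base) (addTo d t)).eval x K s).reg d = s.reg .base + s.reg t := by
  rw [Prog.eval_seq, reg_addTo x K hd _ (by simpa [Prog.eval_copy, hdt] using h)]
  simp [Prog.eval_copy, hdt]

/-- The last hypothesis guarantees that both ends of the edge are in the range up to K³ that
`emitBlocks` covers. -/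
theorem em_emitEdge (sy : Bool → S) {t : Reg} (ht : t = .p ∨ t = .f ∨ t = .g) (s : RState S M)
    (hp : s.reg .p ≤ K) (htK : s.reg t ≤ K) (hb : s.reg .base + 2 * K ≤ K ^ 3) :
    em ((emitEdge sy t).eval x K s) =
      emits sy (edgeWord (s.reg .base + s.reg .p, s.reg .base + K + s.reg t)) (em s) := by
  have key : ∀ s' : RState S M, em s' = em s → s'.reg .u = s.reg .base + s.reg .p →
      s'.reg .v = s.reg .base + K + s.reg t →
      em ((Prog.seq (emit (.sym none)) (emitBlocks sy)).eval x K s') =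
        emits sy (edgeWord (s.reg .base + s.reg .p, s.reg .base + K + s.reg t)) (em s) := by
    intro s' h1 h2 h3
    rw [Prog.eval_seq]
    have e1 : ((emit (.sym none) : RProg S M).eval x K s').reg .u = s'.reg .u :=
      Prog.eval_reg x K _ rfl s'
    have e2 : ((emit (.sym none) : RProg S M).eval x K s').reg .v = s'.reg .v :=
      Prog.eval_reg x K _ rfl s'
    rw [em_emitBlocks x K sy _ (by omega), em_emit, e1, e2, h1, h2, h3]
    rfl
  have e : (emitEdge sy t : RProg S M).eval x K s =
      (Prog.seq (emit (.sym none)) (emitBlocks sy)).eval x K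
        ((addTo .v t : RProg S M).eval x K ((Prog.rep (.inc .v)).eval x K
          ((Prog.copy .v .base).eval x K
            ((Prog.seq (.copy .u .base) (addTo .u .p)).eval x K s)))) := rfl
  rw [e]
  set s1 := (Prog.seq (.copy .u .base) (addTo .u .p) : RProg S M).eval x K s with hs1
  set s2 := (Prog.copy .v .base : RProg S M).eval x K s1 with hs2
  set s3 := (Prog.rep (.inc .v) : RProg S M).eval x K s2 with hs3
  have hst : ∀ r : Reg, r = .p ∨ r = .f ∨ r = .g → s3.reg r = s.reg r := by
    rintro r (rfl | rfl | rfl) <;>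
    exact (Prog.eval_reg x K _ rfl s2).trans
      ((Prog.eval_reg x K _ rfl s1).trans (Prog.eval_reg x K _ rfl s))
  refine key _ ?_ ?_ ?_
  · refine (em_eval x K rfl ?_ _).trans ((em_eval x K rfl ?_ _).trans ((em_eval x K rfl ?_ _).trans
      (em_eval x K rfl ?_ _))) <;> simp [Prog.KeepsSt, addTo, Prog.skip]
  · rw [Prog.eval_reg x K _ rfl, Prog.eval_reg x K _ rfl, Prog.eval_reg x K _ rfl,
      reg_copy_addTo x K (by simp) (by simp) s hp]
  · rw [reg_addTo x K (by simp) _ (by rw [hst t ht]; exact htK), hst t ht, reg_addK]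
    have : s1.reg .base = s.reg .base := Prog.eval_reg x K _ rfl s
    simp [hs2, Prog.eval_copy, this]

end Correctness


/-! ### Correctness of the enumeration of the edges and of the whole instance. -/

section Correctness

variable {S : Type} {M : Machine (Option S) (Option IdxSym)} (x : List SatSym) (K : ℕ)

theorem pairState_le (n : ℕ) : (pairState x n).2.1 ≤ n ∧ (pairState x n).2.2 ≤ n := by
  induction n with
  | zero => simp [pairState]
  | succ n ih =>
    simp only [pairState]
    split_ifs <;> constructor <;> first | omega | (simp; done) | (simp; omega)

theorem signsTo_le (n : ℕ) : signsTo x n ≤ n := by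
  induction n with
  | zero => simp [signsTo]
  | succ n ih =>
    simp only [signsTo]
    split_ifs <;> omega

theorem em_emitIf (sy : Bool → S) {t t' : Reg} (ht : t = .f ∨ t = .g) (ht' : t' = .f ∨ t' = .g)
    (s : RState S M) (hp : s.reg .p ≤ K) (htK : s.reg t' ≤ K)
    (hb : s.reg .base + 2 * K ≤ K ^ 3) :
    em ((emitIf sy t t').eval x K s) = emits sy (if negAt x K (s.reg .p) (s.reg t) then
      edgeWord (s.reg .base + s.reg .p, s.reg .base + K + s.reg t') else []) (em s) := by
  rw [emitIf, Prog.eval_seq, Prog.eval_ite]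
  have hneg := neg_compare (M := M) x K (p := .p) (q := t) (by rcases ht with rfl | rfl <;> simp) s
  set s1 := (compare .p t : RProg S M).eval x K s with hs1
  have hem : em s1 = em s := em_eval x K (by rcases ht with rfl | rfl <;> rfl)
    (by simp [Prog.KeepsSt, compare]) s
  have h1 : s1.reg .p = s.reg .p := Prog.eval_reg x K _ (by rcases ht with rfl | rfl <;> rfl) s
  have h2 : s1.reg .base = s.reg .base :=
    Prog.eval_reg x K _ (by rcases ht with rfl | rfl <;> rfl) s
  have h3 : s1.reg t' = s.reg t' :=
    Prog.eval_reg x K _ (by rcases ht with rfl | rfl <;> rcases ht' with rfl | rfl <;> rfl) s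
  simp only [hneg, negAt, beq_iff_eq, decide_eq_true_eq]
  split_ifs with h
  · rw [em_emitEdge x K sy (.inr ht') s1 (by omega) (by omega) (by omega), hem, h1, h2, h3]
  · exact hem

/-- While the formula is scanned, `hasLit`, `f` and `g` follow `pairState`. So at the end mark of a
clause, `f` and `g` point to its literals. -/
theorem em_emitClauses (sy : Bool → S) (s : RState S M) (hp : s.reg .p ≤ K)
    (hb : s.reg .base + 2 * K ≤ K ^ 3) :
    em ((emitClauses sy).eval x K s) = emits sy
      (((pairsTo x K).flatMap (clauseEdges x K (s.reg .base) (s.reg .p))).flatMap edgeWord)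
      (em s) := by
  rw [emitClauses, Prog.eval_seq, Prog.eval_seq, Prog.eval_seq, Prog.eval_set, Prog.eval_clear,
    Prog.eval_clear]
  refine (Prog.each_induction x K .cl _ (fun i (s' : RState S M) => em s' = emits sy
      (((pairsTo x i).flatMap (clauseEdges x K (s.reg .base) (s.reg .p))).flatMap edgeWord)
      (em s) ∧ (s'.st.hasLit, s'.reg .f, s'.reg .g) = pairState x i ∧
      s'.reg .base = s.reg .base ∧ s'.reg .p = s.reg .p) ?_ ?_ ?_ ?_).1
  · rfl
  · rintro i s' n ⟨h1, h2, h3, h4⟩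
    exact ⟨by simpa [em] using h1, by simpa using h2, by simpa using h3, by simpa using h4⟩
  · exact ⟨by simp [em, pairsTo, emits], by simp [pairState], by simp, by simp⟩
  · rintro i s' hi hcl ⟨h1, h2, h3, h4⟩
    rw [Prog.eval_seq, Prog.eval_read, Prog.eval_ite]
    simp only [hcl, pairsTo, pairState]
    by_cases hs : (scan x (i + 1)).isSign = true
    · have he : (scan x (i + 1)).isEnd = false := by
        revert hs
        generalize scan x (i + 1) = c
        rintro h
        rcases c with _ | (_ | _ | _) | _ <;> simp_all [InCell.isSign, InCell.isEnd]
      simp only [hs, he, if_true, ← h2]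
      simp only [em] at h1
      cases hl : s'.st.hasLit <;>
        simp [Prog.eval, hcl, h3, h4, Prog.skip, h1, em]
    · simp only [hs, if_false, Bool.false_eq_true]
      rw [Prog.eval_ite]
      by_cases he : (scan x (i + 1)).isEnd = true
      · simp only [he, if_true, Prog.eval_seq]
        set s1 : RState S M := { s' with st := { s'.st with cx := scan x (i + 1) } } with hs1
        set s2 := (emitIf sy .f .g).eval x K s1 with hs2
        set s3 := (emitIf sy .g .f).eval x K s2 with hs3
        obtain ⟨hf, hg⟩ := pairState_le x i
        rw [← h2] at hf hg ⊢
        simp only at hf hg ⊢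
        have r2 : ∀ r : Reg, r ∈ [Reg.base, .p, .f, .g] → s2.reg r = s'.reg r := by
          intro r hr
          simp only [List.mem_cons, List.not_mem_nil, or_false] at hr
          rcases hr with rfl | rfl | rfl | rfl <;> exact Prog.eval_reg x K _ rfl s1
        have r3 : ∀ r : Reg, r ∈ [Reg.base, .p, .f, .g] → s3.reg r = s'.reg r := by
          intro r hr
          rw [← r2 r hr]
          simp only [List.mem_cons, List.not_mem_nil, or_false] at hr
          rcases hr with rfl | rfl | rfl | rfl <;> exact Prog.eval_reg x K _ rfl s2
        have e2 : em s2 = _ := em_emitIf x K sy (.inl rfl) (.inr rfl) s1 (by simp [hs1, h4, hp])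
          (by simp only [hs1]; omega) (by simp only [hs1]; omega)
        have e3 : em s3 = _ := em_emitIf x K sy (.inr rfl) (.inl rfl) s2
          (by rw [r2 _ (by simp)]; omega) (by rw [r2 _ (by simp)]; omega)
          (by rw [r2 _ (by simp)]; omega)
        refine ⟨?_, ?_, (r3 _ (by simp)).trans h3, (r3 _ (by simp)).trans h4⟩
        · change em s3 = _
          rw [e3, e2, r2 _ (by simp), r2 _ (by simp), r2 _ (by simp), r2 _ (by simp)]
          simp only [hs1]
          change emits sy _ (emits sy _ (em s')) = _
          rw [h1, ← emits_append, ← emits_append, List.flatMap_append, List.flatMap_append]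
          congr 1
          simp only [h3, h4, clauseEdges, List.flatMap_cons, List.flatMap_nil, List.append_nil,
            List.flatMap_append]
          congr 1
          split_ifs <;> simp
        · simp only [Prog.eval_set, r3 .f (by simp), r3 .g (by simp)]
      · simp only [he, Bool.false_eq_true, if_false, List.append_nil]
        exact ⟨h1, h2, h3, h4⟩

theorem eachSign_induction (r : Reg) (body : RProg S M) (Inv : ℕ → RState S M → Prop)
    (hr : body.keepsReg r = true)
    {s : RState S M}
    (hinv : ∀ i s n, Inv i s → Inv i { s with reg := Function.update s.reg r n })
    (hcx : ∀ i s c, Inv i s → Inv i { s with st := { s.st with cx := c } })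
    (h0 : Inv 0 s)
    (hstep : ∀ i s, i < K → s.reg r = i + 1 → (scan x (i + 1)).isSign = true → Inv i s →
      Inv (i + 1) (body.eval x K s))
    (hskip : ∀ i s, (scan x (i + 1)).isSign = false → Inv i s → Inv (i + 1) s) :
    Inv K ((eachSign r body).eval x K s) := by
  refine Prog.each_induction x K r _ Inv (by simp [Prog.keepsReg, hr, Prog.skip]) hinv h0 ?_
  intro i s' hi h1 h2
  rw [Prog.eval_seq, Prog.eval_read, Prog.eval_ite]
  simp only [h1]
  split_ifs with h
  · exact hstep i _ hi h1 h (hcx i s' _ h2)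
  · exact hskip i _ (by simpa using h) (hcx i s' _ h2)

theorem em_emitLayer (sy : Bool → S) (s : RState S M) (hb : s.reg .base + 2 * K ≤ K ^ 3) :
    em ((emitLayer sy).eval x K s) =
      emits sy ((layer x K (s.reg .base)).flatMap edgeWord) (em s) := by
  refine (eachSign_induction x K .p _ (fun i (s' : RState S M) => em s' = emits sy
      (((List.range i).flatMap fun i => if (scan x (i + 1)).isSign then
        edgesFrom x K (s.reg .base) (i + 1) else []).flatMap edgeWord) (em s) ∧
      s'.reg .base = s.reg .base) rfl ?_ ?_ ?_ ?_ ?_).1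
  · rintro i s' n ⟨h1, h2⟩
    exact ⟨by simpa [em] using h1, by simpa using h2⟩
  · rintro i s' n ⟨h1, h2⟩
    exact ⟨h1, h2⟩
  · exact ⟨by simp [emits], rfl⟩
  · rintro i s' hi hp hs ⟨h1, h2⟩
    rw [Prog.eval_seq]
    have r1 : ((emitEdge sy .p : RProg S M).eval x K s').reg .base = s'.reg .base :=
      Prog.eval_reg x K _ rfl s'
    have r2 : ((emitEdge sy .p : RProg S M).eval x K s').reg .p = s'.reg .p :=
      Prog.eval_reg x K _ rfl s'
    refine ⟨?_, ?_⟩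
    · rw [em_emitClauses x K sy _ (by omega) (by omega),
        em_emitEdge x K sy (.inl rfl) s' (by omega) (by omega) (by omega), r1, r2, h1, h2, hp,
        List.range_succ, List.flatMap_append, List.flatMap_append, emits_append]
      simp only [List.flatMap_cons, List.flatMap_nil, List.append_nil, hs, if_true, edgesFrom,
        emits_append]
    · exact (Prog.eval_reg x K _ rfl _).trans (r1.trans h2)
  · rintro i s' hs ⟨h1, h2⟩
    refine ⟨?_, h2⟩
    rw [h1, List.range_succ, List.flatMap_append]
    simp [hs]


theorem em_emitInst (sy : Bool → S) {a b : Reg} (ha : a = .a ∨ a = .b) (hb : b = .a ∨ b = .b)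
    (s : RState S M) (hK : 2 ≤ K) (hbK : s.reg b ≤ K) :
    em ((emitInst sy a b).eval x K s) =
      emits sy (instWord x K (s.reg a) (s.reg b)) (em s) := by
  rw [emitInst, Prog.eval_seq, Prog.eval_seq]
  set s1 := (eachSign .r (.rep (.inc .base)) : RProg S M).eval x K
    ((Prog.clear .base).eval x K s) with hs1
  have hbase : s1.reg .base = signsTo x K * K := by
    refine eachSign_induction x K .r _ (fun i (s' : RState S M) => s'.reg .base = signsTo x i * K)
      rfl ?_ ?_ ?_ ?_ ?_
    · intro i s' n h; simpa using h
    · intro i s' n h; exact h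
    · simp [signsTo, Prog.eval_clear]
    · intro i s' hi h1 h2 h3
      rw [reg_addK, h3, signsTo, if_pos h2, Nat.succ_mul]
    · intro i s' h1 h2
      simp [signsTo, h1, h2]
  have hem1 : em s1 = em s := (em_eval x K rfl (by simp [Prog.KeepsSt, eachSign, Prog.each,
    Prog.skip]) _).trans (em_eval x K (by rfl) (by exact trivial) s)
  have hreg1 : ∀ r : Reg, r = .a ∨ r = .b → s1.reg r = s.reg r := by
    rintro r (rfl | rfl) <;>
    exact (Prog.eval_reg x K _ rfl _).trans (Prog.eval_reg x K _ rfl s)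
  have e : ∀ s1 : RState S M, Prog.eval x K (.seq (.copy .u a) (.seq (.copy .v .base)
      (.seq (addTo .v b) (.seq (emitBlocks sy)
      (.seq (.clear .base) (eachSign .r (.seq (emitLayer sy) (.rep (.inc .base))))))))) s1 =
      (eachSign .r (.seq (emitLayer sy) (.rep (.inc .base)))).eval x K
        ((Prog.clear .base).eval x K ((emitBlocks sy).eval x K
          ((Prog.seq (.copy .v .base) (addTo .v b)).eval x K ((Prog.copy .u a).eval x K s1)))) :=
    fun _ => rfl
  rw [e]
  set s2 := (Prog.copy .u a : RProg S M).eval x K s1 with hs2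
  set s3 := (Prog.seq (.copy .v .base) (addTo .v b) : RProg S M).eval x K s2 with hs3
  have hreg2 : s2.reg b = s.reg b := by
    rw [← hreg1 b hb]
    rcases hb with rfl | rfl <;> exact Prog.eval_reg x K _ rfl _
  have hu : s3.reg .u = s.reg a := by
    rw [← hreg1 a ha]
    refine (Prog.eval_reg x K _ rfl _).trans ?_
    simp [hs2, Prog.eval_copy]
  have hv : s3.reg .v = signsTo x K * K + s.reg b := by
    rw [hs3, reg_copy_addTo x K (by simp) (by rcases hb with rfl | rfl <;> simp) s2 (by omega),
      hreg2, ← hbase]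
    congr 1
  have hem3 : em s3 = em s := by
    rw [← hem1]
    exact (em_eval x K rfl (by simp [Prog.KeepsSt, addTo, Prog.skip]) _).trans
      (em_eval x K (by rfl) (by exact trivial) s1)
  have hsK := signsTo_le x K
  -- Here `2 ≤ K` is needed: the end TK + b of the target word must not exceed K³.
  have hK3 : K * K + K ≤ K ^ 3 := by nlinarith [Nat.mul_le_mul_right K (Nat.mul_le_mul hK hK)]
  have hem4 := em_emitBlocks x K sy s3
    (by rw [hv]; exact (Nat.add_le_add (Nat.mul_le_mul_right K hsK) hbK).trans hK3)
  set s4 := (emitBlocks sy).eval x K s3 with hs4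
  have := eachSign_induction x K .r (.seq (emitLayer sy) (.rep (.inc .base)))
    (fun i (s' : RState S M) => s'.reg .base = signsTo x i * K ∧ em s' = emits sy
      (((List.range i).flatMap fun i => if (scan x (i + 1)).isSign then
        layer x K (signsTo x i * K) else []).flatMap edgeWord) (em s4))
    rfl (s := (Prog.clear .base).eval x K s4) ?_ ?_ ?_ ?_ ?_
  · rw [this.2, hem4, hu, hv, hem3, ← emits_append]
    rfl
  · rintro i s' n ⟨h1, h2⟩
    exact ⟨by simpa using h1, by simpa [em] using h2⟩
  · rintro i s' n ⟨h1, h2⟩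
    exact ⟨h1, h2⟩
  · exact ⟨by simp [signsTo, Prog.eval_clear], em_eval x K (by rfl) (by exact trivial) s4⟩
  · rintro i s' hi h1 h2 ⟨h3, h4⟩
    -- Since `i < K`, at most K - 1 literals precede this one, so the sum is at most (K + 1)K.
    have hb' : s'.reg .base + 2 * K ≤ K ^ 3 := by
      rw [h3]
      have := signsTo_le x i
      have : (signsTo x i + 2) * K ≤ (K + 1) * K := Nat.mul_le_mul_right _ (by omega)
      nlinarith
    have h5 : ((emitLayer sy : RProg S M).eval x K s').reg .base = s'.reg .base :=
      Prog.eval_reg x K _ rfl s'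
    rw [Prog.eval_seq]
    refine ⟨?_, ?_⟩
    · rw [reg_addK, h5, h3, signsTo, if_pos h2, Nat.succ_mul]
    · rw [em_eval x K rfl (by simp [Prog.KeepsSt]), em_emitLayer x K sy s' hb', h4, ← emits_append,
        h3, List.range_succ, List.flatMap_append, List.flatMap_append]
      simp [h2]
  · rintro i s' h1 ⟨h2, h3⟩
    refine ⟨by simp [signsTo, h1, h2], ?_⟩
    rw [h3, List.range_succ, List.flatMap_append]
    simp [h1]

theorem emits_found (sy : Bool → S) (l : List (Option Bool)) (c e) :
    emits sy l (c, e, true) = (c, e, true) := by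
  induction l with
  | nil => rfl
  | cons o l ih => exact ih

/-- Each symbol put out lowers the counter, and the one that meets the value zero is kept. -/
theorem emits_scan (sy : Bool → S) (l : List (Option Bool)) (c : ℕ) (y : InCell (Option S)) :
    (emits sy l (c, y, false)).2.1 =
      match l[c]? with
      | some o => .sym (o.map sy)
      | none => y := by
  induction l generalizing c with
  | nil => rfl
  | cons o l ih =>
    cases c with
    | zero =>
      change (emits sy l (0, _, true)).2.1 = _
      rw [emits_found]; rfl
    | succ c =>
      change (emits sy l (c, _, false)).2.1 = _
      rw [ih]; rfl

/-- This is what saves the space for the instance: its word is enumerated anew whenever `M` reads a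
symbol, and only the symbol under the head is remembered. The position 0 is the left endmarker,
which is therefore put out before the word. -/
theorem sym_fetch (sy : Bool → S) {a b : Reg} (ha : a = .a ∨ a = .b) (hb : b = .a ∨ b = .b)
    (s : RState S M) (hK : 2 ≤ K) (hbK : s.reg b ≤ K) :
    ((fetch sy a b).eval x K s).st.sym =
      scan ((instWord x K (s.reg a) (s.reg b)).map (Option.map sy)) (s.reg .ip) := by
  change (em ((fetch sy a b).eval x K s)).2.1 = _
  rw [fetch, Prog.eval_seq, Prog.eval_seq, Prog.eval_seq]
  set s1 := (Prog.copy .c .ip : RProg S M).eval x K ((Prog.set fun s _ _ =>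
    { s with sym := .rightEnd, found := false } : RProg S M).eval x K s) with hs1
  have hr : ∀ r : Reg, r = .a ∨ r = .b →
      ((emit .leftEnd : RProg S M).eval x K s1).reg r = s.reg r := by
    rintro r (rfl | rfl) <;>
    exact (Prog.eval_reg x K _ rfl _).trans ((Prog.eval_reg x K _ rfl _).trans
      (Prog.eval_reg x K _ rfl s))
  have hem : em s1 = (s.reg .ip, .rightEnd, false) := by
    simp [em, hs1, Prog.eval_copy, Prog.eval_set]
  rw [em_emitInst x K sy ha hb _ hK (by rw [hr b hb]; exact hbK), em_emit, hr a ha, hr b hb, hem]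
  cases h : s.reg .ip with
  | zero =>
    change (emits sy _ (0, _, true)).2.1 = _
    rw [emits_found]; rfl
  | succ c =>
    change (emits sy _ (c, _, false)).2.1 = _
    rw [emits_scan]
    simp only [scan, List.getElem?_map]
    cases (instWord x K (s.reg a) (s.reg b))[c]? <;> rfl

end Correctness


/-! ## Simulation of the machine for the knapsack problem -/

/-- Is this a move to the left? -/
def Dir.isLeft : Dir → Bool
  | .left => true
  | _ => false

/-- Is this a move to the right? -/
def Dir.isRight : Dir → Bool
  | .right => true
  | _ => false

/-- Execute the programs of a list. -/
def Prog.seqs {A σ R J G : Type} : List (Prog A σ R J G) → Prog A σ R J G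
  | [] => .skip
  | p :: ps => .seq p (.seqs ps)

section Program

variable {S : Type} {M : Machine (Option S) (Option IdxSym)}

/-- What `M` does on work tape `i` in its next step. -/
def Store.workAct (s : Store S M) (i : Fin M.k) : M.Γ × Dir :=
  match s.act with
  | some (_, _, w, _) => w i
  | none => (M.blank, .stay)

/-- How `M` moves its input head in its next step. -/
def Store.inMove (s : Store S M) : Dir :=
  match s.act with
  | some (_, d, _, _) => d
  | none => .stay

/-- Simulate a step of `M` on work tape `i`: the stack `(i, false)` holds the cells to the left of
the head, the stack `(i, true)` the others. -/
def tapeStep (i : Fin M.k) : RProg S M :=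
  .seq (.pop (i, true))
    (.ite (fun s _ _ => (s.workAct i).2.isRight) (.push (i, false) fun s _ => (s.workAct i).1)
      (.seq (.push (i, true) fun s _ => (s.workAct i).1)
        (.ite (fun s _ v => (s.workAct i).2.isLeft && (v (i, false)).isSome)
          (.seq (.push (i, true) fun _ v => (v (i, false)).getD M.blank) (.pop (i, false)))
          .skip)))

/-- Perform the action of `M`. -/
def perform : RProg S M :=
  -- The head must not pass the right endmarker, so a move to the right is suppressed there.
  .seq (.ite (fun s _ _ => s.inMove.isRight && !s.sym.isRightEnd) (.inc .ip) .skip)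
    (.seq (.ite (fun s _ _ => s.inMove.isLeft) (.dec .ip) .skip)
      (.seq (.seqs ((List.finRange M.k).map tapeStep))
        (.set fun s _ _ => { s with
          q := (s.act.map fun r => r.1).getD s.q
          -- Only the first symbol that `M` ever writes matters: it is `none` for ⊥ and some symbol
          -- of a solution otherwise. Later output is discarded.
          first := s.first.or (s.act.bind fun r => r.2.2.2.map Option.isSome) })))

/-- Simulate a step of `M` on the instance for `a` and `b`. -/
def simStep (sy : Bool → S) (a b : Reg) : RProg S M :=
  .seq (fetch sy a b)
    (.seq (.set fun s _ v =>
        -- An empty right stack means that the head is on a cell that has not been visited yet,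
        -- which is blank.
        { s with act := M.δ s.q s.sym fun i => (v (i, true)).getD M.blank })
      (.ite (fun s _ _ => s.act.isSome) perform .skip))

/-- Simulate `M` on the instance for `a` and `b`. -/
def simulate (sy : Bool → S) (d : ℕ) (a b : Reg) : RProg S M :=
  .seq (.set fun s _ _ => { s with q := M.start, first := none })
    (.seq (.clear .ip)
      (.seq (.seqs ((List.finRange M.k).map fun i => .seq (.wipe (i, false)) (.wipe (i, true))))
        (.repPow d (simStep sy a b))))

/-- The body of the inner loop of the search. -/
def searchBody (sy : Bool → S) (d : ℕ) : RProg S M :=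
  .seq (compare .a .b)
    (.ite (fun s _ _ => s.neg == some true)
      (.seq (simulate sy d .a .b)
        (.seq (.set fun s _ _ => { s with res := s.first == some true })
          (.seq (simulate sy d .b .a)
            (.set fun s _ _ => { s with bad := s.bad || (s.res && s.first == some true) }))))
      .skip)

/-- Search for literals `a` and `b` that are complementary such that there are paths from `a` to `b`
and from `b` to `a`. -/
def searchCycle (sy : Bool → S) (d : ℕ) : RProg S M := .each .a (.each .b (searchBody sy d))

end Program

/-! ### Work tapes as pairs of stacks. -/

section Correctness

variable {S : Type} {M : Machine (Option S) (Option IdxSym)} (x : List SatSym) (K : ℕ)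

/-- The stacks `l` and `r` represent a work tape with contents `f` and head position `h`. -/
structure TapeRep {Γ : Type} (blank : Γ) (H : ℕ) (f : ℕ → Γ) (h : ℕ) (l r : List Γ) : Prop where
  head : l.length = h
  cells : ∀ j, f j = (l.reverse ++ r).getD j blank
  bound : l.length + r.length ≤ H

theorem TapeRep.scanned {Γ : Type} {blank : Γ} {H : ℕ} {f : ℕ → Γ} {h : ℕ} {l r : List Γ}
    (t : TapeRep blank H f h l r) : r.head?.getD blank = f h := by
  rw [t.cells, List.getD_append_right _ _ _ _ (by simp [t.head])]
  cases r <;> simp [t.head]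

/-- Writing increases the number of stored cells only if the right stack is empty. Then `h + 1`
cells are stored afterwards, and these are the cells up to the head. -/
theorem TapeRep.update {Γ : Type} {blank : Γ} {H : ℕ} {f : ℕ → Γ} {h : ℕ} {l r : List Γ}
    (t : TapeRep blank H f h l r) (hH : h + 1 ≤ H) (g : Γ) :
    (∀ j, Function.update f h g j = (l.reverse ++ g :: r.tail).getD j blank) ∧
      l.length + (r.tail.length + 1) ≤ H := by
  constructor
  · intro j
    have hl : l.reverse.length = h := by simp [t.head]
    rcases lt_trichotomy j h with hj | rfl | hj
    · rw [Function.update_of_ne hj.ne, t.cells, List.getD_append _ _ _ _ (by omega),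
        List.getD_append _ _ _ _ (by omega)]
    · rw [Function.update_self, List.getD_append_right _ _ _ _ (by omega)]
      simp [hl]
    · rw [Function.update_of_ne hj.ne', t.cells, List.getD_append_right _ _ _ _ (by omega),
        List.getD_append_right _ _ _ _ (by omega)]
      obtain ⟨k, rfl⟩ := Nat.exists_eq_add_of_lt hj
      rw [hl, show h + k + 1 - h = k + 1 by omega]
      cases r <;> simp
  · have h1 := t.bound
    have h2 := t.head
    cases r with
    | nil => simp; omega
    | cons a r => simpa using h1

/-- The two stacks together hold at most `H` cells after the step, and the pushes in between stay
within `H` too, so the space of `M` bounds `hw`. -/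
theorem tapeStep_spec (i : Fin M.k) (s : RState S M) {H : ℕ} {f : ℕ → M.Γ} {h : ℕ}
    (t : TapeRep M.blank H f h (s.stk (i, false)) (s.stk (i, true))) (hH : h + 1 ≤ H)
    (hhw : s.hw ≤ H) :
    TapeRep M.blank H (Function.update f h (s.st.workAct i).1) ((s.st.workAct i).2.apply h)
      (((tapeStep i).eval x K s).stk (i, false)) (((tapeStep i).eval x K s).stk (i, true)) ∧
    (∀ j c, j ≠ i → ((tapeStep i).eval x K s).stk (j, c) = s.stk (j, c)) ∧
    ((tapeStep i).eval x K s).hw ≤ H ∧ ((tapeStep i).eval x K s).st = s.st ∧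
    ((tapeStep i).eval x K s).reg = s.reg := by
  obtain ⟨h1, h2⟩ := t.update hH (s.st.workAct i).1
  have h3 := t.head
  rw [List.length_tail] at h2
  obtain hd | hd | hd : (s.st.workAct i).2 = .right ∨ (s.st.workAct i).2 = .stay ∨
      (s.st.workAct i).2 = .left := by
    cases (s.st.workAct i).2 <;> simp
  · simp only [tapeStep, Prog.eval, hd, Dir.isRight, if_true, Dir.apply]
    refine ⟨⟨?_, ?_, ?_⟩, ?_, ?_, by trivial⟩
    · simp [h3]
    · intro j
      rw [h1]; simp
    · simp; omega
    · intro j c hj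
      simp [hj]
    · simp only [ne_eq, Prod.mk.injEq, Bool.false_eq_true, and_false, not_false_eq_true,
        Function.update_of_ne, max_le_iff]
      exact ⟨hhw, by omega⟩
  · simp only [tapeStep, Prog.eval, hd, Dir.isRight, Bool.false_eq_true, if_false, Dir.apply, Dir.isLeft, Bool.false_and,
      Prog.skip, Prog.eval]
    refine ⟨⟨?_, ?_, ?_⟩, ?_, ?_, by trivial⟩
    · simp [h3]
    · intro j
      rw [h1]; simp
    · simpa using h2
    · intro j c hj
      simp [hj]
    · simp; omega
  · cases hl : s.stk (i, false) with
    | nil =>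
      rw [hl] at h1 h2 h3
      simp only [tapeStep, Prog.eval, hd, Dir.isRight, Bool.false_eq_true, if_false, Dir.apply,
        Dir.isLeft, State.tops, hl, Prog.skip, Prog.eval, ne_eq, Prod.mk.injEq, and_false,
        not_false_eq_true, Function.update_of_ne, List.head?_nil, Option.isSome_none, Bool.and_false,
        Bool.false_eq_true]
      refine ⟨⟨?_, ?_, ?_⟩, ?_, ?_, by trivial⟩
      · simp at h3; simp; omega
      · intro j
        rw [h1]; simp
      · simpa using h2
      · intro j c hj
        simp [hj]
      · simp at h2; simp; omega
    | cons a l =>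
      rw [hl] at h1 h2 h3
      simp only [tapeStep, Prog.eval, hd, Dir.isRight, Bool.false_eq_true, if_false, Dir.apply,
        Dir.isLeft, State.tops, hl, Prog.skip, Prog.eval, ne_eq, Prod.mk.injEq, and_false, not_false_eq_true,
        Function.update_of_ne, List.head?_cons, Option.isSome_some, Bool.and_true,
        if_true, Option.getD_some, Function.update_self, List.tail_cons]
      simp only [List.length_cons] at h2 h3
      refine ⟨⟨?_, ?_, ?_⟩, ?_, ?_, by trivial⟩
      · omega
      · intro j
        rw [h1]; simp
      · simp; omega
      · intro j c hj
        simp [hj]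
      · simp; omega

theorem tapeSteps_spec (L : List (Fin M.k)) (hL : L.Nodup) (s : RState S M) {H : ℕ}
    {f : Fin M.k → ℕ → M.Γ} {h : Fin M.k → ℕ}
    (t : ∀ i ∈ L, TapeRep M.blank H (f i) (h i) (s.stk (i, false)) (s.stk (i, true)))
    (hH : ∀ i ∈ L, h i + 1 ≤ H) (hhw : s.hw ≤ H) :
    (∀ i ∈ L, TapeRep M.blank H (Function.update (f i) (h i) (s.st.workAct i).1)
      ((s.st.workAct i).2.apply (h i))
      (((Prog.seqs (L.map tapeStep)).eval x K s).stk (i, false))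
      (((Prog.seqs (L.map tapeStep)).eval x K s).stk (i, true))) ∧
    (∀ i c, i ∉ L → ((Prog.seqs (L.map tapeStep)).eval x K s).stk (i, c) = s.stk (i, c)) ∧
    ((Prog.seqs (L.map tapeStep)).eval x K s).hw ≤ H ∧
    ((Prog.seqs (L.map tapeStep)).eval x K s).st = s.st ∧
    ((Prog.seqs (L.map tapeStep)).eval x K s).reg = s.reg := by
  induction L generalizing s with
  | nil => exact ⟨by simp, fun _ _ _ => rfl, hhw, rfl, rfl⟩
  | cons i L ih =>
    simp only [List.nodup_cons] at hL
    obtain ⟨h1, h2, h3, h4, h5⟩ := tapeStep_spec x K i s (t i (by simp)) (hH i (by simp)) hhw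
    simp only [List.map_cons, Prog.seqs, Prog.eval_seq]
    set s1 := (tapeStep i).eval x K s with hs1
    have hne : ∀ j ∈ L, j ≠ i := fun j hj e => hL.1 (e ▸ hj)
    obtain ⟨g1, g2, g3, g4, g5⟩ := ih hL.2 s1
      (fun j hj => by
        rw [h2 j _ (hne j hj), h2 j _ (hne j hj)]
        exact t j (List.mem_cons_of_mem _ hj))
      (fun j hj => hH j (List.mem_cons_of_mem _ hj)) h3
    refine ⟨?_, ?_, g3, g4.trans h4, g5.trans h5⟩
    · intro j hj
      rcases List.mem_cons.1 hj with rfl | hj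
      · rw [g2 _ _ hL.1, g2 _ _ hL.1]
        exact h1
      · simpa only [h4] using g1 j hj
    · intro j c hj
      simp only [List.mem_cons, not_or] at hj
      rw [g2 j c hj.2, h2 j c hj.1]

end Correctness


/-! ### Simulation of runs -/

theorem Prog.keepsReg_seqs {A σ R J G : Type} [DecidableEq R] (r : R) (L : List (Prog A σ R J G))
    (h : ∀ p ∈ L, p.keepsReg r = true) : (Prog.seqs L).keepsReg r = true := by
  induction L with
  | nil => rfl
  | cons p L ih =>
    simp only [Prog.seqs, Prog.keepsReg, Bool.and_eq_true]
    exact ⟨h p (by simp), ih fun q hq => h q (by simp [hq])⟩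

theorem Prog.keepsSt_seqs {A σ R J G α : Type} (π : σ → α) (L : List (Prog A σ R J G))
    (h : ∀ p ∈ L, p.KeepsSt π) : (Prog.seqs L).KeepsSt π := by
  induction L with
  | nil => exact fun _ _ _ => rfl
  | cons p L ih => exact ⟨h p (by simp), ih fun q hq => h q (by simp [hq])⟩

theorem Prog.keepsReg_repPow {A σ R J G : Type} [DecidableEq R] (r : R) (p : Prog A σ R J G)
    (h : p.keepsReg r = true) (d : ℕ) : (p.repPow d).keepsReg r = true := by
  induction d with
  | zero => exact h
  | succ d ih => exact ih

theorem Prog.keepsSt_repPow {A σ R J G α : Type} (π : σ → α) (p : Prog A σ R J G)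
    (h : p.KeepsSt π) (d : ℕ) : (p.repPow d).KeepsSt π := by
  induction d with
  | zero => exact h
  | succ d ih => exact ih

section Correctness

variable {S : Type} {M : Machine (Option S) (Option IdxSym)} (x : List SatSym) (K : ℕ)

/-- The state `s` represents the configuration `c` of the simulated machine. -/
structure SimRep (H : ℕ) (s : RState S M) (c : M.Config) : Prop where
  q : s.st.q = c.state
  ip : s.reg .ip = c.inPos
  first : s.st.first = c.out.head?.map Option.isSome
  tape : ∀ i, TapeRep M.blank H (c.work i) (c.workPos i) (s.stk (i, false)) (s.stk (i, true))
  hw : s.hw ≤ H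

theorem fetch_keepsSt (sy : Bool → S) (a b : Reg) : (fetch sy a b : RProg S M).KeepsSt
    fun s => (s.q, s.first, s.res, s.bad) := by
  simp [fetch, emit, emitInst, eachSign, Prog.each, Prog.skip, addTo, emitBlocks, emitBlk,
    Prog.KeepsSt, emitLayer, emitEdge, emitClauses, emitIf, compare, Prog.repPow]

theorem tapeSteps_keepsReg (r : Reg) :
    (Prog.seqs ((List.finRange M.k).map tapeStep) : RProg S M).keepsReg r = true :=
  Prog.keepsReg_seqs _ _ fun p hp => by
    obtain ⟨i, _, rfl⟩ := List.mem_map.1 hp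
    rfl

theorem tapeSteps_keepsSt {α : Type} (π : Store S M → α) :
    (Prog.seqs ((List.finRange M.k).map tapeStep) : RProg S M).KeepsSt π :=
  Prog.keepsSt_seqs _ _ fun p hp => by
    obtain ⟨i, _, rfl⟩ := List.mem_map.1 hp
    simp [tapeStep, Prog.KeepsSt, Prog.skip]

theorem simStep_keepsReg (sy : Bool → S) (a b : Reg) {r : Reg} (hr : r = .a ∨ r = .b) :
    (simStep sy a b : RProg S M).keepsReg r = true := by
  have h := tapeSteps_keepsReg (M := M) r
  have h2 : (fetch sy a b : RProg S M).keepsReg r = true := by rcases hr with rfl | rfl <;> rfl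
  rcases hr with rfl | rfl <;>
  · simp only [simStep, perform, Prog.keepsReg, h2, h]
    rfl

theorem simStep_keepsSt (sy : Bool → S) (a b : Reg) :
    (simStep sy a b : RProg S M).KeepsSt fun s => (s.res, s.bad) := by
  refine ⟨?_, ?_, ⟨?_, ?_, ?_, ?_⟩, ?_⟩
  · simp [fetch, emit, emitInst, eachSign, Prog.each, Prog.skip, addTo, emitBlocks, emitBlk,
      Prog.KeepsSt, emitLayer, emitEdge, emitClauses, emitIf, compare, Prog.repPow]
  · exact fun _ _ _ => rfl
  · exact ⟨trivial, fun _ _ _ => rfl⟩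
  · exact ⟨trivial, fun _ _ _ => rfl⟩
  · exact tapeSteps_keepsSt _
  · exact fun _ _ _ => rfl
  · exact fun _ _ _ => rfl

theorem perform_spec {H : ℕ} {V : List (Option S)} {s : RState S M} {c : M.Config}
    (r : SimRep H s c) (hc : ∀ i, c.workPos i + 1 ≤ H) (hin : c.inPos ≤ V.length + 1)
    (hsym : s.st.sym = scan V c.inPos) (hact : s.st.act = M.next V c) (hs : s.st.act.isSome = true) :
    SimRep H (perform.eval x K s) (M.step V c) := by
  obtain ⟨⟨q, d, w, o⟩, hq⟩ := Option.isSome_iff_exists.1 hs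
  have hstep : M.step V c =
    { state := q
      inPos := min (d.apply c.inPos) (V.length + 1)
      work := fun i => Function.update (c.work i) (c.workPos i) (w i).1
      workPos := fun i => (w i).2.apply (c.workPos i)
      out := c.out ++ o.toList } := by
    rw [Machine.step, ← hact, hq]
  rw [hstep, perform, Prog.eval_seq, Prog.eval_seq, Prog.eval_seq]
  set s1 := (Prog.ite (fun s _ _ => s.inMove.isRight && !s.sym.isRightEnd) (.inc .ip) .skip :
    RProg S M).eval x K s with hs1
  set s2 := (Prog.ite (fun s _ _ => s.inMove.isLeft) (.dec .ip) .skip : RProg S M).eval x K s1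
    with hs2
  have hst1 : s1.st = s.st ∧ s1.stk = s.stk ∧ s1.hw = s.hw := by
    rw [hs1, Prog.eval_ite]; split_ifs <;> exact ⟨rfl, rfl, rfl⟩
  have hst2 : s2.st = s.st ∧ s2.stk = s.stk ∧ s2.hw = s.hw := by
    rw [hs2, Prog.eval_ite, ← hst1.1, ← hst1.2.1, ← hst1.2.2]; split_ifs <;> exact ⟨rfl, rfl, rfl⟩
  have hip : s2.reg .ip = min (d.apply c.inPos) (V.length + 1) := by
    have hm : s.st.inMove = d := by rw [Store.inMove, hq]
    rw [hs2, Prog.eval_ite, hst1.1, hs1, Prog.eval_ite, hm, hsym]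
    -- The suppressed move at the right endmarker corresponds to the minimum in `Machine.step`.
    have hre : (scan V c.inPos).isRightEnd = true ↔ c.inPos = V.length + 1 := by
      rw [isRightEnd_scan, decide_eq_true_eq]; omega
    cases d with
    | left =>
      simp [Dir.isRight, Dir.isLeft, Dir.apply, Prog.eval, Prog.skip, r.ip]
      omega
    | stay =>
      simp [Dir.isRight, Dir.isLeft, Dir.apply, Prog.eval, Prog.skip, r.ip, hin]
    | right =>
      by_cases hre' : (scan V c.inPos).isRightEnd = true
      · have := hre.1 hre'
        simp [Dir.isRight, Dir.isLeft, Dir.apply, Prog.eval, Prog.skip, r.ip, hre']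
        omega
      · have : c.inPos ≠ V.length + 1 := fun h => hre' (hre.2 h)
        simp only [Bool.not_eq_true] at hre'
        simp [Dir.isRight, Dir.isLeft, Dir.apply, Prog.eval, Prog.skip, r.ip, hre']
        omega
  obtain ⟨h1, -, h3, h4, h5⟩ := tapeSteps_spec x K (List.finRange M.k) (List.nodup_finRange _) s2
    (H := H) (f := c.work) (h := c.workPos)
    (fun i _ => by rw [hst2.2.1]; exact r.tape i) (fun i _ => hc i) (by rw [hst2.2.2]; exact r.hw)
  have hw : ∀ i, s2.st.workAct i = w i := fun i => by rw [hst2.1, Store.workAct, hq]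
  refine ⟨?_, ?_, ?_, ?_, h3⟩
  · simp only [Prog.eval_set, h4, hst2.1, hq]; rfl
  · simp only [Prog.eval_set, h5, hip]
  · simp only [Prog.eval_set, h4, hst2.1, hq, r.first]
    cases c.out <;> cases o <;> rfl
  · intro i
    have := h1 i (List.mem_finRange i)
    rw [hw] at this
    exact this

theorem simStep_spec (sy : Bool → S) {a b : Reg} (ha : a = .a ∨ a = .b) (hb : b = .a ∨ b = .b)
    {H : ℕ} {s : RState S M} {c : M.Config} (hK : 2 ≤ K) (hbK : s.reg b ≤ K)
    (r : SimRep H s c) (hc : ∀ i, c.workPos i + 1 ≤ H)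
    (hin : c.inPos ≤ ((instWord x K (s.reg a) (s.reg b)).map (Option.map sy)).length + 1) :
    SimRep H ((simStep sy a b).eval x K s)
      (M.step ((instWord x K (s.reg a) (s.reg b)).map (Option.map sy)) c) := by
  have hsym := sym_fetch x K sy ha hb s hK hbK
  set V := (instWord x K (s.reg a) (s.reg b)).map (Option.map sy) with hV
  rw [simStep, Prog.eval_seq, Prog.eval_seq]
  set s1 := (fetch sy a b).eval x K s with hs1
  have hst := Prog.eval_st x K _ (fetch_keepsSt (M := M) sy a b) s
  have hstk := Prog.eval_stk x K (fetch sy a b : RProg S M) rfl s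
  have hip : s1.reg .ip = s.reg .ip := Prog.eval_reg x K _ rfl s
  simp only [← hs1, Prod.mk.injEq] at hst hstk
  set s2 := (Prog.set (fun s _ v => { s with act := M.δ s.q s.sym fun i => (v (i, true)).getD M.blank }) :
    RProg S M).eval x K s1 with hs2
  have hr2 : SimRep H s2 c := by
    refine ⟨hst.1.trans r.q, hip.trans r.ip, hst.2.1.trans r.first, fun i => ?_, ?_⟩
    · change TapeRep _ _ _ _ (s1.stk _) (s1.stk _)
      rw [hstk.1]
      exact r.tape i
    · exact hstk.2.le.trans r.hw
  have hact : s2.st.act = M.next V c := by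
    have : ∀ i, (s1.tops (i, true)).getD M.blank = c.work i (c.workPos i) := fun i => by
      rw [State.tops, hstk.1]
      exact (r.tape i).scanned
    simp only [hs2, Prog.eval_set, this, hst.1, hsym, r.q, r.ip]
    rfl
  rw [Prog.eval_ite]
  split_ifs with h
  · exact perform_spec x K hr2 hc hin (hsym.trans (by rw [r.ip])) hact h
  · rw [hact] at h
    simp only [Option.isSome_iff_ne_none, ne_eq, not_not] at h
    rw [Machine.step, h]
    exact hr2

theorem inPos_le (V : List (Option S)) (t : ℕ) : (M.run V t).inPos ≤ V.length + 1 := by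
  cases t with
  | zero => exact Nat.zero_le _
  | succ t =>
    induction t with
    | zero =>
      simp only [Machine.run, Function.iterate_succ_apply', Machine.step, Function.iterate_zero,
        id_eq]
      split
      · exact Nat.zero_le _
      · exact min_le_right _ _
    | succ t ih =>
      rw [Machine.run, Function.iterate_succ_apply', Machine.step]
      split
      · exact ih
      · exact min_le_right _ _

theorem wipes_spec (L : List (Fin M.k)) (s : RState S M) :
    (∀ i ∈ L, ∀ c, ((Prog.seqs (L.map fun i => Prog.seq (.wipe (i, false)) (.wipe (i, true))) :
      RProg S M).eval x K s).stk (i, c) = []) ∧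
    (∀ i c, s.stk (i, c) = [] → ((Prog.seqs (L.map fun i => Prog.seq (.wipe (i, false))
      (.wipe (i, true))) : RProg S M).eval x K s).stk (i, c) = []) ∧
    ((Prog.seqs (L.map fun i => Prog.seq (.wipe (i, false)) (.wipe (i, true))) :
      RProg S M).eval x K s).st = s.st ∧
    ((Prog.seqs (L.map fun i => Prog.seq (.wipe (i, false)) (.wipe (i, true))) :
      RProg S M).eval x K s).reg = s.reg ∧
    ((Prog.seqs (L.map fun i => Prog.seq (.wipe (i, false)) (.wipe (i, true))) :
      RProg S M).eval x K s).hw = s.hw := by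
  induction L generalizing s with
  | nil => exact ⟨by simp, fun _ _ h => h, rfl, rfl, rfl⟩
  | cons i L ih =>
    simp only [List.map_cons, Prog.seqs, Prog.eval_seq]
    set s1 := (Prog.wipe (i, true)).eval x K ((Prog.wipe (i, false)).eval x K s) with hs1
    have hi : ∀ c, s1.stk (i, c) = [] := fun c => by
      cases c <;> simp [hs1, Prog.eval]
    have ho : ∀ j c, s.stk (j, c) = [] → s1.stk (j, c) = [] := fun j c h => by
      by_cases hj : j = i
      · subst hj; exact hi c
      · simp [hs1, Prog.eval, hj, h]
    obtain ⟨h1, h2, h3, h4, h5⟩ := ih s1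
    refine ⟨?_, fun j c h => h2 j c (ho j c h), h3, h4, h5⟩
    intro j hj c
    rcases List.mem_cons.1 hj with rfl | hj
    · exact h2 _ _ (hi c)
    · exact h1 j hj c

theorem simulate_keepsReg (sy : Bool → S) (d : ℕ) (a b : Reg) {r : Reg} (hr : r = .a ∨ r = .b) :
    (simulate sy d a b : RProg S M).keepsReg r = true := by
  have h := Prog.keepsReg_repPow r _ (simStep_keepsReg (M := M) sy a b hr) d
  have h2 : (Prog.seqs ((List.finRange M.k).map fun i =>
      Prog.seq (.wipe (i, false)) (.wipe (i, true))) : RProg S M).keepsReg r = true :=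
    Prog.keepsReg_seqs _ _ fun p hp => by
      obtain ⟨i, _, rfl⟩ := List.mem_map.1 hp
      rfl
  rcases hr with rfl | rfl <;>
  · simp only [simulate, Prog.keepsReg, h2, h]
    rfl

theorem simulate_keepsSt (sy : Bool → S) (d : ℕ) (a b : Reg) :
    (simulate sy d a b : RProg S M).KeepsSt fun s => (s.res, s.bad) := by
  refine ⟨fun _ _ _ => rfl, trivial, Prog.keepsSt_seqs _ _ fun p hp => ?_,
    Prog.keepsSt_repPow _ _ (simStep_keepsSt sy a b) d⟩
  obtain ⟨i, _, rfl⟩ := List.mem_map.1 hp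
  exact ⟨trivial, trivial⟩

theorem simulate_spec (sy : Bool → S) (d : ℕ) {a b : Reg} (ha : a = .a ∨ a = .b)
    (hb : b = .a ∨ b = .b) {H : ℕ} {s : RState S M} (hK : 2 ≤ K) (hbK : s.reg b ≤ K)
    (hc : ∀ t i, (M.run ((instWord x K (s.reg a) (s.reg b)).map (Option.map sy)) t).workPos i + 1
      ≤ H) (hw : s.hw ≤ H) :
    SimRep H ((simulate sy d a b).eval x K s)
      (M.run ((instWord x K (s.reg a) (s.reg b)).map (Option.map sy)) (K ^ d)) := by
  set V := (instWord x K (s.reg a) (s.reg b)).map (Option.map sy) with hV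
  rw [simulate, Prog.eval_seq, Prog.eval_seq, Prog.eval_seq, Prog.eval_repPow]
  set s1 := (Prog.clear .ip).eval x K ((Prog.set fun s _ _ =>
    { s with q := M.start, first := none } : RProg S M).eval x K s) with hs1
  obtain ⟨h1, -, h3, h4, h5⟩ := wipes_spec (M := M) x K (List.finRange M.k) s1
  set s2 := (Prog.seqs ((List.finRange M.k).map fun i =>
    Prog.seq (.wipe (i, false)) (.wipe (i, true))) : RProg S M).eval x K s1 with hs2
  have hr : ∀ r : Reg, r = .a ∨ r = .b → s2.reg r = s.reg r := by
    intro r hr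
    rw [h4]
    rcases hr with rfl | rfl <;> rfl
  refine (iterate_induction (f := (simStep sy a b).eval x K) (fun t (s' : RState S M) =>
    (s'.reg a = s.reg a ∧ s'.reg b = s.reg b) ∧ SimRep H s' (M.run V t)) (K ^ d)
    ⟨⟨hr a ha, hr b hb⟩, ⟨?_, ?_, ?_, fun i => ⟨?_, fun j => ?_, ?_⟩, ?_⟩⟩ ?_).2
  · rw [h3]; rfl
  · rw [h4]; simp [hs1, Prog.eval_clear]; rfl
  · rw [h3]; rfl
  · rw [h1 i (List.mem_finRange i)]; rfl
  · rw [h1 i (List.mem_finRange i), h1 i (List.mem_finRange i)]; rfl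
  · rw [h1 i (List.mem_finRange i), h1 i (List.mem_finRange i)]; exact Nat.zero_le _
  · rw [h5]; exact hw
  · rintro t s' - ⟨⟨g1, g2⟩, g3⟩
    refine ⟨⟨?_, ?_⟩, ?_⟩
    · rw [Prog.eval_reg x K _ (simStep_keepsReg sy a b ha), g1]
    · rw [Prog.eval_reg x K _ (simStep_keepsReg sy a b hb), g2]
    · rw [Machine.run, Function.iterate_succ_apply']
      have := simStep_spec x K sy ha hb hK (g2.le.trans hbK) g3 (hc t)
      rw [g1, g2] at this
      exact this (inPos_le V t)

/-- The first symbol that the simulated machine writes on the instance for `i` and `j` belongs to a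
solution. -/
def solves (M : Machine (Option S) (Option IdxSym)) (sy : Bool → S) (d i j : ℕ) : Bool :=
  ((M.run ((instWord x K i j).map (Option.map sy)) (K ^ d)).out.head?.map Option.isSome) ==
    some true

/-- There are complementary literals in the cells `i` and `j` with paths in both directions. -/
def cyclic (M : Machine (Option S) (Option IdxSym)) (sy : Bool → S) (d i j : ℕ) : Bool :=
  negAt x K i j && (solves x K M sy d i j && solves x K M sy d j i)

theorem searchBody_keepsReg (sy : Bool → S) (d : ℕ) {r : Reg} (hr : r = .a ∨ r = .b) :
    (searchBody sy d : RProg S M).keepsReg r = true := by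
  have h := simulate_keepsReg (M := M) sy d .a .b hr
  have h' := simulate_keepsReg (M := M) sy d .b .a hr
  rcases hr with rfl | rfl <;>
  · simp only [searchBody, Prog.keepsReg, h, h']
    rfl

/-- Resource bounds for `M` are available only on legitimate instances, that is, for cells with
literals. So `hc` is conditional on `negAt`, and the program compares the two cells before it
simulates. -/
theorem searchBody_spec (sy : Bool → S) (d : ℕ) {H : ℕ} {s : RState S M} (hK : 2 ≤ K) {i j : ℕ}
    (hi : s.reg .a = i) (hj : s.reg .b = j) (hiK : i ≤ K) (hjK : j ≤ K)
    (hc : negAt x K i j = true → ∀ t l,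
      (M.run ((instWord x K i j).map (Option.map sy)) t).workPos l + 1 ≤ H ∧
      (M.run ((instWord x K j i).map (Option.map sy)) t).workPos l + 1 ≤ H) (hw : s.hw ≤ H) :
    ((searchBody sy d).eval x K s).st.bad = (s.st.bad || cyclic x K M sy d i j) ∧
      ((searchBody sy d).eval x K s).hw ≤ H := by
  rw [searchBody, Prog.eval_seq]
  set s1 := (compare .a .b).eval x K s with hs1
  have hneg : s1.st.neg = scanNeg x i j K := by
    rw [hs1, neg_compare x K (by simp), hi, hj]
  have hbad : s1.st.bad = s.st.bad :=
    Prog.eval_st x K (π := Store.bad) _ (by simp [compare, Prog.KeepsSt]) s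
  have hhw : s1.hw = s.hw := (Prog.eval_stk x K (compare .a .b : RProg S M) rfl s).2
  have ha : s1.reg .a = i := (Prog.eval_reg x K _ rfl s).trans hi
  have hb : s1.reg .b = j := (Prog.eval_reg x K _ rfl s).trans hj
  rw [Prog.eval_ite, hneg]
  by_cases hn : negAt x K i j = true
  · have hn' : scanNeg x i j K = some true := by simpa [negAt] using hn
    simp only [hn', beq_self_eq_true, if_true]
    rw [Prog.eval_seq, Prog.eval_seq, Prog.eval_seq]
    have r1 := simulate_spec x K sy d (a := .a) (b := .b) (by simp) (by simp) (s := s1) (H := H) hK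
      (by omega) (by rw [ha, hb]; exact fun t l => (hc hn t l).1) (by omega)
    rw [ha, hb] at r1
    have k1 := Prog.eval_st x K _ (simulate_keepsSt (M := M) sy d .a .b) s1
    have a1 := Prog.eval_reg x K _ (simulate_keepsReg (M := M) sy d .a .b (r := .a) (by simp)) s1
    have b1 := Prog.eval_reg x K _ (simulate_keepsReg (M := M) sy d .a .b (r := .b) (by simp)) s1
    set s2 := (simulate sy d .a .b).eval x K s1 with hs2
    rw [ha] at a1
    rw [hb] at b1
    set s3 := (Prog.set fun s _ _ => { s with res := s.first == some true } : RProg S M).eval x K s2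
      with hs3
    have a3 : s3.reg .a = i := a1
    have b3 : s3.reg .b = j := b1
    have r3 := simulate_spec x K sy d (a := .b) (b := .a) (by simp) (by simp) (s := s3) (H := H) hK
      (by omega) (by rw [a3, b3]; exact fun t l => (hc hn t l).2) r1.hw
    have k3 := Prog.eval_st x K _ (simulate_keepsSt (M := M) sy d .b .a) s3
    rw [a3, b3] at r3
    refine ⟨?_, r3.hw⟩
    simp only [Prod.mk.injEq] at k1 k3
    simp only [Prog.eval_set, k3, r3.first]
    simp only [hs3, Prog.eval_set, k1, r1.first, hbad, cyclic, hn, Bool.true_and]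
    rfl
  · have hn' : scanNeg x i j K ≠ some true := by simpa [negAt] using hn
    simp only [Bool.not_eq_true] at hn
    have : (scanNeg x i j K == some true) = false := by simpa using hn'
    simp only [this, Bool.false_eq_true, if_false, cyclic, hn, Bool.false_and, Bool.or_false]
    exact ⟨hbad, hhw.le.trans hw⟩

theorem searchCycle_spec (sy : Bool → S) (d : ℕ) {H : ℕ} {s : RState S M} (hK : 2 ≤ K)
    (hbad : s.st.bad = false) (hw : s.hw ≤ H)
    (hc : ∀ i j, negAt x K i j = true → ∀ t l,
      (M.run ((instWord x K i j).map (Option.map sy)) t).workPos l + 1 ≤ H ∧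
      (M.run ((instWord x K j i).map (Option.map sy)) t).workPos l + 1 ≤ H) :
    (((searchCycle sy d).eval x K s).st.bad = true ↔
      ∃ i < K, ∃ j < K, cyclic x K M sy d (i + 1) (j + 1) = true) ∧
      ((searchCycle sy d).eval x K s).hw ≤ H := by
  have hbody : (Prog.each .b (searchBody sy d) : RProg S M).keepsReg .a = true := by
    simp [Prog.each, Prog.keepsReg, searchBody_keepsReg]
  have := Prog.each_induction x K .a (.each .b (searchBody sy d)) (fun i (s' : RState S M) =>
    (s'.st.bad = true ↔ ∃ i' < i, ∃ j < K, cyclic x K M sy d (i' + 1) (j + 1) = true) ∧ s'.hw ≤ H)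
    hbody (s := s) (fun _ _ _ h => h) ⟨by simp [hbad], hw⟩ ?_
  · exact this
  · rintro i s' hi hr ⟨h1, h2⟩
    have := Prog.each_induction x K .b (searchBody sy d) (fun j (s'' : RState S M) =>
      s''.reg .a = i + 1 ∧ (s''.st.bad = true ↔ s'.st.bad = true ∨
        ∃ j' < j, cyclic x K M sy d (i + 1) (j' + 1) = true) ∧ s''.hw ≤ H)
      (searchBody_keepsReg sy d (by simp)) (s := s')
      (fun _ s'' _ h => ⟨by simpa using h.1, h.2⟩) ⟨hr, by simp, h2⟩ ?_
    · refine ⟨?_, this.2.2⟩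
      rw [this.2.1, h1]
      simp only [Nat.lt_succ_iff_lt_or_eq, or_and_right, exists_or, exists_eq_left]
    · rintro j s'' hj hr' ⟨h3, h4, h5⟩
      obtain ⟨g1, g2⟩ := searchBody_spec x K sy d hK h3 hr' (by omega) (by omega) (hc _ _) h5
      refine ⟨?_, ?_, g2⟩
      · rw [Prog.eval_reg x K _ (searchBody_keepsReg sy d (by simp)), h3]
      · rw [g1, Bool.or_eq_true, h4]
        simp only [Nat.lt_succ_iff_lt_or_eq, or_and_right, exists_or, exists_eq_left, or_assoc]

end Correctness


/-! ## The literals in the encoding of a formula -/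

section Word

variable (x : List SatSym) (K : ℕ)

/-- Is this a bit? -/
def SatSym.isBit : SatSym → Bool
  | .bit _ => true
  | _ => false

/-- The cell `p` holds the sign of the literal `l`. -/
def HoldsLit (p : ℕ) (l : Literal) : Prop :=
  scan x p = .sym (.sign l.2) ∧ (x.drop p).takeWhile SatSym.isBit = l.1.bits.map .bit

variable {x K}

theorem bits_injective : Function.Injective Nat.bits := fun m n h =>
  Nat.eq_of_testBit_eq fun i => by rw [Nat.testBit_eq_inth, Nat.testBit_eq_inth, h]

theorem bit_injective : Function.Injective SatSym.bit := fun a b h => by simpa using h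

theorem HoldsLit.unique {p : ℕ} {l l' : Literal} (h : HoldsLit x p l) (h' : HoldsLit x p l') :
    l = l' := by
  have h1 := h.1.symm.trans h'.1
  have h2 := h.2.symm.trans h'.2
  simp only [InCell.sym.injEq, SatSym.sign.injEq] at h1
  exact Prod.ext (bits_injective (List.map_injective_iff.2 bit_injective h2)) h1

theorem HoldsLit.isSign {p : ℕ} {l : Literal} (h : HoldsLit x p l) : (scan x p).isSign = true := by
  rw [h.1]; rfl

theorem bit?_scan_succ (n : ℕ) : (scan x (n + 1)).bit? = x[n]?.bind fun s => (InCell.sym s).bit? := by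
  simp only [scan]
  cases x[n]? <;> rfl

/-- In the case that `k` is the length of the name, both sides are `none`: the cell after the name
holds no bit. The comparison of names recognizes the end in this way. -/
theorem HoldsLit.bit? {p : ℕ} {l : Literal} (h : HoldsLit x p l) {k : ℕ} (hk : k ≤ l.1.bits.length) :
    (scan x (p + (k + 1))).bit? = l.1.bits[k]? := by
  have hd := List.takeWhile_append_dropWhile (p := SatSym.isBit) (l := x.drop p)
  rw [h.2] at hd
  rw [← add_assoc, bit?_scan_succ, ← List.getElem?_drop, ← hd]
  rcases hk.lt_or_eq with hk | rfl
  · rw [List.getElem?_append_left (by simpa using hk)]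
    simp only [List.getElem?_map, List.getElem?_eq_getElem hk]
    rfl
  · rw [List.getElem?_append_right (by simp)]
    simp only [List.length_map, Nat.sub_self, List.getElem?_eq_none le_rfl]
    have := List.head?_dropWhile_not SatSym.isBit (x.drop p)
    rw [← List.head?_eq_getElem?]
    cases hh : (List.dropWhile SatSym.isBit (x.drop p)).head? with
    | none => rfl
    | some s =>
      rw [hh] at this
      cases s <;> simp_all [SatSym.isBit, InCell.bit?]

theorem HoldsLit.lt {p : ℕ} {l : Literal} (h : HoldsLit x p l) :
    l.1.bits.length < x.length := by
  have h1 := congrArg List.length h.2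
  rw [List.length_map] at h1
  have h2 := (List.takeWhile_prefix (p := SatSym.isBit) (l := x.drop p)).length_le
  have h3 := h.1
  cases p with
  | zero => simp [scan] at h3
  | succ p =>
    by_cases hp : p < x.length
    · rw [List.length_drop] at h2
      omega
    · simp [scan, not_lt.1 hp] at h3

theorem scanNeg_of_start {p q : ℕ} (h : startNeg (scan x p) (scan x q) = some false) (k : ℕ) :
    scanNeg x p q k = some false := by
  induction k with
  | zero => exact h
  | succ k ih => rw [scanNeg, ih]

/-- The comparison is undecided as long as the names agree and neither has ended. A name is shorter
than the input, so `K` rounds lead to a decision. -/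
theorem HoldsLit.negAt_iff {p q : ℕ} {l m : Literal} (h : HoldsLit x p l) (h' : HoldsLit x q m)
    (hK : x.length < K) : negAt x K p q = true ↔ m = (l.1, !l.2) := by
  rw [negAt, decide_eq_true_eq]
  by_cases hs : l.2 = m.2
  · rw [scanNeg_of_start (by rw [h.1, h'.1]; simp [startNeg, hs])]
    refine ⟨fun h => by simp at h, ?_⟩
    rintro rfl
    simp at hs
  have key : ∀ k, (scanNeg x p q k = none ∧ l.1.bits.take k = m.1.bits.take k ∧
      k ≤ l.1.bits.length ∧ k ≤ m.1.bits.length) ∨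
      (scanNeg x p q k = some true ∧ l.1.bits = m.1.bits) ∨
      (scanNeg x p q k = some false ∧ l.1.bits ≠ m.1.bits) := by
    intro k
    induction k with
    | zero => exact .inl ⟨by rw [scanNeg, h.1, h'.1]; simp [startNeg, hs], by simp⟩
    | succ k ih =>
      rcases ih with ⟨h1, h2, h3, h4⟩ | ⟨h1, h2⟩ | ⟨h1, h2⟩
      · rw [scanNeg, h1]
        simp only [cmpCell, h.bit? h3, h'.bit? h4]
        rcases h3.lt_or_eq with h3 | h3 <;> rcases h4.lt_or_eq with h4 | h4
        · simp only [List.getElem?_eq_getElem h3, List.getElem?_eq_getElem h4]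
          by_cases hb : l.1.bits[k] = m.1.bits[k]
          · refine .inl ⟨by simp [hb], ?_, h3, h4⟩
            rw [List.take_succ_eq_append_getElem h3, List.take_succ_eq_append_getElem h4, h2, hb]
          · exact .inr (.inr ⟨by simp [hb], fun e => hb (by simp [e])⟩)
        · rw [List.getElem?_eq_getElem h3, List.getElem?_eq_none h4.ge]
          exact .inr (.inr ⟨rfl, fun e => by rw [e] at h3; omega⟩)
        · rw [List.getElem?_eq_getElem h4, List.getElem?_eq_none h3.ge]
          exact .inr (.inr ⟨rfl, fun e => by rw [e] at h3; omega⟩)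
        · rw [List.getElem?_eq_none h4.ge, List.getElem?_eq_none h3.ge]
          refine .inr (.inl ⟨rfl, ?_⟩)
          rwa [List.take_of_length_le h3.ge, List.take_of_length_le h4.ge] at h2
      · exact .inr (.inl ⟨by rw [scanNeg, h1], h2⟩)
      · exact .inr (.inr ⟨by rw [scanNeg, h1], h2⟩)
  rcases key K with ⟨-, -, h3, -⟩ | ⟨h1, h2⟩ | ⟨h1, h2⟩
  · have := h.lt
    omega
  · simp only [h1, true_iff]
    refine Prod.ext (bits_injective h2.symm) ?_
    cases hl : l.2 <;> cases hm : m.2 <;> simp_all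
  · simp only [h1, Option.some.injEq, Bool.false_eq_true, false_iff]
    rintro rfl
    exact h2 rfl

/-- If one of the cells holds no sign, `startNeg` rejects at once. -/
theorem isSign_of_negAt {p q : ℕ} (h : negAt x K p q = true) :
    (scan x p).isSign = true ∧ (scan x q).isSign = true := by
  by_contra hn
  rw [negAt, decide_eq_true_eq, scanNeg_of_start] at h
  · simp at h
  · revert hn
    generalize scan x p = c
    generalize scan x q = d
    intro hn
    unfold startNeg
    split
    · exact (hn ⟨rfl, rfl⟩).elim
    · rfl

theorem scan_append (u : List SatSym) (s : SatSym) (r : List SatSym) :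
    scan (u ++ s :: r) (u.length + 1) = .sym s := by
  simp [scan]

/-- The clause `c` consists of the literals in the cells `e.1` and `e.2`. -/
def HoldsClause (x : List SatSym) (e : ℕ × ℕ) (c : List Literal) : Prop :=
  ∃ l m, HoldsLit x e.1 l ∧ HoldsLit x e.2 m ∧ (c = [l, m] ∨ c = [l] ∧ m = l)

/-- The bits of names affect none of the quantities that are accumulated over the input. -/
theorem skip_bits (u : List SatSym) (bs : List Bool) (r : List SatSym) :
    pairState (u ++ bs.map .bit ++ r) (u.length + bs.length) =
        pairState (u ++ bs.map .bit ++ r) u.length ∧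
      pairsTo (u ++ bs.map .bit ++ r) (u.length + bs.length) =
        pairsTo (u ++ bs.map .bit ++ r) u.length ∧
      signsTo (u ++ bs.map .bit ++ r) (u.length + bs.length) =
        signsTo (u ++ bs.map .bit ++ r) u.length ∧
      ∀ p, u.length < p → p ≤ u.length + bs.length →
        (scan (u ++ bs.map .bit ++ r) p).isSign = false := by
  induction bs generalizing u with
  | nil => exact ⟨rfl, rfl, rfl, fun p h h' => by simp at h'; omega⟩
  | cons b bs ih =>
    obtain ⟨h1, h2, h3, h4⟩ := ih (u ++ [.bit b])
    have e : u ++ [.bit b] ++ bs.map .bit ++ r = u ++ (b :: bs).map .bit ++ r := by simp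
    have e' : (u ++ [SatSym.bit b]).length = u.length + 1 := by simp
    have e'' : u.length + (b :: bs).length = u.length + 1 + bs.length := by simp; omega
    have hs : scan (u ++ (b :: bs).map .bit ++ r) (u.length + 1) = .sym (.bit b) := by
      rw [← scan_append u (.bit b) (bs.map .bit ++ r)]; simp
    rw [e, e'] at h1 h2 h3 h4
    rw [e'']
    refine ⟨h1.trans ?_, h2.trans ?_, h3.trans ?_, fun p hp hp' => ?_⟩
    · rw [pairState, hs]; rfl
    · rw [pairsTo, hs]; simp [InCell.isEnd]
    · rw [signsTo, hs]; simp [InCell.isSign]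
    · rcases (Nat.succ_le_of_lt hp).eq_or_lt with rfl | hp
      · rw [hs]; rfl
      · exact h4 p hp hp'

/-- `hr` makes the name end with the code of `l`: what follows does not prolong it. -/
theorem read_literal (u : List SatSym) (l : Literal) {r : List SatSym}
    (hr : ∀ s ∈ r.head?, s.isBit = false) {x : List SatSym} (hx : x = u ++ encodeLiteral l ++ r) :
    pairState x (u ++ encodeLiteral l).length =
        (true, (if (pairState x u.length).1 then (pairState x u.length).2.1 else u.length + 1),
          u.length + 1) ∧
      pairsTo x (u ++ encodeLiteral l).length = pairsTo x u.length ∧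
      signsTo x (u ++ encodeLiteral l).length = signsTo x u.length + 1 ∧
      HoldsLit x (u.length + 1) l ∧
      ∀ p, u.length < p → p ≤ (u ++ encodeLiteral l).length → (scan x p).isSign = true →
        p = u.length + 1 := by
  obtain ⟨h1, h2, h3, h4⟩ := skip_bits (u ++ [.sign l.2]) l.1.bits r
  have e : u ++ [.sign l.2] ++ l.1.bits.map .bit ++ r = x := by simp [hx, encodeLiteral]
  have e' : (u ++ [SatSym.sign l.2]).length = u.length + 1 := by simp
  have e'' : (u ++ encodeLiteral l).length = u.length + 1 + l.1.bits.length := by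
    simp [encodeLiteral]; omega
  have hs : scan x (u.length + 1) = .sym (.sign l.2) := by
    rw [hx, ← scan_append u (.sign l.2) (l.1.bits.map .bit ++ r)]; simp [encodeLiteral]
  rw [e, e'] at h1 h2 h3 h4
  rw [e'']
  refine ⟨h1.trans ?_, h2.trans ?_, h3.trans ?_, ⟨hs, ?_⟩, fun p hp hp' hsg => ?_⟩
  · rw [pairState, hs]
    cases (pairState x u.length).1 <;> simp [InCell.isSign]
  · rw [pairsTo, hs]; simp [InCell.isEnd]
  · rw [signsTo, hs]; simp [InCell.isSign]
  · have : x.drop (u.length + 1) = l.1.bits.map .bit ++ r := by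
      rw [← e, ← e', List.append_assoc, List.drop_left]
    rw [this, List.takeWhile_append_of_pos fun s hs => by
      obtain ⟨b, -, rfl⟩ := List.mem_map.1 hs
      rfl]
    cases r with
    | nil => simp
    | cons s r => simp [hr s (by simp)]
  · by_contra hne
    rw [h4 p (by omega) hp'] at hsg
    simp at hsg

theorem read_end (u : List SatSym) {r : List SatSym} {x : List SatSym}
    (hx : x = u ++ .endClause :: r) :
    pairState x (u.length + 1) = (false, (pairState x u.length).2) ∧
      pairsTo x (u.length + 1) = pairsTo x u.length ++ [(pairState x u.length).2] ∧
      signsTo x (u.length + 1) = signsTo x u.length ∧ (scan x (u.length + 1)).isSign = false := by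
  have hs : scan x (u.length + 1) = .sym .endClause := by rw [hx, scan_append]
  refine ⟨?_, ?_, ?_, ?_⟩
  · rw [pairState, hs]; rfl
  · rw [pairsTo, hs]; rfl
  · rw [signsTo, hs]; rfl
  · rw [hs]; rfl

theorem read_clause (u : List SatSym) {c : List Literal} (hc : 1 ≤ c.length ∧ c.length ≤ 2)
    {r x : List SatSym} (hx : x = u ++ encodeClause c ++ r)
    (hu : (pairState x u.length).1 = false) :
    (pairState x (u ++ encodeClause c).length).1 = false ∧
      (∃ e, pairsTo x (u ++ encodeClause c).length = pairsTo x u.length ++ [e] ∧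
        HoldsClause x e c) ∧
      signsTo x (u ++ encodeClause c).length = signsTo x u.length + c.length ∧
      ∀ p, u.length < p → p ≤ (u ++ encodeClause c).length → (scan x p).isSign = true →
        ∃ l, HoldsLit x p l := by
  match c, hc with
  | [l], _ =>
    obtain ⟨h1, h2, h3, h4, h5⟩ := read_literal u l (r := .endClause :: r) (x := x)
      (by simp [SatSym.isBit]) (by simp [hx, encodeClause])
    obtain ⟨g1, g2, g3, g4⟩ := read_end (u ++ encodeLiteral l) (r := r) (x := x)
      (by simp [hx, encodeClause])
    have e : (u ++ encodeClause [l]).length = (u ++ encodeLiteral l).length + 1 := by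
      simp [encodeClause]; omega
    rw [e, g1, g2, g3, h1, h2, h3, hu]
    refine ⟨rfl, ⟨_, rfl, l, l, h4, h4, .inr ⟨rfl, rfl⟩⟩, rfl, fun p hp hp' hs => ?_⟩
    rcases hp'.lt_or_eq with hp' | rfl
    · exact ⟨l, h5 p hp (by omega) hs ▸ h4⟩
    · rw [g4] at hs; simp at hs
  | [l, m], _ =>
    obtain ⟨h1, h2, h3, h4, h5⟩ := read_literal u l (r := encodeLiteral m ++ .endClause :: r)
      (x := x) (by simp [SatSym.isBit, encodeLiteral]) (by simp [hx, encodeClause])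
    obtain ⟨k1, k2, k3, k4, k5⟩ := read_literal (u ++ encodeLiteral l) m (r := .endClause :: r)
      (x := x) (by simp [SatSym.isBit]) (by simp [hx, encodeClause])
    obtain ⟨g1, g2, g3, g4⟩ := read_end (u ++ encodeLiteral l ++ encodeLiteral m) (r := r) (x := x)
      (by simp [hx, encodeClause])
    have e : (u ++ encodeClause [l, m]).length =
        (u ++ encodeLiteral l ++ encodeLiteral m).length + 1 := by
      simp [encodeClause]; omega
    rw [e, g1, g2, g3, k1, k2, k3, h1, h2, h3, hu]
    refine ⟨rfl, ⟨_, rfl, l, m, h4, k4, .inl rfl⟩, rfl, fun p hp hp' hs => ?_⟩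
    rcases hp'.lt_or_eq with hp' | rfl
    · by_cases hp2 : p ≤ (u ++ encodeLiteral l).length
      · exact ⟨l, h5 p hp hp2 hs ▸ h4⟩
      · exact ⟨m, k5 p (by omega) (by omega) hs ▸ k4⟩
    · rw [g4] at hs; simp at hs

theorem read_clauses (cs : List (List Literal)) (u : List SatSym)
    (hc : ∀ c ∈ cs, 1 ≤ c.length ∧ c.length ≤ 2) {r x : List SatSym}
    (hx : x = u ++ cs.flatMap encodeClause ++ r) (hu : (pairState x u.length).1 = false) :
    (∃ L, pairsTo x (u ++ cs.flatMap encodeClause).length = pairsTo x u.length ++ L ∧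
        List.Forall₂ (HoldsClause x) L cs) ∧
      signsTo x (u ++ cs.flatMap encodeClause).length = signsTo x u.length + cs.flatten.length ∧
      ∀ p, u.length < p → p ≤ (u ++ cs.flatMap encodeClause).length → (scan x p).isSign = true →
        ∃ l, HoldsLit x p l := by
  induction cs generalizing u with
  | nil => exact ⟨⟨[], by simp⟩, by simp, fun p h h' => by simp at h'; omega⟩
  | cons c cs ih =>
    obtain ⟨h1, ⟨e, h2, h2'⟩, h3, h4⟩ := read_clause u (hc c (by simp))
      (r := cs.flatMap encodeClause ++ r) (x := x) (by simp [hx]) hu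
    obtain ⟨⟨L, g1, g1'⟩, g2, g3⟩ := ih (u ++ encodeClause c) (fun c' h => hc c' (by simp [h]))
      (by simp [hx]) h1
    have ee : u ++ (c :: cs).flatMap encodeClause = u ++ encodeClause c ++ cs.flatMap encodeClause := by
      simp
    rw [ee, g1, g2, h2, h3]
    refine ⟨⟨e :: L, by simp, .cons h2' g1'⟩, by simp; omega, fun p hp hp' hs => ?_⟩
    by_cases hp2 : p ≤ (u ++ encodeClause c).length
    · exact h4 p hp hp2 hs
    · exact g3 p (by omega) hp' hs

/-- What the reduction reads from the encoding of a formula. -/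
theorem read_formula (φ : TwoSat3Inst) :
    List.Forall₂ (HoldsClause (twoSat3.encode φ))
        (pairsTo (twoSat3.encode φ) ((twoSat3.encode φ).length + 1)) φ.clauses ∧
      signsTo (twoSat3.encode φ) ((twoSat3.encode φ).length + 1) = φ.clauses.flatten.length ∧
      ∀ p, (scan (twoSat3.encode φ) p).isSign = true → ∃ l, HoldsLit (twoSat3.encode φ) p l := by
  obtain ⟨⟨L, h1, h1'⟩, h2, h3⟩ := read_clauses φ.clauses [] φ.clause_len (r := [])
    (x := twoSat3.encode φ) (by simp [twoSat3]) rfl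
  have e : [] ++ φ.clauses.flatMap encodeClause = twoSat3.encode φ := rfl
  rw [e] at h1 h2 h3
  have hs : scan (twoSat3.encode φ) ((twoSat3.encode φ).length + 1) = .rightEnd := by simp [scan]
  refine ⟨?_, ?_, fun p hp => ?_⟩
  · rw [pairsTo, hs, h1]
    simpa [pairsTo, InCell.isEnd] using h1'
  · rw [signsTo, hs, h2]
    simp [signsTo, InCell.isSign]
  · cases p with
    | zero => simp [scan, InCell.isSign] at hp
    | succ p =>
      by_cases hl : p < (twoSat3.encode φ).length
      · exact h3 _ (by simp) hl hp
      · simp [scan, not_lt.1 hl, InCell.isSign] at hp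

end Word


open Relation

/-! ## Satisfiability and the implication graph -/

section Literals

/-- The complement of a literal. -/
def Literal.compl (l : Literal) : Literal := (l.1, !l.2)

theorem Literal.compl_compl (l : Literal) : l.compl.compl = l := by
  simp [Literal.compl]

theorem Literal.compl_ne (l : Literal) : l.compl ≠ l := fun h => by
  have := congrArg Prod.snd h
  simp [Literal.compl] at this

variable (C : Literal → Literal → Prop)

/-- The implications between literals that the clauses `C` provide. -/
def Implies (l m : Literal) : Prop := C l.compl m ∨ C m l.compl

variable {C}

theorem Implies.compl {l m : Literal} (h : Implies C l m) : Implies C m.compl l.compl := by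
  simpa only [Implies, Literal.compl_compl, or_comm] using h

theorem reach_compl {l m : Literal} (h : ReflTransGen (Implies C) l m) :
    ReflTransGen (Implies C) m.compl l.compl := by
  induction h with
  | refl => exact .refl
  | tail _ h ih => exact .head h.compl ih

theorem eval_of_reach {a : ℕ → Bool} (ha : ∀ l m, C l m → a l.1 = l.2 ∨ a m.1 = m.2)
    {l m : Literal} (h : ReflTransGen (Implies C) l m) (hl : a l.1 = l.2) : a m.1 = m.2 := by
  induction h with
  | refl => exact hl
  | @tail m n _ h ih =>
    have : a m.compl.1 ≠ m.compl.2 := by simp [Literal.compl, ih]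
    rcases h with h | h
    · exact (ha _ _ h).resolve_left this
    · exact (ha _ _ h).resolve_right this

/-- A consistent set of literals that is closed under implications. -/
def ClosedConsistent (C : Literal → Literal → Prop) (T : Set Literal) : Prop :=
  (∀ l ∈ T, ∀ m, Implies C l m → m ∈ T) ∧ ∀ l ∈ T, l.compl ∉ T

theorem ClosedConsistent.reach {T : Set Literal} (hT : ClosedConsistent C T) {l m : Literal}
    (hl : l ∈ T) (h : ReflTransGen (Implies C) l m) : m ∈ T := by
  induction h with
  | refl => exact hl
  | tail _ h ih => exact hT.1 _ ih _ h

/-- If `l` reached the complement of some `m` in `T`, then `m` would reach the complement of `l` by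
contraposition, and that would be in `T`. If `l` reached both `m` and its complement, then it would
reach its own complement. -/
theorem ClosedConsistent.extend {T : Set Literal} (hT : ClosedConsistent C T) {l : Literal}
    (h' : l.compl ∉ T) (hl : ¬ ReflTransGen (Implies C) l l.compl) :
    ClosedConsistent C (T ∪ {m | ReflTransGen (Implies C) l m}) := by
  have hx : ∀ m ∈ T, ¬ ReflTransGen (Implies C) l m.compl := fun m hm h => by
    have := reach_compl h
    rw [Literal.compl_compl] at this
    exact h' (hT.reach hm this)
  refine ⟨?_, ?_⟩
  · rintro m (hm | hm) n h
    · exact .inl (hT.1 m hm n h)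
    · exact .inr (ReflTransGen.tail hm h)
  · rintro m (hm | hm) (hn | hn)
    · exact hT.2 m hm hn
    · exact hx m hm hn
    · exact hx _ hn (by rwa [Literal.compl_compl])
    · have := reach_compl hn
      rw [Literal.compl_compl] at this
      exact hl (ReflTransGen.trans hm this)

/-- A set of clauses of two literals is satisfiable if and only if no literal is equivalent to its
complement. -/
theorem satisfiable_iff_reach :
    (∃ a : ℕ → Bool, ∀ l m, C l m → a l.1 = l.2 ∨ a m.1 = m.2) ↔
      ∀ l : Literal, ¬ (ReflTransGen (Implies C) l l.compl ∧
        ReflTransGen (Implies C) l.compl l) := by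
  constructor
  · rintro ⟨a, ha⟩ l ⟨h1, h2⟩
    have g1 := eval_of_reach ha h1
    have g2 := eval_of_reach ha h2
    simp only [Literal.compl] at g1 g2
    cases h : l.2 <;> cases h' : a l.1 <;> simp_all
  · intro h
    -- A maximal closed consistent set contains one literal of each variable and so defines an
    -- assignment. Zorn's lemma is applied because `C` may be infinite.
    obtain ⟨T, hT⟩ := zorn_subset {T | ClosedConsistent C T} fun c hc hch => by
      refine ⟨⋃₀ c, ⟨?_, ?_⟩, fun s hs => Set.subset_sUnion_of_mem hs⟩
      · rintro l ⟨s, hs, hl⟩ m hlm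
        exact ⟨s, hs, (hc hs).1 l hl m hlm⟩
      · rintro l ⟨s, hs, hl⟩ ⟨s', hs', hl'⟩
        rcases hch.total hs hs' with hss | hss
        · exact (hc hs').2 l (hss hl) hl'
        · exact (hc hs).2 l hl (hss hl')
    have hmem : ∀ l : Literal, l.compl ∉ T → ¬ ReflTransGen (Implies C) l l.compl → l ∈ T :=
      fun l h1 h2 => hT.2 (hT.1.extend h1 h2) Set.subset_union_left (.inr ReflTransGen.refl)
    -- If both `l` and its complement were missing, one of them would not reach its own complement,
    -- and `T` could be extended by everything reachable from it.
    have hcomplete : ∀ l : Literal, l ∉ T → l.compl ∈ T := by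
      intro l hl
      by_contra hl'
      by_cases hr : ReflTransGen (Implies C) l l.compl
      · refine hl' (hmem l.compl (by rwa [Literal.compl_compl]) ?_)
        rw [Literal.compl_compl]
        exact fun hr' => h l ⟨hr, hr'⟩
      · exact hl (hmem l hl' hr)
    classical
    refine ⟨fun v => decide ((v, true) ∈ T), fun l m hlm => ?_⟩
    have hval : ∀ l ∈ T, decide ((l.1, true) ∈ T) = l.2 := by
      rintro ⟨v, b⟩ hl
      cases b with
      | true => simpa using hl
      | false => simpa [Literal.compl] using hT.1.2 _ hl
    -- If `l` is not in `T`, its complement is, and the clause makes it imply `m`.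
    by_cases hl : l ∈ T
    · exact .inl (hval l hl)
    · exact .inr (hval m (hT.1.1 _ (hcomplete l hl) m (.inl (by rwa [Literal.compl_compl]))))

end Literals

/-! ### Reachability between occurrences of literals in the input. -/

section Occurrences

variable (x : List SatSym) (K : ℕ)

/-- The implications between the literals in the cells `p` and `q`. -/
def Step (p q : ℕ) : Prop :=
  ∃ c ∈ pairsTo x K, negAt x K p c.1 = true ∧ q = c.2 ∨ negAt x K p c.2 = true ∧ q = c.1

/-- Two literals form a clause. -/
def IsClause (cs : List (List Literal)) (l m : Literal) : Prop := [l, m] ∈ cs ∨ [l] ∈ cs ∧ m = l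

theorem satisfiable_iff_isClause (φ : TwoSat3Inst) : φ.Satisfiable ↔
    ∃ a : ℕ → Bool, ∀ l m, IsClause φ.clauses l m → a l.1 = l.2 ∨ a m.1 = m.2 := by
  refine exists_congr fun a => ⟨?_, ?_⟩
  · rintro h l m (hc | ⟨hc, rfl⟩)
    · simpa using h _ hc
    · exact .inl (by simpa using h _ hc)
  · intro h c hc
    have hl := φ.clause_len c hc
    match c, hl with
    | [l], _ => exact ⟨l, by simp, by simpa using h l l (.inr ⟨hc, rfl⟩)⟩
    | [l, m], _ => simpa using h l m (.inl hc)

variable {x K}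

theorem mem_of_forall₂ {α β : Type*} {R : α → β → Prop} {l : List α} {l' : List β}
    (h : List.Forall₂ R l l') : (∀ a ∈ l, ∃ b ∈ l', R a b) ∧ ∀ b ∈ l', ∃ a ∈ l, R a b := by
  induction h with
  | nil => simp
  | cons h _ ih =>
    refine ⟨fun a ha => ?_, fun b hb => ?_⟩
    · rcases List.mem_cons.1 ha with rfl | ha
      · exact ⟨_, by simp, h⟩
      · obtain ⟨b, hb, hR⟩ := ih.1 a ha
        exact ⟨b, by simp [hb], hR⟩
    · rcases List.mem_cons.1 hb with rfl | hb
      · exact ⟨_, by simp, h⟩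
      · obtain ⟨a, ha, hR⟩ := ih.2 b hb
        exact ⟨a, by simp [ha], hR⟩

variable {cs : List (List Literal)} (hcs : List.Forall₂ (HoldsClause x) (pairsTo x K) cs)
  (hK : x.length < K)
include hcs hK

theorem Step.implies {p q : ℕ} (h : Step x K p q) {l : Literal} (hl : HoldsLit x p l) :
    ∃ m, HoldsLit x q m ∧ Implies (IsClause cs) l m := by
  obtain ⟨e, he, hn⟩ := h
  obtain ⟨c, hc, l', m', h1, h2, h3⟩ := (mem_of_forall₂ hcs).1 e he
  have hcl : IsClause cs l' m' := by
    rcases h3 with rfl | ⟨rfl, rfl⟩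
    · exact .inl hc
    · exact .inr ⟨hc, rfl⟩
  rcases hn with ⟨hn, rfl⟩ | ⟨hn, rfl⟩
  · rw [hl.negAt_iff h1 hK] at hn
    subst hn
    exact ⟨m', h2, .inl hcl⟩
  · rw [hl.negAt_iff h2 hK] at hn
    subst hn
    exact ⟨l', h1, .inr hcl⟩

/-- The target `q` is determined by a clause and does not depend on `p`: all occurrences of a
literal have the same successors. -/
theorem exists_step {l m : Literal} (h : Implies (IsClause cs) l m) :
    ∃ q, HoldsLit x q m ∧ ∀ p, HoldsLit x p l → Step x K p q := by
  have key : ∀ l m, IsClause cs l m → ∃ e ∈ pairsTo x K, HoldsLit x e.1 l ∧ HoldsLit x e.2 m := by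
    rintro l m (h | ⟨h, rfl⟩)
    · obtain ⟨e, he, l', m', h1, h2, h3⟩ := (mem_of_forall₂ hcs).2 _ h
      simp only [List.cons.injEq, and_true, reduceCtorEq, and_false, false_and, or_false] at h3
      obtain ⟨rfl, rfl⟩ := h3
      exact ⟨e, he, h1, h2⟩
    · obtain ⟨e, he, l', m', h1, h2, h3⟩ := (mem_of_forall₂ hcs).2 _ h
      simp only [List.cons.injEq, and_true, reduceCtorEq, and_false, false_or] at h3
      obtain ⟨rfl, rfl⟩ := h3
      exact ⟨e, he, h1, h2⟩
  rcases h with h | h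
  · obtain ⟨e, he, h1, h2⟩ := key _ _ h
    exact ⟨e.2, h2, fun p hp => ⟨e, he, .inl ⟨(hp.negAt_iff h1 hK).2 rfl, rfl⟩⟩⟩
  · obtain ⟨e, he, h1, h2⟩ := key _ _ h
    exact ⟨e.1, h1, fun p hp => ⟨e, he, .inr ⟨(hp.negAt_iff h2 hK).2 rfl, rfl⟩⟩⟩

theorem reach_literal {p q : ℕ} (h : ReflTransGen (Step x K) p q) {l : Literal}
    (hl : HoldsLit x p l) : ∃ m, HoldsLit x q m ∧ ReflTransGen (Implies (IsClause cs)) l m := by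
  induction h with
  | refl => exact ⟨l, hl, .refl⟩
  | tail _ h ih =>
    obtain ⟨m, h1, h2⟩ := ih
    obtain ⟨n, h3, h4⟩ := h.implies hcs hK h1
    exact ⟨n, h3, h2.tail h4⟩

/-- At least one step is needed, since without a step one cannot get from one occurrence of a
literal to another. The end `q` is the same for all occurrences of `l`. -/
theorem exists_reach {l m : Literal} (h : TransGen (Implies (IsClause cs)) l m) :
    ∃ q, HoldsLit x q m ∧ ∀ p, HoldsLit x p l → ReflTransGen (Step x K) p q := by
  induction h with
  | single h =>
    obtain ⟨q, h1, h2⟩ := exists_step hcs hK h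
    exact ⟨q, h1, fun p hp => .single (h2 p hp)⟩
  | tail _ h ih =>
    obtain ⟨q, h1, h2⟩ := ih
    obtain ⟨r, h3, h4⟩ := exists_step hcs hK h
    exact ⟨r, h3, fun p hp => (h2 p hp).tail (h4 q h1)⟩

omit hcs hK in
theorem transGen_of_ne {α : Type*} {R : α → α → Prop} {a b : α} (h : ReflTransGen R a b)
    (hne : b ≠ a) : TransGen R a b :=
  (reflTransGen_iff_eq_or_transGen.1 h).resolve_left hne

/-- A literal differs from its complement, so both implication paths have positive length. Their
ends are occurrences that can be reached from every occurrence of the respective start, and so the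
two paths fit together to a cycle of cells. -/
theorem exists_cycle_iff (hs : ∀ p, (scan x p).isSign = true → ∃ l, HoldsLit x p l) :
    (∃ p q, negAt x K p q = true ∧ ReflTransGen (Step x K) p q ∧ ReflTransGen (Step x K) q p) ↔
    ∃ l : Literal, ReflTransGen (Implies (IsClause cs)) l l.compl ∧
        ReflTransGen (Implies (IsClause cs)) l.compl l := by
  constructor
  · rintro ⟨p, q, hn, h1, h2⟩
    obtain ⟨l, hl⟩ := hs p (isSign_of_negAt hn).1
    obtain ⟨m, hm, g1⟩ := reach_literal hcs hK h1 hl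
    obtain ⟨l', hl', g2⟩ := reach_literal hcs hK h2 hm
    obtain rfl := hl.unique hl'
    rw [hl.negAt_iff hm hK] at hn
    subst hn
    exact ⟨l, g1, g2⟩
  · rintro ⟨l, h1, h2⟩
    obtain ⟨q, hq, g1⟩ := exists_reach hcs hK (transGen_of_ne h1 l.compl_ne)
    obtain ⟨p, hp, g2⟩ := exists_reach hcs hK (transGen_of_ne h2 l.compl_ne.symm)
    exact ⟨p, q, (hp.negAt_iff hq hK).2 rfl, g1 p hp, g2 q hq⟩

end Occurrences

theorem satisfiable_iff_acyclic (φ : TwoSat3Inst) {x : List SatSym} (hx : x = twoSat3.encode φ) :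
    φ.Satisfiable ↔ ¬ ∃ p q, negAt x (x.length + 1) p q = true ∧
      ReflTransGen (Step x (x.length + 1)) p q ∧ ReflTransGen (Step x (x.length + 1)) q p := by
  subst hx
  obtain ⟨h1, -, h3⟩ := read_formula φ
  rw [exists_cycle_iff h1 (Nat.lt_succ_self _) h3, satisfiable_iff_isClause, satisfiable_iff_reach,
    not_exists]


open Relation

/-! ## The number of strings -/

section Counting

variable {x : List SatSym} {K : ℕ}

/-- Every edge is due to an occurrence of the variable of `l`. The factor 2 is for clauses of a
single literal, whose edge is listed twice. -/
theorem length_clauseEdges_le (hK : x.length < K) {p base : ℕ} {l : Literal} (hl : HoldsLit x p l)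
    {L : List (ℕ × ℕ)} {cs : List (List Literal)} (h : List.Forall₂ (HoldsClause x) L cs) :
    (L.flatMap (clauseEdges x K base p)).length ≤ 2 * (varOccurrences cs).count l.1 := by
  induction h with
  | nil => simp
  | @cons e c L cs hc _ ih =>
    obtain ⟨l', m', h1, h2, h3⟩ := hc
    have k1 : negAt x K p e.1 = true → l'.1 = l.1 := fun h => by
      rw [hl.negAt_iff h1 hK] at h; rw [h]
    have k2 : negAt x K p e.2 = true → m'.1 = l.1 := fun h => by
      rw [hl.negAt_iff h2 hK] at h; rw [h]
    have hlen : (clauseEdges x K base p e).length ≤ 2 * (c.map Prod.fst).count l.1 := by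
      simp only [clauseEdges, List.length_append]
      rcases h3 with rfl | ⟨rfl, rfl⟩
      · by_cases g1 : negAt x K p e.1 = true <;> by_cases g2 : negAt x K p e.2 = true
        · simp [g1, g2, k1 g1, k2 g2]
        · simp [g1, g2, k1 g1, List.count_cons]; omega
        · simp [g1, g2, k2 g2, List.count_cons]; omega
        · simp [g1, g2]
      · by_cases g1 : negAt x K p e.1 = true <;> by_cases g2 : negAt x K p e.2 = true
        · simp [g1, g2, k1 g1]
        · simp [g1, g2, k1 g1]
        · simp [g1, g2, k2 g2]
        · simp [g1, g2]
    have : (varOccurrences (c :: cs)).count l.1 =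
        (c.map Prod.fst).count l.1 + (varOccurrences cs).count l.1 := by
      simp [varOccurrences]
    rw [List.flatMap_cons, List.length_append, this]
    omega

theorem length_flatMap_signs_le (F : ℕ → List (ℕ × ℕ)) {B : ℕ} (n : ℕ)
    (h : ∀ i, (scan x (i + 1)).isSign = true → (F i).length ≤ B) :
    ((List.range n).flatMap fun i => if (scan x (i + 1)).isSign then F i else []).length ≤
      signsTo x n * B := by
  induction n with
  | zero => simp [signsTo]
  | succ n ih =>
    rw [List.range_succ, List.flatMap_append, List.length_append, signsTo, Nat.add_mul]
    refine Nat.add_le_add ih ?_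
    by_cases hs : (scan x (n + 1)).isSign
    · simpa [hs] using h n hs
    · simp [hs]

theorem length_edges_le {B : ℕ}
    (h : ∀ base p, (scan x p).isSign = true → (edgesFrom x K base p).length ≤ B) :
    (edges x K).length ≤ signsTo x K * (signsTo x K * B) :=
  length_flatMap_signs_le _ _ fun _ _ => length_flatMap_signs_le _ _ fun i hi => h _ (i + 1) hi

/-- There are T ≤ 3m occurrences of literals, hence at most 3m layers of edges with at most 3m
starting points each. From each of these lead at most 1 + 2 · 3 = 7 edges, and 3 · 3 · 7 = 63. That
the bound is quadratic in m is the reason for the exponent 1/2 in the theorem. -/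
theorem length_edges_encode_le (φ : TwoSat3Inst) {x : List SatSym} (hx : x = twoSat3.encode φ) :
    (edges x (x.length + 1)).length ≤ 63 * φ.numVars ^ 2 := by
  subst hx
  obtain ⟨h1, h2, h3⟩ := read_formula φ
  have hT : signsTo (twoSat3.encode φ) ((twoSat3.encode φ).length + 1) ≤ 3 * φ.numVars := by
    rw [h2, ← List.length_map (f := Prod.fst)]
    change (varOccurrences φ.clauses).length ≤ _
    rw [← List.sum_toFinset_count_eq_length, TwoSat3Inst.numVars, mul_comm, ← smul_eq_mul]
    exact Finset.sum_le_card_nsmul _ _ _ fun v _ => φ.occ_le v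
  refine (length_edges_le (B := 7) fun base p hp => ?_).trans ?_
  · obtain ⟨l, hl⟩ := h3 p hp
    have := length_clauseEdges_le (base := base) (Nat.lt_add_one _) hl h1
    have := φ.occ_le l.1
    rw [edgesFrom, List.length_cons]
    omega
  · calc _ ≤ 3 * φ.numVars * (3 * φ.numVars * 7) := by gcongr
      _ = _ := by ring

theorem length_pairsTo_le (n : ℕ) : (pairsTo x n).length ≤ n := by
  induction n with
  | zero => simp [pairsTo]
  | succ n ih =>
    simp only [pairsTo, List.length_append]
    split_ifs <;> simp <;> omega

theorem mem_flatMap_signs {F : ℕ → List (ℕ × ℕ)} {n : ℕ} {e : ℕ × ℕ} :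
    (e ∈ (List.range n).flatMap fun i => if (scan x (i + 1)).isSign then F i else []) ↔
      ∃ i < n, (scan x (i + 1)).isSign = true ∧ e ∈ F i := by
  rw [List.mem_flatMap]
  refine exists_congr fun i => ?_
  rw [List.mem_range]
  by_cases hs : (scan x (i + 1)).isSign <;> simp [hs]

/-- An edge of the layered graph between literals. -/
def Hop (x : List SatSym) (K p q : ℕ) : Prop := q = p ∨ Step x K p q

theorem mem_edgesFrom {base p : ℕ} {e : ℕ × ℕ} :
    e ∈ edgesFrom x K base p ↔ ∃ q, Hop x K p q ∧ e = (base + p, base + K + q) := by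
  simp only [edgesFrom, List.mem_cons, List.mem_flatMap, clauseEdges, List.mem_append]
  constructor
  · rintro (rfl | ⟨c, hc, h | h⟩)
    · exact ⟨p, .inl rfl, rfl⟩
    · split_ifs at h with hn
      · exact ⟨c.2, .inr ⟨c, hc, .inl ⟨hn, rfl⟩⟩, by simpa using h⟩
      · simp at h
    · split_ifs at h with hn
      · exact ⟨c.1, .inr ⟨c, hc, .inr ⟨hn, rfl⟩⟩, by simpa using h⟩
      · simp at h
  · rintro ⟨q, rfl | ⟨c, hc, ⟨hn, rfl⟩ | ⟨hn, rfl⟩⟩, rfl⟩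
    · exact .inl rfl
    · exact .inr ⟨c, hc, .inl (by simp [hn])⟩
    · exact .inr ⟨c, hc, .inr (by simp [hn])⟩

theorem mem_layer {base : ℕ} {e : ℕ × ℕ} : e ∈ layer x K base ↔
    ∃ p q, p ≤ K ∧ (scan x p).isSign = true ∧ Hop x K p q ∧ e = (base + p, base + K + q) := by
  rw [layer, mem_flatMap_signs]
  constructor
  · rintro ⟨i, hi, hs, he⟩
    obtain ⟨q, hq, rfl⟩ := mem_edgesFrom.1 he
    exact ⟨i + 1, q, hi, hs, hq, rfl⟩
  · rintro ⟨p, q, hp, hs, hq, rfl⟩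
    cases p with
    | zero => simp [scan, InCell.isSign] at hs
    | succ i => exact ⟨i, hp, hs, mem_edgesFrom.2 ⟨q, hq, rfl⟩⟩

theorem signsTo_lt {i n : ℕ} (hi : i < n) (hs : (scan x (i + 1)).isSign = true) :
    signsTo x i < signsTo x n := by
  induction n with
  | zero => omega
  | succ n ih =>
    rw [signsTo]
    rcases (Nat.lt_succ_iff_lt_or_eq).1 hi with h | rfl
    · have := ih h; omega
    · simp [hs]

theorem exists_of_mem_edges {e : ℕ × ℕ} (he : e ∈ edges x K) :
    ∃ t p q, t < signsTo x K ∧ p ≤ K ∧ (scan x p).isSign = true ∧ Hop x K p q ∧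
      e = (t * K + p, (t + 1) * K + q) := by
  rw [edges, mem_flatMap_signs] at he
  obtain ⟨i, hi, hs, he⟩ := he
  obtain ⟨p, q, hp, hps, hq, rfl⟩ := mem_layer.1 he
  exact ⟨signsTo x i, p, q, signsTo_lt hi hs, hp, hps, hq, by rw [Nat.succ_mul]⟩

/-- The edges of a path form a sublist of all edges. -/
theorem path_sublist {f : ℕ → ℕ} (hf : ∀ t, f t ≤ K ∧ (scan x (f t)).isSign = true)
    (hop : ∀ t < signsTo x K, Hop x K (f t) (f (t + 1))) :
    ((List.range (signsTo x K)).map fun t => (t * K + f t, (t + 1) * K + f (t + 1))).Sublist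
      (edges x K) := by
  -- Induction over the cells of the input: each sign that is read adds a layer to the list and the
  -- next edge to the path.
  have key : ∀ n, (∀ t < signsTo x n, Hop x K (f t) (f (t + 1))) →
      ((List.range (signsTo x n)).map fun t => (t * K + f t, (t + 1) * K + f (t + 1))).Sublist
      ((List.range n).flatMap fun i =>
        if (scan x (i + 1)).isSign then layer x K (signsTo x i * K) else []) := by
    intro n
    induction n with
    | zero => simp [signsTo]
    | succ n ih =>
      intro hn
      rw [List.range_succ (n := n), List.flatMap_append]
      by_cases hs : (scan x (n + 1)).isSign = true
      · have e : signsTo x (n + 1) = signsTo x n + 1 := by simp [signsTo, hs]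
        rw [e, List.range_succ, List.map_append]
        refine (ih fun t ht => hn t (by omega)).append ?_
        simp only [hs, if_true, List.flatMap_cons, List.flatMap_nil, List.append_nil, List.map_cons,
          List.map_nil, List.singleton_sublist]
        exact mem_layer.2 ⟨_, _, (hf _).1, (hf _).2, hn (signsTo x n) (by omega), by
          rw [Nat.succ_mul]⟩
      · have e : signsTo x (n + 1) = signsTo x n := by simp [signsTo, hs]
        rw [e]
        simpa [hs] using ih fun t ht => hn t (by omega)
  exact key K hop

end Counting

/-! ## Short paths -/

section Paths

variable {α : Type*} (R : α → α → Prop)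

/-- There is a path of length `n`. -/
def PathOf (a : α) : ℕ → α → Prop
  | 0, b => b = a
  | n + 1, b => ∃ c, PathOf a n c ∧ R c b

variable {R}

theorem PathOf.exists_fun {a b : α} {n : ℕ} (h : PathOf R a n b) :
    ∃ f : ℕ → α, f 0 = a ∧ f n = b ∧ (∀ t < n, R (f t) (f (t + 1))) ∧ ∀ t, n ≤ t → f t = b := by
  induction n generalizing b with
  | zero => exact ⟨fun _ => a, rfl, h.symm, by simp, fun _ _ => h.symm⟩
  | succ n ih =>
    obtain ⟨c, hc, hR⟩ := h
    obtain ⟨f, h0, hn, hf, -⟩ := ih hc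
    refine ⟨fun t => if t ≤ n then f t else b, by simpa using h0, by simp, fun t ht => ?_,
      fun t ht => if_neg (by omega)⟩
    rcases (Nat.lt_succ_iff_lt_or_eq).1 ht with h | rfl
    · simpa [h.le, Nat.succ_le_of_lt h] using hf t h
    · simpa [hn] using hR

theorem PathOf.exists_length {a b : α} (h : ReflTransGen R a b) : ∃ n, PathOf R a n b := by
  induction h with
  | refl => exact ⟨0, rfl⟩
  | tail _ h ih =>
    obtain ⟨n, hn⟩ := ih
    exact ⟨n + 1, _, hn, h⟩

/-- For a reflexive relation, the points that are reachable are reachable in as many steps as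
there are points. -/
theorem PathOf.of_card (hR : ∀ a, R a a) {s : Finset α} {a : α} (ha : a ∈ s)
    (hs : ∀ b c, b ∈ s → R b c → c ∈ s) {b : α} (h : ReflTransGen R a b) {n : ℕ}
    (hn : s.card ≤ n) : PathOf R a n b := by
  have hmono : ∀ m, {c | PathOf R a m c} ⊆ {c | PathOf R a (m + 1) c} :=
    fun m c hc => ⟨c, hc, hR c⟩
  have hsub : ∀ m, {c | PathOf R a m c} ⊆ s := by
    intro m
    induction m with
    | zero => rintro c rfl; exact ha
    | succ m ih => rintro c ⟨d, hd, hc⟩; exact hs d c (ih hd) hc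
  have hfin : ∀ m, {c | PathOf R a m c}.Finite := fun m => s.finite_toSet.subset (hsub m)
  have hM : Monotone fun m => {c | PathOf R a m c} := monotone_nat_of_le_succ hmono
  obtain ⟨m, hm⟩ := PathOf.exists_length h
  rcases le_total m n with hmn | hmn
  · exact hM hmn hm
  -- The sets of points reachable in m steps increase with m, and once two successive ones agree
  -- they are constant. Since they lie in `s`, this happens within `s.card` steps.
  · have hcard := Nat.stabilises_of_monotone (f := fun m => {c | PathOf R a m c}.ncard) (b := n)
      (n := m) (fun i j hij => Set.ncard_le_ncard (hM hij) (hfin j))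
      (fun i => (Set.ncard_le_ncard (hsub i) s.finite_toSet).trans (by simpa using hn))
      (fun i hi => by
        have hi := Set.eq_of_subset_of_ncard_le (hmono i) hi.ge (hfin _)
        have : {c | PathOf R a (i + 1) c} = {c | PathOf R a (i + 1 + 1) c} := by
          ext c
          constructor
          · exact fun h => hmono _ h
          · rintro ⟨d, hd, hc⟩
            exact ⟨d, (Set.ext_iff.1 hi d).2 hd, hc⟩
        exact congrArg Set.ncard this) hmn
    have := Set.eq_of_subset_of_ncard_le (hM hmn) hcard.le (hfin _)
    exact (Set.ext_iff.1 this b).2 hm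

end Paths


open Relation

/-! ## Blocks -/

theorem blocks_cons {u v : ℕ} (h : u < v) : blocks u v = blk u ++ blocks (u + 1) v := by
  rw [blocks, blocks, show v - u = (v - (u + 1)) + 1 by omega, List.range'_succ]
  simp

theorem blocks_append {u v w : ℕ} (h : u ≤ v) (h' : v ≤ w) :
    blocks u v ++ blocks v w = blocks u w := by
  induction w, h' using Nat.le_induction with
  | base => rw [blocks_of_le le_rfl, List.append_nil]
  | succ w hw ih => rw [blocks_succ hw, blocks_succ (h.trans hw), ← ih, List.append_assoc]

/-- Blocks form a prefix code: the length of the run of ones after the first symbol is the number.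
-/
theorem blk_append_inj {u v : ℕ} {r r' : List Bool} (h : blk u ++ r = blk v ++ r') :
    u = v ∧ r = r' := by
  simp only [blk, List.cons_append, List.append_assoc, List.cons.injEq, true_and,
    List.nil_append] at h
  induction u generalizing v with
  | zero =>
    cases v with
    | zero => simpa using h
    | succ v => simp [List.replicate_succ] at h
  | succ u ih =>
    cases v with
    | zero => simp [List.replicate_succ] at h
    | succ v =>
      simp only [List.replicate_succ, List.cons_append, List.cons.injEq, true_and] at h
      simpa using ih h

theorem blocks_ne_nil {u v : ℕ} (h : u < v) : blocks u v ≠ [] := by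
  simp [blocks_cons h, blk]

/-- Block number `u ≥ 1` occurs in a sequence of blocks in no other place than in its own. -/
theorem eq_blocks_of_blk {a c u : ℕ} (hu : 1 ≤ u) {p r : List Bool}
    (h : blocks a c = p ++ (blk u ++ r)) : p = blocks a u ∧ a ≤ u := by
  obtain ⟨n, hn⟩ : ∃ n, n = c - a := ⟨_, rfl⟩
  induction n generalizing a p with
  | zero =>
    rw [blocks_of_le (by omega)] at h
    simp [blk] at h
  | succ n ih =>
    rw [blocks_cons (by omega)] at h
    rcases List.append_eq_append_iff.1 h with ⟨p', rfl, h1⟩ | ⟨q, h1, h2⟩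
    · obtain ⟨h2, h3⟩ := ih h1 (by omega)
      exact ⟨by rw [h2, ← blocks_cons (by omega)], by omega⟩
    · cases p with
      | nil =>
        obtain ⟨rfl, -⟩ := blk_append_inj (r := blocks (a + 1) c) (v := u) (r' := r) (by simpa using h)
        exact ⟨(blocks_of_le le_rfl).symm, le_rfl⟩
      | cons b p =>
        -- `q` is what remains of block `a` when a nonempty beginning has been cut off. Block `u`
        -- starts with 01 because `u ≥ 1`, so `q` cannot start with a one; nor can it be a single
        -- zero, because the next block, if any, starts with a zero. Block 0, which is 00, could
        -- straddle two blocks.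
        have hlast : q = [] ∨ q = [false] ∨ ∃ q', q = true :: q' := by
          simp only [blk, List.cons_append, List.cons.injEq] at h1
          rcases List.append_eq_append_iff.1 h1.2 with ⟨s, -, hs⟩ | ⟨s, hs, rfl⟩
          · cases q with
            | nil => exact .inl rfl
            | cons b' q =>
              cases s with
              | nil => simp at hs; exact .inr (.inl (by simp [hs]))
              | cons b'' s => simp at hs
          · cases s with
            | nil => exact .inr (.inl rfl)
            | cons b' s =>
              have : b' ∈ List.replicate a true := by rw [hs]; simp
              rw [List.eq_of_mem_replicate this]
              exact .inr (.inr ⟨_, rfl⟩)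
        obtain ⟨u, rfl⟩ := Nat.exists_eq_add_of_le' hu
        rcases hlast with rfl | rfl | ⟨q', rfl⟩
        · obtain ⟨h3, h4⟩ := ih (a := a + 1) (p := []) (by simpa using h2.symm) (by omega)
          rw [List.append_nil] at h1
          refine ⟨?_, by omega⟩
          rw [← h1, blocks_cons (by omega), ← h3, List.append_nil]
        · simp only [blk, List.replicate_succ, List.cons_append, List.nil_append,
            List.cons.injEq, true_and] at h2
          by_cases hc : a + 1 < c
          · simp [blocks_cons hc, blk] at h2
          · simp [blocks_of_le (not_lt.1 hc)] at h2
        · simp [blk] at h2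

/-- The first block alone determines the place of the whole string, by `eq_blocks_of_blk`. -/
theorem isUniqueSubstring_blocks {S : Type} {sy : Bool → S} (hsy : Function.Injective sy)
    {a c u v : ℕ} (hu : 1 ≤ u) (huv : u < v)
    (h : (blocks u v).map sy <:+: (blocks a c).map sy) :
    IsUniqueSubstring ((blocks u v).map sy) ((blocks a c).map sy) := by
  have key : ∀ p r : List S, (blocks a c).map sy = p ++ (blocks u v).map sy ++ r →
      p = (blocks a u).map sy := by
    intro p r h
    rw [List.append_assoc] at h
    obtain ⟨p', t', h1, rfl, h2⟩ := List.map_eq_append_iff.1 h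
    obtain ⟨s', r', rfl, h3, h4⟩ := List.map_eq_append_iff.1 h2
    rw [List.map_injective_iff.2 hsy h3, blocks_cons huv, List.append_assoc] at h1
    rw [(eq_blocks_of_blk hu h1).1]
  obtain ⟨p, r, h⟩ := h
  refine ⟨(p, r), h.symm, ?_⟩
  rintro ⟨p', r'⟩ h'
  have e := key p r h.symm
  have e' := key p' r' h'
  subst e e'
  simp only at h'
  rw [← h, List.append_assoc, List.append_assoc] at h'
  simpa using h'.symm

theorem blocks_append_eq {u v c : ℕ} (h : u < v) {r : List Bool}
    (he : blocks u v ++ r = blocks u c) : v ≤ c ∧ r = blocks v c := by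
  obtain ⟨n, rfl⟩ := Nat.exists_eq_add_of_lt h
  induction n generalizing u with
  | zero =>
    by_cases hc : u < c
    · rw [blocks_cons h, blocks_cons hc, blocks_of_le (by omega), List.append_nil] at he
      exact ⟨hc, (blk_append_inj he).2⟩
    · rw [blocks_of_le (not_lt.1 hc)] at he
      exact absurd (List.append_eq_nil_iff.1 he).1 (blocks_ne_nil h)
  | succ n ih =>
    by_cases hc : u < c
    · rw [blocks_cons h, blocks_cons hc, List.append_assoc] at he
      have := ih (u := u + 1) (by omega)
        (by rw [show u + 1 + n + 1 = u + (n + 1) + 1 by omega]; exact (blk_append_inj he).2)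
      rwa [show u + 1 + n + 1 = u + (n + 1) + 1 by omega] at this
    · rw [blocks_of_le (not_lt.1 hc)] at he
      exact absurd (List.append_eq_nil_iff.1 he).1 (blocks_ne_nil h)

/-! ## The instance and its solutions -/

section Instance

variable {S : Type} {sy : Bool → S} (hsy : Function.Injective sy) {x : List SatSym} {K : ℕ}

/-- All literals are in the first `K` cells, and the clauses consist of literals. -/
structure WellFormed (x : List SatSym) (K : ℕ) : Prop where
  le : ∀ p, (scan x p).isSign = true → p ≤ K
  pairs : ∀ e ∈ pairsTo x K, (scan x e.1).isSign = true ∧ (scan x e.2).isSign = true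

theorem pos_of_isSign {p : ℕ} (h : (scan x p).isSign = true) : 1 ≤ p := by
  cases p with
  | zero => simp [scan, InCell.isSign] at h
  | succ p => omega

theorem Hop.isSign {p q : ℕ} (hx : WellFormed x K) (h : Hop x K p q)
    (hp : (scan x p).isSign = true) : (scan x q).isSign = true := by
  rcases h with rfl | ⟨e, he, ⟨-, rfl⟩ | ⟨-, rfl⟩⟩
  · exact hp
  · exact (hx.pairs e he).2
  · exact (hx.pairs e he).1

/-- Cells with literals are numbered from 1 to K. So even in layer 0 no edge starts at the number 0,
which would spoil uniqueness, and the number of a cell is smaller than those of all cells of the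
next layer. -/
theorem edge_bounds (hx : WellFormed x K) {e : ℕ × ℕ} (he : e ∈ edges x K) :
    1 ≤ e.1 ∧ e.1 < e.2 := by
  obtain ⟨t, p, q, -, hp, hps, hq, rfl⟩ := exists_of_mem_edges he
  have h1 := pos_of_isSign hps
  have h2 := pos_of_isSign (hq.isSign hx hps)
  constructor
  · dsimp only; omega
  · simp only [Nat.succ_mul]; omega

theorem signsTo_pos (hx : WellFormed x K) {a : ℕ} (ha : (scan x a).isSign = true) :
    0 < signsTo x K := by
  obtain ⟨i, rfl⟩ := Nat.exists_eq_add_of_le' (pos_of_isSign ha)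
  exact (Nat.zero_le _).trans_lt (signsTo_lt (hx.le _ ha) ha)

theorem edges_ne_nil (hx : WellFormed x K) {a : ℕ} (ha : (scan x a).isSign = true) :
    edges x K ≠ [] := by
  have h := path_sublist (K := K) (f := fun _ => a) (fun _ => ⟨hx.le a ha, ha⟩)
    (fun _ _ => .inl rfl)
  intro h0
  rw [h0, List.sublist_nil, List.map_eq_nil_iff, List.range_eq_nil] at h
  have := signsTo_pos hx ha
  omega

include hsy in
/-- The knapsack instance that asks for a path from `a` to `b`. -/
def knapsack (hx : WellFormed x K) {a : ℕ} (ha : (scan x a).isSign = true) (b : ℕ) :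
    UOCKInst S where
  w := (blocks a (signsTo x K * K + b)).map sy
  ws := (edges x K).map fun e => (blocks e.1 e.2).map sy
  ws_ne := by simpa using edges_ne_nil hx ha
  unique := by
    intro z hz h
    obtain ⟨e, he, rfl⟩ := List.mem_map.1 hz
    exact isUniqueSubstring_blocks hsy (edge_bounds hx he).1 (edge_bounds hx he).2 h

theorem encode_knapsack (hx : WellFormed x K) {a : ℕ} (ha : (scan x a).isSign = true) (b : ℕ) :
    (searchUOCK S).encode (knapsack hsy hx ha b) = (instWord x K a b).map (Option.map sy) := by
  simp [searchUOCK, knapsack, instWord, edgeWord, List.flatMap_map, List.map_flatMap,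
    Function.comp_def]

theorem size_knapsack (hx : WellFormed x K) {a : ℕ} (ha : (scan x a).isSign = true) (b : ℕ) :
    (searchUOCK S).size (knapsack hsy hx ha b) = (edges x K).length := by
  simp [searchUOCK, knapsack]

/-- Cells range over 1, …, K, so a number determines its layer and its cell. -/
theorem mul_add_inj {t s p q : ℕ} (hp : 1 ≤ p) (hp' : p ≤ K) (hq : 1 ≤ q) (hq' : q ≤ K)
    (h : t * K + p = s * K + q) : t = s ∧ p = q := by
  have : t = s := by
    rcases lt_trichotomy t s with hl | hl | hl
    · have := Nat.mul_le_mul_right K (Nat.succ_le_of_lt hl)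
      rw [Nat.succ_mul] at this
      omega
    · exact hl
    · have := Nat.mul_le_mul_right K (Nat.succ_le_of_lt hl)
      rw [Nat.succ_mul] at this
      omega
  subst this
  exact ⟨rfl, by omega⟩

/-- The first string must begin with the block of the current vertex, so it belongs to an edge that
starts there; cancelling it leaves the same situation at the end of this edge. Edges that stay in
their cell contribute nothing to the path. -/
theorem reach_of_blocks (hx : WellFormed x K) {b s : ℕ} (hb : (scan x b).isSign = true)
    (es : List (ℕ × ℕ)) (hes : ∀ e ∈ es, e ∈ edges x K) {t p : ℕ}
    (hp : (scan x p).isSign = true) (hle : t * K + p ≤ s * K + b)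
    (h : es.flatMap (fun e => blocks e.1 e.2) = blocks (t * K + p) (s * K + b)) :
    ReflTransGen (Step x K) p b := by
  induction es generalizing t p with
  | nil =>
    rcases hle.lt_or_eq with hl | hl
    · exact absurd h.symm (blocks_ne_nil hl)
    · rw [(mul_add_inj (pos_of_isSign hp) (hx.le _ hp) (pos_of_isSign hb) (hx.le _ hb) hl).2]
  | cons e es ih =>
    have he := edge_bounds hx (hes e (by simp))
    obtain ⟨t', p', q, -, hp', hps, hq, rfl⟩ := exists_of_mem_edges (hes e (by simp))
    rw [List.flatMap_cons] at h
    have hlt : t * K + p < s * K + b := by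
      refine hle.lt_of_ne fun hl => ?_
      rw [hl, blocks_of_le le_rfl] at h
      exact blocks_ne_nil he.2 (List.append_eq_nil_iff.1 h).1
    have h1 := h
    rw [blocks_cons hlt, blocks_cons he.2, List.append_assoc] at h1
    obtain ⟨rfl, rfl⟩ := mul_add_inj (pos_of_isSign hps) hp' (pos_of_isSign hp) (hx.le _ hp)
      (blk_append_inj h1).1
    obtain ⟨h2, h3⟩ := blocks_append_eq he.2 h
    have := ih (fun e he => hes e (by simp [he])) (hq.isSign hx hps) h2 h3
    rcases hq with rfl | hq
    · exact this
    · exact .head hq this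

/-- There are as many layers of edges as vertices, so the layers suffice for every path, by
`PathOf.of_card`. -/
theorem card_signs (n : ℕ) :
    ((Finset.range (n + 1)).filter fun p => (scan x p).isSign = true).card = signsTo x n := by
  induction n with
  | zero => simp [signsTo, Finset.filter_singleton, scan, InCell.isSign]
  | succ n ih =>
    rw [Finset.range_add_one, Finset.filter_insert, signsTo, ← ih]
    split_ifs with h
    · rw [Finset.card_insert_of_notMem (by simp)]
    · rfl

/-- The strings along a path telescope. -/
theorem flatMap_path {f : ℕ → ℕ} (hf : ∀ t, 1 ≤ f t ∧ f t ≤ K) (n : ℕ) :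
    ((List.range n).map fun t => (t * K + f t, (t + 1) * K + f (t + 1))).flatMap
      (fun e => blocks e.1 e.2) = blocks (f 0) (n * K + f n) := by
  have hmono : ∀ t, t * K + f t ≤ (t + 1) * K + f (t + 1) := fun t => by
    have := (hf t).2
    rw [Nat.succ_mul]; omega
  have h0 : ∀ n, f 0 ≤ n * K + f n := by
    intro n
    induction n with
    | zero => simp
    | succ n ih => exact ih.trans (hmono n)
  induction n with
  | zero => simp [blocks_of_le]
  | succ n ih =>
    rw [List.range_succ, List.map_append, List.flatMap_append, ih]
    simp only [List.map_cons, List.map_nil, List.flatMap_cons, List.flatMap_nil, List.append_nil]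
    exact blocks_append (h0 n) (hmono n)

/-- The relation `Hop` is reflexive, so a path of any length can be shortened or padded to one of
exactly T hops. -/
theorem exists_path (hx : WellFormed x K) {a b : ℕ} (ha : (scan x a).isSign = true)
    (h : ReflTransGen (Step x K) a b) :
    ∃ f : ℕ → ℕ, f 0 = a ∧ f (signsTo x K) = b ∧ (∀ t, (scan x (f t)).isSign = true) ∧
      ∀ t < signsTo x K, Hop x K (f t) (f (t + 1)) := by
  obtain ⟨f, h0, hn, hop, hc⟩ := (PathOf.of_card (R := Hop x K) (fun _ => .inl rfl)
    (s := (Finset.range (K + 1)).filter fun p => (scan x p).isSign = true)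
    (by simp [ha, Nat.lt_succ_of_le (hx.le a ha)])
    (fun p q hp hq => by
      simp only [Finset.mem_filter, Finset.mem_range] at hp ⊢
      have := hq.isSign hx hp.2
      exact ⟨Nat.lt_succ_of_le (hx.le q this), this⟩)
    (h.lift id fun _ _ h => .inr h) (card_signs K).le).exists_fun
  refine ⟨f, h0, hn, ?_, hop⟩
  have : ∀ t ≤ signsTo x K, (scan x (f t)).isSign = true := by
    intro t
    induction t with
    | zero => intro _; rwa [h0]
    | succ t ih => exact fun ht => (hop t ht).isSign hx (ih (by omega))
  intro t
  rcases le_total t (signsTo x K) with ht | ht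
  · exact this t ht
  · rw [hc t ht, ← hn]
    exact this _ le_rfl

/-- A solution spells a path by `reach_of_blocks`. Conversely, the edges of a path of T hops are a
sublist of all edges, and a sublist is given by an increasing sequence of indices. -/
theorem sol_knapsack_nonempty_iff (hx : WellFormed x K) {a b : ℕ} (ha : (scan x a).isSign = true)
    (hb : (scan x b).isSign = true) :
    ((searchUOCK S).sol (knapsack hsy hx ha b)).Nonempty ↔ ReflTransGen (Step x K) a b := by
  constructor
  · rintro ⟨y, is, ⟨-, -, h⟩, -⟩
    have hlen : (knapsack hsy hx ha b).ws.length = (edges x K).length := size_knapsack hsy hx ha b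
    have h2 : (blocks a (signsTo x K * K + b)).map sy = ((is.map fun i =>
        (edges x K)[i.1]'(hlen ▸ i.2)).flatMap fun e => blocks e.1 e.2).map sy := by
      rw [List.flatMap_map, List.map_flatMap]
      refine h.trans ?_
      rw [List.flatMap_def]
      congr 1
      refine List.map_congr_left fun i _ => ?_
      change ((edges x K).map _)[i.1]'_ = _
      rw [List.getElem_map]
    refine reach_of_blocks (t := 0) (s := signsTo x K) hx hb _ ?_ ha ?_
      ((List.map_injective_iff.2 hsy h2).symm.trans (by simp))
    · intro e he
      obtain ⟨i, -, rfl⟩ := List.mem_map.1 he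
      exact List.getElem_mem _
    · have := Nat.mul_le_mul_right K (signsTo_pos hx ha)
      have := hx.le a ha
      omega
  · intro h
    obtain ⟨f, h0, hn, hs, hop⟩ := exists_path hx ha h
    have hsub := (path_sublist (fun t => ⟨hx.le _ (hs t), hs t⟩) hop).map
      fun e => (blocks e.1 e.2).map sy
    obtain ⟨is, h1, h2⟩ := List.sublist_eq_map_getElem hsub
    refine ⟨_, is, ⟨?_, h2, ?_⟩, rfl⟩
    -- The cell `a` holds a literal, so T ≥ 1 and the path has an edge.
    · rintro rfl
      have := signsTo_pos hx ha
      have h1 := h1.trans List.map_nil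
      rw [List.map_eq_nil_iff, List.map_eq_nil_iff, List.range_eq_nil] at h1
      omega
    · have h3 := flatMap_path (fun t => ⟨pos_of_isSign (hs t), hx.le _ (hs t)⟩) (signsTo x K)
      rw [h0, hn] at h3
      change (blocks a (signsTo x K * K + b)).map sy = _
      rw [← h3, List.map_flatMap, List.flatMap_def, h1]
      rfl

theorem wellFormed_encode (φ : TwoSat3Inst) {x : List SatSym} (hx : x = twoSat3.encode φ) :
    WellFormed x (x.length + 1) := by
  subst hx
  refine ⟨fun p hp => ?_, fun e he => ?_⟩
  · by_contra hlt
    obtain ⟨n, rfl⟩ := Nat.exists_eq_add_of_lt (not_le.1 hlt)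
    rw [scan] at hp
    rw [List.getElem?_eq_none (by omega)] at hp
    simp [InCell.isSign] at hp
  · obtain ⟨c, -, l, m, h1, h2, -⟩ := (mem_of_forall₂ (read_formula φ).1).1 e he
    exact ⟨h1.isSign, h2.isSign⟩

end Instance

/-! ## The length of the instance -/

theorem length_blocks_le (u v : ℕ) : (blocks u v).length ≤ v * (v + 2) := by
  rcases le_total v u with h | h
  · simp [blocks_of_le h]
  induction v, h using Nat.le_induction with
  | base => simp [blocks_of_le]
  | succ v hv ih =>
    rw [blocks_succ hv, List.length_append]
    have : (blk v).length = v + 2 := by simp [blk]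
    rw [this]
    nlinarith

theorem length_flatMap_le {α β : Type*} {l : List α} {f : α → List β} {B : ℕ}
    (h : ∀ a ∈ l, (f a).length ≤ B) : (l.flatMap f).length ≤ l.length * B := by
  induction l with
  | nil => simp
  | cons a l ih =>
    rw [List.flatMap_cons, List.length_append, List.length_cons, Nat.succ_mul, add_comm]
    exact Nat.add_le_add (ih fun b hb => h b (by simp [hb])) (h a (by simp))

/-- A crude count: the numbers are at most K³, hence the strings have at most K⁷ symbols including
the separator, and there are at most K⁵ edges. Constants are absorbed by `2 ≤ K`. -/
theorem length_instWord_le {x : List SatSym} {K : ℕ} (hx : WellFormed x K) (hK : 2 ≤ K) {a b : ℕ}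
    (hb : b ≤ K) : (instWord x K a b).length ≤ K ^ 13 := by
  have hT := signsTo_le x K
  have hv : ∀ t q, t ≤ K → q ≤ K → t * K + q ≤ K ^ 3 := fun t q ht hq => by
    have : t * K ≤ K * K := Nat.mul_le_mul_right K ht
    nlinarith [Nat.mul_le_mul_right K (Nat.mul_le_mul hK hK)]
  have hblk : ∀ u v, v ≤ K ^ 3 → (blocks u v).length + 1 ≤ K ^ 7 := fun u v h => by
    have h1 := length_blocks_le u v
    have h3 : 8 ≤ K ^ 3 := by
      calc 8 = 2 ^ 3 := rfl
        _ ≤ _ := Nat.pow_le_pow_left hK 3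
    have h2 : v * (v + 2) ≤ K ^ 3 * (K ^ 3 + 2) := Nat.mul_le_mul h (by omega)
    calc _ ≤ K ^ 3 * (K ^ 3 + 2) + 1 := by omega
      _ ≤ 2 * (K ^ 3 * K ^ 3) := by nlinarith
      _ ≤ K * (K ^ 3 * K ^ 3) := Nat.mul_le_mul_right _ hK
      _ = K ^ 7 := by ring
  have hedges : (edges x K).length ≤ K ^ 5 := by
    refine (length_edges_le (B := K * 2 + 1) fun base p _ => ?_).trans ?_
    · rw [edgesFrom, List.length_cons]
      refine Nat.succ_le_succ ((length_flatMap_le (B := 2) fun c _ => ?_).trans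
        (Nat.mul_le_mul_right 2 (length_pairsTo_le K)))
      rw [clauseEdges, List.length_append]
      split_ifs <;> simp
    · calc _ ≤ K * (K * (K * 2 + 1)) := by gcongr
        _ ≤ K * (K * (K * K * K)) := by
          gcongr
          nlinarith [Nat.mul_le_mul hK hK, Nat.mul_le_mul_right K (Nat.mul_le_mul hK hK)]
        _ = K ^ 5 := by ring
  have hwords : ((edges x K).flatMap edgeWord).length ≤ K ^ 5 * K ^ 7 := by
    refine (length_flatMap_le (B := K ^ 7) fun e he => ?_).trans (Nat.mul_le_mul_right _ hedges)
    obtain ⟨t, p, q, ht, -, hp, hq, rfl⟩ := exists_of_mem_edges he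
    simpa [edgeWord] using hblk _ _ (hv (t + 1) q (by omega) (hx.le _ (hq.isSign hx hp)))
  have hw := hblk a _ (hv _ b hT hb)
  rw [instWord, List.length_append, List.length_map]
  calc _ ≤ K ^ 7 + K ^ 5 * K ^ 7 := by omega
    _ ≤ K ^ 5 * K ^ 7 + K ^ 5 * K ^ 7 := by
      gcongr
      exact Nat.le_mul_of_pos_left _ (by positivity)
    _ = 2 * (K ^ 5 * K ^ 7) := by ring
    _ ≤ K * (K ^ 5 * K ^ 7) := Nat.mul_le_mul_right _ hK
    _ = K ^ 13 := by ring


open Relation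

/-! ## Polynomial bounds -/

/-- Coefficients are absorbed by powers of `n ≥ 2`, as `a ≤ n ^ a`. -/
theorem exists_eval_le_pow (p : Polynomial ℕ) : ∃ D, ∀ n, 2 ≤ n → p.eval n ≤ n ^ D := by
  induction p using Polynomial.induction_on' with
  | add p q hp hq =>
    obtain ⟨D, hD⟩ := hp
    obtain ⟨E, hE⟩ := hq
    refine ⟨D + E + 1, fun n hn => ?_⟩
    have h1 := (hD n hn).trans (Nat.pow_le_pow_right (by omega) (Nat.le_add_right D E))
    have h2 := (hE n hn).trans (Nat.pow_le_pow_right (by omega) (Nat.le_add_left E D))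
    rw [Polynomial.eval_add, pow_succ]
    nlinarith [Nat.mul_le_mul_left (n ^ (D + E)) hn]
  | monomial k a =>
    refine ⟨a + k, fun n hn => ?_⟩
    rw [Polynomial.eval_monomial, pow_add]
    exact Nat.mul_le_mul_right _ ((Nat.lt_pow_self (n := a) (by omega : 1 < n)).le)

theorem eval_le_eval_of_le (p : Polynomial ℕ) {m n : ℕ} (h : m ≤ n) : p.eval m ≤ p.eval n := by
  rw [Polynomial.eval_eq_sum, Polynomial.eval_eq_sum]
  exact Finset.sum_le_sum fun i _ => Nat.mul_le_mul_left _ (Nat.pow_le_pow_left h i)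

theorem aeval_nonneg (p : Polynomial ℕ) {r : ℝ} (hr : 0 ≤ r) : 0 ≤ Polynomial.aeval r p := by
  rw [Polynomial.aeval_eq_sum_range]
  exact Finset.sum_nonneg fun i _ => by positivity

theorem aeval_le_aeval_of_le (p : Polynomial ℕ) {r s : ℝ} (hr : 0 ≤ r) (h : r ≤ s) :
    Polynomial.aeval r p ≤ Polynomial.aeval s p := by
  rw [Polynomial.aeval_eq_sum_range, Polynomial.aeval_eq_sum_range]
  exact Finset.sum_le_sum fun i _ => by gcongr

theorem logb_le_of_le_pow {m n D : ℕ} (hn : 2 ≤ n) (h : m ≤ n ^ D) :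
    Real.logb 2 m ≤ D * Real.logb 2 n := by
  rcases Nat.eq_zero_or_pos m with rfl | hm
  · have : 0 ≤ Real.logb 2 n := Real.logb_nonneg (by norm_num) (by exact_mod_cast (by omega : 1 ≤ n))
    simpa using by positivity
  · rw [← Real.logb_pow]
    exact Real.logb_le_logb_of_le (by norm_num) (by exact_mod_cast hm) (by exact_mod_cast h)

theorem logb_natCast_nonneg (n : ℕ) : 0 ≤ Real.logb 2 n := by
  rcases Nat.eq_zero_or_pos n with rfl | hn
  · simp
  · exact Real.logb_nonneg (by norm_num) (by exact_mod_cast hn)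

/-- The given exponent may be negative, so it is first replaced by a nonnegative `e`, which needs `n
≥ 1`. Then 63^e ≤ 63. -/
theorem rpow_le_of_le_sq {n m : ℕ} (hn : 1 ≤ n) (hnm : n ≤ 63 * m ^ 2) {δ e : ℝ} (hδ : δ ≤ e)
    (he : 0 ≤ e) (he' : e ≤ 1) : (n : ℝ) ^ δ ≤ 63 * (m : ℝ) ^ (2 * e) := by
  have h1 : (1 : ℝ) ≤ n := by exact_mod_cast hn
  have h2 : (n : ℝ) ≤ 63 * (m : ℝ) ^ (2 : ℝ) := by
    rw [Real.rpow_two]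
    exact_mod_cast hnm
  calc (n : ℝ) ^ δ ≤ (n : ℝ) ^ e := Real.rpow_le_rpow_of_exponent_le h1 hδ
    _ ≤ (63 * (m : ℝ) ^ (2 : ℝ)) ^ e := Real.rpow_le_rpow (by positivity) h2 he
    _ = 63 ^ e * (m : ℝ) ^ (2 * e) := by
      rw [Real.mul_rpow (by norm_num) (by positivity), Real.rpow_mul (by positivity)]
    _ ≤ 63 ^ (1 : ℝ) * (m : ℝ) ^ (2 * e) := by
      gcongr
      norm_num
    _ = _ := by rw [Real.rpow_one]

/-- The space used by the given machine on the instance, in terms of the formula. -/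
theorem space_le {n m N N' : ℕ} (hn : 1 ≤ n) (hnm : n ≤ 63 * m ^ 2) (hN : 2 ≤ N)
    (hN' : N' ≤ (N + 1) ^ 13) {δ e : ℝ} (hδ : δ ≤ e) (he : 0 ≤ e) (he' : e ≤ 1) (C : ℝ)
    (q : Polynomial ℕ) :
    C * (n : ℝ) ^ δ * Polynomial.aeval (Real.logb 2 N') q ≤
      (m : ℝ) ^ (2 * e) * (63 * ⌈|C|⌉₊ * Polynomial.aeval (26 * Real.logb 2 N) q) := by
  have h1 := rpow_le_of_le_sq hn hnm hδ he he'
  have h2 : C ≤ ⌈|C|⌉₊ := (le_abs_self C).trans (Nat.le_ceil _)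
  have h3 : Polynomial.aeval (Real.logb 2 N') q ≤ Polynomial.aeval (26 * Real.logb 2 N) q := by
    refine aeval_le_aeval_of_le q (logb_natCast_nonneg _) ?_
    -- N + 1 ≤ N² for N ≥ 2, and 26 = 2 · 13.
    have : N' ≤ N ^ 26 := hN'.trans <| by
      rw [show N ^ 26 = (N ^ 2) ^ 13 by ring]
      exact Nat.pow_le_pow_left (by nlinarith) 13
    exact_mod_cast logb_le_of_le_pow hN this
  have h4 := aeval_nonneg q (logb_natCast_nonneg N')
  calc _ ≤ (⌈|C|⌉₊ : ℝ) * (63 * (m : ℝ) ^ (2 * e)) *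
        Polynomial.aeval (26 * Real.logb 2 N) q := by gcongr
    _ = _ := by ring

/-! ## The reduction -/

instance {A : Type} [Finite A] : Finite (InCell A) := by
  refine Finite.of_injective (β := Option (Option A)) (fun c => match c with
    | .leftEnd => none
    | .rightEnd => some none
    | .sym a => some (some a)) ?_
  intro a b h
  cases a <;> cases b <;> simp_all

instance : Finite SatSym := by
  refine Finite.of_injective (β := Option (Bool × Bool)) (fun s => match s with
    | .bit b => some (false, b)
    | .sign b => some (true, b)
    | .endClause => none) ?_
  intro a b h
  cases a <;> cases b <;> simp_all

instance : Finite IdxSym := by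
  refine Finite.of_injective (β := Option Bool) (fun s => match s with
    | .bit b => some b
    | .endIndex => none) ?_
  intro a b h
  cases a <;> cases b <;> simp_all

instance : Finite Dir := by
  refine Finite.of_injective (β := Option Bool) (fun s => match s with
    | .left => some false
    | .stay => none
    | .right => some true) ?_
  intro a b h
  cases a <;> cases b <;> simp_all

section Reduction

variable {S : Type} {M : Machine (Option S) (Option IdxSym)}

instance [Finite S] : Finite (Store S M) := by
  have := M.finiteQ
  have := M.finiteΓ
  refine Finite.of_injective (fun s : Store S M => ((s.q, s.sym, s.found, s.first, s.act),
    (s.cx, s.cy, s.neg), (s.hasLit, s.res, s.bad))) ?_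
  rintro ⟨⟩ ⟨⟩ h
  simp only [Prod.mk.injEq] at h
  obtain ⟨⟨rfl, rfl, rfl, rfl, rfl⟩, ⟨rfl, rfl, rfl⟩, rfl, rfl, rfl⟩ := h
  rfl

/-- The initial store. -/
def Store.initial (M : Machine (Option S) (Option IdxSym)) : Store S M where
  q := M.start
  sym := .leftEnd
  found := false
  first := none
  act := none
  cx := .leftEnd
  cy := .leftEnd
  neg := none
  hasLit := false
  res := false
  bad := false

/-- A solution is written with at least one symbol, so the first symbol of the output always tells
whether there is a solution. -/
theorem encodeIndices_ne_nil {n : ℕ} {is : List (Fin n)} (h : is ≠ []) :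
    encodeIndices is ≠ [] := by
  cases is with
  | nil => exact absurd rfl h
  | cons i is => simp [encodeIndices]

/-- By the time K^d the machine has halted with its complete output, which begins with `none` for ⊥
and with `some` for a solution. -/
theorem solves_iff (hM : (searchUOCK S).SolvedBy M) {sy : Bool → S}
    (hsy : Function.Injective sy) {x : List SatSym} {K : ℕ} (hx : WellFormed x K) {d a b : ℕ}
    (ha : (scan x a).isSign = true) (hb : (scan x b).isSign = true)
    (hh : M.HaltsWithin ((instWord x K a b).map (Option.map sy)) (K ^ d)) :
    solves x K M sy d a b = true ↔ ReflTransGen (Step x K) a b := by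
  have hM := hM (knapsack hsy hx ha b)
  rw [encode_knapsack] at hM
  rw [← sol_knapsack_nonempty_iff hsy hx ha hb, solves, beq_iff_eq]
  constructor
  · intro h
    by_contra hne
    obtain ⟨t, ht, hout⟩ := hM.2 (Set.not_nonempty_iff_eq_empty.1 hne)
    rw [Machine.run_eq_run_of_halted hh ht, hout] at h
    simp at h
  · intro h
    obtain ⟨y, ⟨is, his, rfl⟩, t, ht, hout⟩ := hM.1 h
    rw [Machine.run_eq_run_of_halted hh ht, hout]
    cases he : encodeIndices is with
    | nil => exact absurd he (encodeIndices_ne_nil his.1)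
    | cons s l => simp

theorem two_le_length_encode (φ : TwoSat3Inst) : 2 ≤ (twoSat3.encode φ).length := by
  obtain ⟨c, cs, h⟩ := List.exists_cons_of_ne_nil φ.clauses_ne
  have hc := (φ.clause_len c (by simp [h])).1
  obtain ⟨l, ls, rfl⟩ := List.exists_cons_of_length_pos hc
  simp only [twoSat3, h, List.flatMap_cons, encodeClause, encodeLiteral, List.length_append,
    List.length_cons]
  omega

theorem one_le_numVars (φ : TwoSat3Inst) : 1 ≤ φ.numVars := by
  obtain ⟨c, cs, h⟩ := List.exists_cons_of_ne_nil φ.clauses_ne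
  have hc := (φ.clause_len c (by simp [h])).1
  obtain ⟨l, ls, rfl⟩ := List.exists_cons_of_length_pos hc
  exact Finset.card_pos.2 ⟨l.1, by simp [varOccurrences, h]⟩

/-- A machine for the knapsack problem whose space is bounded by `H φ` on the instances for the
formula `φ` yields a machine for satisfiability. -/
theorem exists_machine_twoSat3 [Finite S] (hM : (searchUOCK S).SolvedBy M) {p : Polynomial ℕ}
    (hp : ∀ y, M.HaltsWithin ((searchUOCK S).encode y) (p.eval ((searchUOCK S).encode y).length))
    {H : TwoSat3Inst → ℕ}
    (hH : ∀ φ y, 1 ≤ (searchUOCK S).size y → (searchUOCK S).size y ≤ 63 * φ.numVars ^ 2 →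
      ((searchUOCK S).encode y).length ≤ ((twoSat3.encode φ).length + 1) ^ 13 →
      ∀ t i, (M.run ((searchUOCK S).encode y) t).workPos i + 1 ≤ H φ)
    {sy : Bool → S} (hsy : Function.Injective sy) :
    ∃ (M' : Machine SatSym Empty) (P Q : Polynomial ℕ), twoSat3.SolvedBy M' ∧
      ∀ φ, M'.HaltsWithin (twoSat3.encode φ) (P.eval (twoSat3.encode φ).length) ∧
        ∀ t i, (M'.run (twoSat3.encode φ) t).workPos i ≤
          max (Nat.log 2 (Q.eval (twoSat3.encode φ).length)) (H φ) := by
  have := M.finiteΓ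
  obtain ⟨D, hD⟩ := exists_eval_le_pow p
  -- The instance has at most K^13 symbols and `M` takes at most n^D steps on n ≥ 2 symbols, so
  -- K^(13D) simulated steps suffice. The new machine accepts if no contradictory cycle has been
  -- found.
  obtain ⟨M', P, Q, h⟩ := (searchCycle sy (13 * D) : RProg S M).exists_machine (Store.initial M)
    fun s => s.bad = false
  have key : ∀ φ : TwoSat3Inst,
      (((searchCycle sy (13 * D) : RProg S M).eval (twoSat3.encode φ)
        ((twoSat3.encode φ).length + 1) (.initial _ _ _ (Store.initial M))).st.bad = false ↔
          φ.Satisfiable) ∧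
      ((searchCycle sy (13 * D) : RProg S M).eval (twoSat3.encode φ)
        ((twoSat3.encode φ).length + 1) (.initial _ _ _ (Store.initial M))).hw ≤ H φ := by
    intro φ
    obtain ⟨x, hx⟩ : ∃ x, x = twoSat3.encode φ := ⟨_, rfl⟩
    have hwf := wellFormed_encode φ hx
    have hlen := two_le_length_encode φ
    have hedges := length_edges_encode_le φ hx
    have hsat := satisfiable_iff_acyclic φ hx
    have hHφ := hH φ
    rw [← hx] at hlen hHφ ⊢
    set K := x.length + 1 with hK
    have hK2 : 2 ≤ K := by omega
    have hword : ∀ a b, (scan x b).isSign = true → (instWord x K a b).length ≤ K ^ 13 :=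
      fun a b hb => length_instWord_le hwf hK2 (hwf.le b hb)
    have hhalt : ∀ a b, (scan x a).isSign = true → (scan x b).isSign = true →
        M.HaltsWithin ((instWord x K a b).map (Option.map sy)) (K ^ (13 * D)) := by
      intro a b ha hb
      have := hp (knapsack hsy hwf ha b)
      rw [encode_knapsack] at this
      refine this.mono ?_
      rw [List.length_map, pow_mul]
      exact (eval_le_eval_of_le p (hword a b hb)).trans
        (hD _ (hK2.trans (Nat.le_self_pow (by norm_num) K)))
    have hspace : ∀ a b, (scan x a).isSign = true → (scan x b).isSign = true → ∀ t i,
        (M.run ((instWord x K a b).map (Option.map sy)) t).workPos i + 1 ≤ H φ := by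
      intro a b ha hb
      have := hHφ (knapsack hsy hwf ha b)
      rw [encode_knapsack, size_knapsack, List.length_map] at this
      exact this (List.length_pos_iff.2 (edges_ne_nil hwf ha)) hedges (hword a b hb)
    obtain ⟨h1, h2⟩ := searchCycle_spec x K sy (13 * D) (M := M) (H := H φ)
      (s := .initial _ _ _ (Store.initial M)) hK2 rfl (Nat.zero_le _) (fun i j hij t l => by
        obtain ⟨hi, hj⟩ := isSign_of_negAt hij
        exact ⟨hspace i j hi hj t l, hspace j i hj hi t l⟩)
    refine ⟨?_, h2⟩
    rw [hsat, ← Bool.not_eq_true, h1, not_iff_not]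
    constructor
    · rintro ⟨i, -, j, -, hij⟩
      simp only [cyclic, Bool.and_eq_true] at hij
      obtain ⟨hn, g1, g2⟩ := hij
      obtain ⟨hi, hj⟩ := isSign_of_negAt hn
      exact ⟨_, _, hn, (solves_iff hM hsy hwf hi hj (hhalt _ _ hi hj)).1 g1,
        (solves_iff hM hsy hwf hj hi (hhalt _ _ hj hi)).1 g2⟩
    · rintro ⟨a, b, hn, g1, g2⟩
      obtain ⟨ha, hb⟩ := isSign_of_negAt hn
      obtain ⟨i, rfl⟩ := Nat.exists_eq_add_of_le' (pos_of_isSign ha)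
      obtain ⟨j, rfl⟩ := Nat.exists_eq_add_of_le' (pos_of_isSign hb)
      refine ⟨i, hwf.le _ ha, j, hwf.le _ hb, ?_⟩
      simp only [cyclic, Bool.and_eq_true]
      exact ⟨hn, (solves_iff hM hsy hwf ha hb (hhalt _ _ ha hb)).2 g1,
        (solves_iff hM hsy hwf hb ha (hhalt _ _ hb ha)).2 g2⟩
  refine ⟨M', P, Q, fun φ => ?_, fun φ => ⟨(h _).1, fun t i => ?_⟩⟩
  · rw [(h _).2.2]
    exact (key φ).1
  · exact ((h _).2.1 t i).trans (max_le_max le_rfl (key φ).2)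

end Reduction

end SubLin

/-- If the linear space hypothesis for 2SAT₃ holds, then, over every finite alphabet with at least
two symbols, for every `ε > 0` no polynomial-time algorithm solves the unique ordered concatenation
knapsack search problem with `n` strings in space `O(n^(1/2-ε))`, not even up to a polylogarithmic
factor in the input length (the constant function `1` is a polylogarithmic function). -/
theorem theorem7 (hLSH : SubLin.LinearSpaceHypothesis SubLin.twoSat3)
    (S : Type) (hfin : Finite S) (hS : 2 ≤ Nat.card S)
    (ε : ℝ) (hε : 0 < ε) (ℓ : ℕ → ℝ) (hℓ : SubLin.IsPolylog ℓ) :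
    ¬ ∃ C : ℝ, (SubLin.searchUOCK S).SolvableInPolyTimeSpace
        (fun n N => C * (n : ℝ) ^ (1 / 2 - ε) * ℓ N) := by
  open SubLin in
  rintro ⟨C, M, p, hM, hres⟩
  obtain ⟨q, hq⟩ := hℓ
  have : Nontrivial S := (Finite.one_lt_card_iff_nontrivial).1 hS
  obtain ⟨s₀, s₁, hs⟩ := exists_pair_ne S
  have hsy : Function.Injective fun b : Bool => if b then s₁ else s₀ := by
    intro a b h
    cases a <;> cases b <;> simp_all
  -- For large ε the exponent 1/2 - ε is not positive; the maximum with 1/4 ensures that 2e lies in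
  -- (0, 1).
  obtain ⟨e, he, hδ, he'⟩ : ∃ e : ℝ, 0 < e ∧ 1 / 2 - ε ≤ e ∧ e < 1 / 2 :=
    ⟨max (1 / 2 - ε) (1 / 4), by positivity, le_max_left _ _, max_lt (by linarith) (by norm_num)⟩
  let B : TwoSat3Inst → ℝ := fun φ => (φ.numVars : ℝ) ^ (2 * e) *
    (63 * ⌈|C|⌉₊ * Polynomial.aeval (26 * Real.logb 2 (twoSat3.encode φ).length) q)
  have hB0 : ∀ φ, 0 ≤ B φ := fun φ => by
    have := aeval_nonneg q (r := 26 * Real.logb 2 (twoSat3.encode φ).length)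
      (mul_nonneg (by norm_num) (logb_natCast_nonneg _))
    positivity
  obtain ⟨M', P, Q, h1, h2⟩ := exists_machine_twoSat3 (H := fun φ => ⌊B φ⌋₊) hM
    (fun y => (hres y).1) (fun φ y g1 g2 g3 t i => by
      refine Nat.le_floor (((hres y).2 t i).trans ?_)
      simp only [hq]
      exact space_le g1 g2 (two_le_length_encode φ) g3 hδ he.le (by linarith) C q) hsy
  obtain ⟨D, hD⟩ := exists_eval_le_pow Q
  -- The polylogarithmic factor has three parts: `D · log N` for the stacks that hold numbers, the
  -- bound for the simulated tapes, and 1 because a head in position h has used h + 1 cells.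
  refine hLSH (2 * e) (by linarith) (by linarith) _ ⟨.C D * .X + .C (63 * ⌈|C|⌉₊) *
    q.comp (.C 26 * .X) + 1, fun _ => rfl⟩ ⟨M', P, h1, fun φ => ⟨(h2 φ).1, fun t i => ?_⟩⟩
  have hw := (h2 φ).2 t i
  set N := (twoSat3.encode φ).length with hN
  have hm : (1 : ℝ) ≤ (φ.numVars : ℝ) ^ (2 * e) :=
    Real.one_le_rpow (by exact_mod_cast one_le_numVars φ) (by linarith)
  have hlog : ((Nat.log 2 (Q.eval N) : ℕ) : ℝ) ≤ D * Real.logb 2 N :=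
    (Real.natLog_le_logb _ _).trans (logb_le_of_le_pow (two_le_length_encode φ)
      (hD N (two_le_length_encode φ)))
  have hlog0 : 0 ≤ D * Real.logb 2 N := mul_nonneg (by positivity) (logb_natCast_nonneg N)
  have hw' : (((M'.run (twoSat3.encode φ) t).workPos i : ℕ) : ℝ) ≤ D * Real.logb 2 N + B φ := by
    refine (Nat.cast_le.2 hw).trans ?_
    rw [Nat.cast_max]
    exact max_le (by linarith [hB0 φ]) (by linarith [Nat.floor_le (hB0 φ)])
  simp only [map_add, map_mul, map_one, Polynomial.aeval_C, Polynomial.aeval_X,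
    Polynomial.aeval_comp]
  have hBφ : B φ = (φ.numVars : ℝ) ^ (2 * e) *
    (63 * ⌈|C|⌉₊ * Polynomial.aeval (26 * Real.logb 2 N) q) := rfl
  rw [hBφ] at hw'
  -- There is at least one variable, so m^(2e) ≥ 1 and the logarithm may be multiplied by it, as the
  -- form of the space bound demands.
  have : D * Real.logb 2 N ≤ (φ.numVars : ℝ) ^ (2 * e) * (D * Real.logb 2 N) :=
    le_mul_of_one_le_left hlog0 hm
  push_cast
  simp only [eq_natCast, Nat.cast_ofNat, mul_add, mul_one]
  change _ ≤ (φ.numVars : ℝ) ^ (2 * e) * _ + (φ.numVars : ℝ) ^ (2 * e) * _ +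
    (φ.numVars : ℝ) ^ (2 * e)
  linarith
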